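/- Conventions. An $\infty$-category is a quasicategory and a functor is a map of simplicial sets. A categorical equivalence of $\infty$-categories is a functor with an inverse up to natural equivalence, and two functors $p\colon X\to S$ and $p'\colon X'\to S'$ of $\infty$-categories are categorically equivalent if there are categorical equivalences $a\colon X\to X'$, $b\colon S\to S'$ with $p'a=bp$. For an inner fibration $p\colon X\to S$, an edge $e$ of $X$ is $p$-Cartesian if for every $n\ge 2$ each lifting problem for $\Lambda^n_n\subset\Delta^n$ against $p$ that sends the edge $\Delta^{\{n-1,n\}}$ to $e$ has a solution. A Cartesian inner fibration is an inner fibration $p\colon X\to S$ such that every edge $s\to p(y)$ of $S$ lifts to a $p$-Cartesian edge of $X$ with target $y$. A functor of $\infty$-categories is called a Cartesian fibration if it is categorically equivalent to a Cartesian inner fibration between $\infty$-categories, and a right fibration if it is categorically equivalent to a map between $\infty$-categories that has the right lifting property with respect to $\Lambda^n_i\subset\Delta^n$ for all $0<i\le n$. For an arbitrary functor $p\colon X\to S$ of $\infty$-categories let $J$ be the nerve of the category with two objects $0,1$ and exactly one morphism between any two objects, and let $\tilde p\colon\tilde X=X\times_S S^{J}\to S$ be its isofibrant replacement, whose objects are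 pairs $(x,\,p(x)\simeq s)$, mapped to $s$ (the pullback is along evaluation at $0$, and $\tilde p$ is evaluation at $1$). An edge of $X$ is called $p$-Cartesian if its image in $\tilde X$ (with constant equivalence) is $\tilde p$-Cartesian; the fibre $X_c$ of $p$ at $c\in S$ is the fibre of $\tilde p$ at $c$; and a commutative square in $X$ lies over a square in $S$ if it is given with a lift to $\tilde X$ that is mapped to that square by $\tilde p$. Proposition. (a) Let $\mathcal{E},\mathcal{D},\mathcal{C}$ be $\infty$-categories and let $f\colon\mathcal{E}\to\mathcal{D}$, $p\colon\mathcal{E}\to\mathcal{C}$, $q\colon\mathcal{D}\to\mathcal{C}$ be functors with $q\circ f=p$ such that: 1. $p$ and $q$ are Cartesian fibrations. 2. $f$ takes $p$-Cartesian edges to $q$-Cartesian edges. 3. For each object $c\in\mathcal{C}$ the induced map on fibres $f_c\colon\mathcal{E}_c\to\mathcal{D}_c$ is a Cartesian fibration. 4. Let $\phi\colon c'\to c$ be an edge of $\mathcal{C}$, and suppose given a commutative square in $\mathcal{E}$ with top side $\alpha\colon\phi^*e'\to e'$, left side $\beta\colon\phi^*e'\to\phi^*e$, right side $\gamma\colon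 e'\to e$ and bottom side $\delta\colon\phi^*e\to e$, lying over the degenerate square in $\mathcal{C}$ whose top and bottom sides are $\phi$ and whose left and right sides are $\mathrm{id}_{c'}$ and $\mathrm{id}_c$. If $\alpha$ and $\delta$ are $p$-Cartesian and $\gamma$ is $f_c$-Cartesian, then $\beta$ is $f_{c'}$-Cartesian. (In other words, $\phi^*\colon\mathcal{E}_c\to\mathcal{E}_{c'}$ takes $f_c$-Cartesian edges to $f_{c'}$-Cartesian edges.) Then $f$ is a Cartesian fibration. (b) Let $\mathcal{A},\mathcal{B},\mathcal{C}$ be $\infty$-categories and let $f\colon\mathcal{A}\to\mathcal{B}$, $p\colon\mathcal{A}\to\mathcal{C}$, $q\colon\mathcal{B}\to\mathcal{C}$ be functors with $q\circ f=p$. If $p$ and $q$ are right fibrations, then $f$ is a right fibration. -/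

import Mathlib

open CategoryTheory Simplicial Limits MonoidalCategory CartesianMonoidalCategory

universe u

namespace ICat

noncomputable section

open SSet

/-! ### Equivalences of functors and of quasicategories

Here `coherentIso` is the nerve of the category with two objects and exactly one morphism between
any two objects; `coherentIso.x₀` and `coherentIso.x₁` are its two vertices. -/

/-- Two functors `f, g : X ⟶ Y` are naturally equivalent: they are the two ends of a map
`coherentIso ⊗ X ⟶ Y`. -/
def NatEquivalent {X Y : SSet.{u}} (f g : X ⟶ Y) : Prop :=
  ∃ h : coherentIso.{u} ⊗ X ⟶ Y,
    lift (SSet.const coherentIso.x₀.{u}) (𝟙 X) ≫ h = f ∧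
    lift (SSet.const coherentIso.x₁.{u}) (𝟙 X) ≫ h = g

/-- A functor (between quasicategories) is a categorical equivalence if it has an inverse
up to natural equivalence. -/
def IsCategoricalEquivalence {X Y : SSet.{u}} (f : X ⟶ Y) : Prop :=
  ∃ g : Y ⟶ X, NatEquivalent (f ≫ g) (𝟙 X) ∧ NatEquivalent (g ≫ f) (𝟙 Y)

/-- `p` and `p'` are categorically equivalent as functors: there is a commutative square
from `p` to `p'` whose two other sides are categorical equivalences. -/
def EquivalentFunctors {X S X' S' : SSet.{u}} (p : X ⟶ S) (p' : X' ⟶ S') : Prop :=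
  ∃ (a : X ⟶ X') (b : S ⟶ S'),
    IsCategoricalEquivalence a ∧ IsCategoricalEquivalence b ∧ a ≫ p' = p ≫ b

/-! ### Cartesian inner fibrations -/

/-- The edge `n + 1 ⟶ n + 2` of the outer horn `Λ[n + 2, n + 2]`. -/
def lastEdge (n : ℕ) : (Λ[n + 2, Fin.last (n + 2)] : SSet.{u}) _⦋1⦌ :=
  horn.edge (n + 2) (Fin.last (n + 2)) (Fin.last (n + 1)).castSucc (Fin.last (n + 2))
    (Fin.le_last _)
    (by
      rw [Finset.insert_comm, Finset.pair_eq_singleton]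
      exact Finset.card_le_two.trans (by omega))

/-- The lifting condition that says, for an *inner fibration* `p`, that the edge `e` is
`p`-Cartesian: for `n ≥ 2`, every lifting problem for `Λ[n, n] ⟶ Δ[n]` against `p` in which the
last edge of the horn is sent to `e` has a solution. -/
def IsCartesianLift {X S : SSet.{u}} (p : X ⟶ S) (e : X _⦋1⦌) : Prop :=
  ∀ (n : ℕ) (σ : (Λ[n + 2, Fin.last (n + 2)] : SSet.{u}) ⟶ X) (τ : Δ[n + 2] ⟶ S),
    σ ≫ p = Λ[n + 2, Fin.last (n + 2)].ι ≫ τ → σ.app _ (lastEdge n) = e →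
      ∃ l : Δ[n + 2] ⟶ X, Λ[n + 2, Fin.last (n + 2)].ι ≫ l = σ ∧ l ≫ p = τ

/-- Cartesian inner fibrations: inner fibrations `p : X ⟶ S` such that every edge of `S` whose
target is the image of a vertex `y` of `X` lifts to a `p`-Cartesian edge with target `y`. -/
def IsCartesianInnerFibration {X S : SSet.{u}} (p : X ⟶ S) : Prop :=
  InnerFibration p ∧
    ∀ (y : X _⦋0⦌) (v : S _⦋1⦌), S.δ 0 v = p.app _ y →
      ∃ e : X _⦋1⦌, X.δ 0 e = y ∧ p.app _ e = v ∧ IsCartesianLift p e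

/-- Right fibrations of simplicial sets, in the strict sense: the right lifting property against
`Λ[n, i] ⟶ Δ[n]` for `0 < i ≤ n`. -/
def IsStrictRightFibration {X S : SSet.{u}} (p : X ⟶ S) : Prop :=
  ∀ (n : ℕ) (i : Fin (n + 2)), 0 < i → HasLiftingProperty (Λ[n + 1, i] : Δ[n + 1].Subcomplex).ι p

/-! ### The invariant notions -/

/-- A functor of quasicategories is a Cartesian fibration if it is categorically equivalent to
a Cartesian inner fibration of quasicategories. -/
def IsCartesianFibration {X S : SSet.{u}} (p : X ⟶ S) : Prop :=
  ∃ (X' S' : SSet.{u}) (p' : X' ⟶ S'), Quasicategory X' ∧ Quasicategory S' ∧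
    IsCartesianInnerFibration p' ∧ EquivalentFunctors p p'

/-- A functor of quasicategories is a right fibration (in the invariant sense) if it is
categorically equivalent to a strict right fibration of quasicategories. -/
def IsRightFibration {X S : SSet.{u}} (p : X ⟶ S) : Prop :=
  ∃ (X' S' : SSet.{u}) (p' : X' ⟶ S'), Quasicategory X' ∧ Quasicategory S' ∧
    IsStrictRightFibration p' ∧ EquivalentFunctors p p'

/-- Evaluation at a vertex `j` of `coherentIso`, on the quasicategory of equivalences in `S`. -/
def evalAt (S : SSet.{u}) (j : coherentIso.{u} _⦋0⦌) : (ihom coherentIso.{u}).obj S ⟶ S :=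
  lift (SSet.const j) (𝟙 _) ≫ (ihom.ev coherentIso.{u}).app S

/-- The isofibrant replacement of `p : X ⟶ S`: its objects are pairs of an object `x` of `X`
and an equivalence in `S` from `p x` to some object of `S`. -/
def Repl {X S : SSet.{u}} (p : X ⟶ S) : SSet.{u} :=
  pullback p (evalAt S coherentIso.x₀)

/-- The projection `(x, p x ≃ s) ↦ x`. -/
def Repl.source {X S : SSet.{u}} (p : X ⟶ S) : Repl p ⟶ X :=
  pullback.fst p (evalAt S coherentIso.x₀)

/-- The isofibration `(x, p x ≃ s) ↦ s`. -/
def Repl.proj {X S : SSet.{u}} (p : X ⟶ S) : Repl p ⟶ S :=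
  pullback.snd p (evalAt S coherentIso.x₀) ≫ evalAt S coherentIso.x₁

/-- The functor `x ↦ (x, id_{p x})`, an equivalence from `X` to the replacement. -/
def Repl.incl {X S : SSet.{u}} (p : X ⟶ S) : X ⟶ Repl p :=
  pullback.lift (𝟙 X) (p ≫ MonoidalClosed.curry (snd coherentIso.{u} S)) (by
    have h : MonoidalClosed.curry (snd coherentIso.{u} S) ≫ evalAt S coherentIso.x₀ = 𝟙 S := by
      have h' : MonoidalClosed.curry (snd coherentIso.{u} S) ≫
          lift (SSet.const coherentIso.x₀.{u}) (𝟙 _) =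
          lift (SSet.const coherentIso.x₀.{u}) (𝟙 _) ≫
            coherentIso.{u} ◁ MonoidalClosed.curry (snd coherentIso.{u} S) := by
        ext1 <;> simp
      rw [evalAt, ← Category.assoc, h', Category.assoc, ← MonoidalClosed.uncurry_eq,
        MonoidalClosed.uncurry_curry, lift_snd]
    rw [Category.id_comp, Category.assoc, h, Category.comp_id])

/-- The functor `(x, p x ≃ s) ↦ (f x, q (f x) ≃ s)` induced by a functor `f` over `S`. -/
def Repl.map {X Y S : SSet.{u}} {p : X ⟶ S} {q : Y ⟶ S} (f : X ⟶ Y) (w : f ≫ q = p) :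
    Repl p ⟶ Repl q :=
  pullback.lift (Repl.source p ≫ f) (pullback.snd p (evalAt S coherentIso.x₀)) (by
    rw [Category.assoc, w]; exact pullback.condition)

theorem Repl.map_proj {X Y S : SSet.{u}} {p : X ⟶ S} {q : Y ⟶ S} (f : X ⟶ Y) (w : f ≫ q = p) :
    Repl.map f w ≫ Repl.proj q = Repl.proj p := by
  unfold Repl.map Repl.proj
  erw [pullback.lift_snd_assoc]

/-- An edge `e` of `X` is `p`-Cartesian, for an arbitrary functor `p` of quasicategories, if
after replacing `p` by an isofibration (in particular, an inner fibration) over `S` the edge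
corresponding to `e` is Cartesian. -/
def IsCartesianEdge {X S : SSet.{u}} (p : X ⟶ S) (e : X _⦋1⦌) : Prop :=
  IsCartesianLift (Repl.proj p) ((Repl.incl p).app _ e)

/-- The fibre of the functor `p` at `c`, in the invariant sense: its objects are the
objects `x` of `X` with an equivalence `p x ≃ c` in `S`. -/
def Fibre {X S : SSet.{u}} (p : X ⟶ S) (c : S _⦋0⦌) : SSet.{u} :=
  pullback (Repl.proj p) (SSet.const c : Δ[0] ⟶ S)

/-- The inclusion of the fibre into the replacement of `p`. -/
def Fibre.ι {X S : SSet.{u}} (p : X ⟶ S) (c : S _⦋0⦌) : Fibre p c ⟶ Repl p :=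
  pullback.fst (Repl.proj p) (SSet.const c : Δ[0] ⟶ S)

/-- The functor on fibres over `c` induced by a functor over `S`. -/
def Fibre.map {X Y S : SSet.{u}} {p : X ⟶ S} {q : Y ⟶ S} (f : X ⟶ Y) (w : f ≫ q = p)
    (c : S _⦋0⦌) : Fibre p c ⟶ Fibre q c :=
  pullback.lift (Fibre.ι p c ≫ Repl.map f w)
    (pullback.snd (Repl.proj p) (SSet.const c : Δ[0] ⟶ S)) (by
      rw [Category.assoc, Repl.map_proj]; exact pullback.condition)

/-! ### The transition functors

A square in a simplicial set is a map out of `Δ[1] ⊗ Δ[1]`; the first coordinate is drawn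
horizontally and the second one vertically (downwards). -/

/-- The top side of a square. -/
def sqTop {X : SSet.{u}} (s : (Δ[1] ⊗ Δ[1] : SSet.{u}) ⟶ X) : X _⦋1⦌ :=
  yonedaEquiv (lift (𝟙 _) (SSet.const (stdSimplex.obj₀Equiv.symm 0)) ≫ s)

/-- The bottom side of a square. -/
def sqBottom {X : SSet.{u}} (s : (Δ[1] ⊗ Δ[1] : SSet.{u}) ⟶ X) : X _⦋1⦌ :=
  yonedaEquiv (lift (𝟙 _) (SSet.const (stdSimplex.obj₀Equiv.symm 1)) ≫ s)

/-- The left side of a square. -/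
def sqLeft {X : SSet.{u}} (s : (Δ[1] ⊗ Δ[1] : SSet.{u}) ⟶ X) : X _⦋1⦌ :=
  yonedaEquiv (lift (SSet.const (stdSimplex.obj₀Equiv.symm 0)) (𝟙 _) ≫ s)

/-- The right side of a square. -/
def sqRight {X : SSet.{u}} (s : (Δ[1] ⊗ Δ[1] : SSet.{u}) ⟶ X) : X _⦋1⦌ :=
  yonedaEquiv (lift (SSet.const (stdSimplex.obj₀Equiv.symm 1)) (𝟙 _) ≫ s)

/-- The transition functors of `p` preserve the edges that are Cartesian for the functors induced
by `f` on fibres: for every commutative square with sides `α` (top), `β` (left), `γ` (right), `δ`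
(bottom) in (the replacement of) the source of `p`, lying over the degenerate square with
horizontal sides `φ : c' ⟶ c` and vertical sides `id_{c'}` and `id_c`, if `α` and `δ` are
`p`-Cartesian and `γ` is `f_c`-Cartesian, then `β` is `f_{c'}`-Cartesian. -/
def TransitionPreservesCartesian {X Y S : SSet.{u}} {p : X ⟶ S} {q : Y ⟶ S} (f : X ⟶ Y)
    (w : f ≫ q = p) : Prop :=
  ∀ (c' c : S _⦋0⦌) (φ : SSet.Edge c' c) (s : (Δ[1] ⊗ Δ[1] : SSet.{u}) ⟶ Repl p)
    (β : (Fibre p c') _⦋1⦌) (γ : (Fibre p c) _⦋1⦌),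
    s ≫ Repl.proj p = fst Δ[1] Δ[1] ≫ yonedaEquiv.symm φ.edge →
    (Fibre.ι p c').app _ β = sqLeft s →
    (Fibre.ι p c).app _ γ = sqRight s →
    IsCartesianEdge p (sqTop (s ≫ Repl.source p)) →
    IsCartesianEdge p (sqBottom (s ≫ Repl.source p)) →
    IsCartesianEdge (Fibre.map f w c) γ →
    IsCartesianEdge (Fibre.map f w c') β

end

end ICat

/-!
Both parts are proved for isofibrations first and then transported to arbitrary functors of
quasicategories.

*Isofibrations.* An isofibration is an inner fibration with the right lifting property against
`{x₀} ⟶ coherentIso`. The pushout-product of `{x₀} ⟶ coherentIso` with the boundary inclusion of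
`Δ[n]` is inner anodyne for `n > 0` (`JPrism.innerAnodyneExtensions_base_ι`), so that homotopies
extend along monomorphisms and lift along isofibrations (`IsIsofibration.exists_homotopy₀`).
It follows that an isofibration which is a categorical equivalence is a trivial fibration
(`IsIsofibration.isTrivialFibration`). If `p` is categorically equivalent to `p'`, their isofibrant
replacements are linked by a pullback and trivial fibrations (`exists_trivial_zigzag_repl`), and
lifting properties pass through both. Hence the replacement of a Cartesian or right fibration has
the strict lifting property (`IsCartesianFibration.hasCartesianLifts`,
`IsRightFibration.isStrictRightFibration`), and Cartesian edges are invariant under equivalence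
(`IsCartesian.of_homotopy`).

*Reduction.* A functor `f` over `S` from `p` to `q` is equivalent to an isofibration `relRepl f w`
over the replacement of `q`: a point of its source is a point of the replacement of `p` together
with an equivalence out of its image which is constant over `S`. The composite with the replacement
of `q` is the replacement of `p` up to a trivial fibration, and the restriction of `relRepl f w` to
the fibres over an object `c` of `S` is the isofibrant replacement of the functor induced by `f` on
these fibres (`exists_isPullback_relRepl`). It remains to treat an isofibration `f : E ⟶ D` over an
isofibration `q : D ⟶ C`.

*Cartesian fibrations* (`hasCartesianLifts_of_fibrewise`). Given an edge `v` of `D` and a lift of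
its target, let `α` be a lift of `v ≫ q` that is Cartesian over `C`. Its image in `D` is Cartesian
over `C`, so `v` factors as an edge in a fibre of `q` followed by the image of `α`. Let `β` be a
fibrewise Cartesian lift of the former edge. The composite of `β` and `α` is Cartesian with respect
to `f`. Indeed, a horn in `E` with this last edge, and the simplex in `D` to be lifted, can be
pulled back along edges that are Cartesian over `C` to the fibre over the image of the initial
vertex. The last edge of the pulled back horn arises from `β` by a transition functor, hence is
Cartesian in the fibre, and the horn can be filled there. The filler is transported back by inner
horns. The pullbacks and their comparison with the original data form a subcomplex of a standard
simplex, the comparison prism, spanned by the chains of a poset (`prismChains`). All extensions over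
it attach simplices in pairs that differ by one vertex (`TogglePairing.exists_extension`).

*Right fibrations* (`isStrictRightFibration_of_comp`). A lifting problem for an outer horn against
`f` has a solution `l` over `C`. Since pushout-products of outer horn inclusions with monomorphisms
lift against right fibrations, `l ≫ f` is homotopic to the given simplex of `D`, relative to the
horn and over `C`. Lifting this homotopy along the isofibration `f` turns `l` into a solution.
-/

namespace ICat

noncomputable section

open SSet

section

/-! ### Simplices of a cylinder on a standard simplex -/

namespace JPrism

variable {n d : ℕ}

/-- The `i`-th letter of a simplex of `coherentIso ⊗ Δ[n]`: its vertex in the first factor. -/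
def letter (x : (coherentIso ⊗ Δ[n] : SSet.{u}) _⦋d⦌) (i : Fin (d + 1)) : Bool :=
  (Codiscrete.equivFun x.1 i).down

/-- The `i`-th vertex of a simplex of `coherentIso ⊗ Δ[n]` in the second factor. -/
def block (x : (coherentIso ⊗ Δ[n] : SSet.{u}) _⦋d⦌) (i : Fin (d + 1)) : Fin (n + 1) := x.2 i

lemma block_monotone (x : (coherentIso ⊗ Δ[n] : SSet.{u}) _⦋d⦌) : Monotone (block x) :=
  stdSimplex.monotone_apply x.2

/-- The simplex with given letters and given vertices in the second factor. -/
def mk (l : Fin (d + 1) → Bool) (b : Fin (d + 1) →o Fin (n + 1)) :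
    (coherentIso ⊗ Δ[n] : SSet.{u}) _⦋d⦌ :=
  (Codiscrete.equivFun.symm fun i ↦ ULift.up (l i), stdSimplex.objMk b)

lemma ext {x y : (coherentIso ⊗ Δ[n] : SSet.{u}) _⦋d⦌} (h : ∀ i, letter x i = letter y i)
    (h' : ∀ i, block x i = block y i) : x = y := by
  refine Prod.ext ?_ ?_
  · apply Codiscrete.equivFun.injective
    funext i
    exact ULift.ext _ _ (h i)
  · exact DFunLike.ext (F := (Δ[n] : SSet.{u}) _⦋d⦌) _ _ h'

lemma letter_δ (x : (coherentIso ⊗ Δ[n] : SSet.{u}) _⦋d + 1⦌) (i : Fin (d + 2))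
    (j : Fin (d + 1)) : letter ((coherentIso ⊗ Δ[n] : SSet.{u}).δ i x) j =
      letter x (i.succAbove j) := rfl

lemma block_δ (x : (coherentIso ⊗ Δ[n] : SSet.{u}) _⦋d + 1⦌) (i : Fin (d + 2))
    (j : Fin (d + 1)) : block ((coherentIso ⊗ Δ[n] : SSet.{u}).δ i x) j =
      block x (i.succAbove j) := rfl

lemma letter_σ (x : (coherentIso ⊗ Δ[n] : SSet.{u}) _⦋d⦌) (i : Fin (d + 1))
    (j : Fin (d + 2)) : letter ((coherentIso ⊗ Δ[n] : SSet.{u}).σ i x) j =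
      letter x (i.predAbove j) := rfl

lemma block_σ (x : (coherentIso ⊗ Δ[n] : SSet.{u}) _⦋d⦌) (i : Fin (d + 1))
    (j : Fin (d + 2)) : block ((coherentIso ⊗ Δ[n] : SSet.{u}).σ i x) j =
      block x (i.predAbove j) := rfl

/-- A simplex is nondegenerate exactly if no two consecutive vertices agree in both factors. -/
lemma mem_nonDegenerate_iff (x : (coherentIso ⊗ Δ[n] : SSet.{u}) _⦋d⦌) :
    x ∈ SSet.nonDegenerate _ d ↔ ∀ i j : Fin (d + 1), j.val = i.val + 1 →
      letter x i = letter x j → block x i ≠ block x j := by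
  constructor
  · rintro hx i j hij h h'
    obtain _ | d := d
    · omega
    obtain ⟨i, rfl⟩ := Fin.eq_castSucc_of_ne_last (x := i) (by grind)
    obtain rfl : j = i.succ := by grind
    refine hx ?_
    have : x = (coherentIso ⊗ Δ[n] : SSet.{u}).σ i
        ((coherentIso ⊗ Δ[n] : SSet.{u}).δ i.castSucc x) := by
      have key (k : Fin (d + 2)) : i.castSucc.succAbove (i.predAbove k) = k ∨
          (k = i.castSucc ∧ i.castSucc.succAbove (i.predAbove k) = i.succ) := by
        by_cases hk : k = i.castSucc
        · subst hk; simp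
        · left; exact Fin.succAbove_predAbove hk
      refine ext (fun k ↦ ?_) (fun k ↦ ?_)
      · rw [letter_σ, letter_δ]
        obtain e | ⟨rfl, e⟩ := key k <;> rw [e]
        exact h
      · rw [block_σ, block_δ]
        obtain e | ⟨rfl, e⟩ := key k <;> rw [e]
        exact h'
    rw [this]
    exact SSet.σ_mem_degenerate _ _ _
  · intro h hx
    obtain _ | d := d
    · rw [SSet.degenerate_zero] at hx; exact hx
    rw [SSet.degenerate_eq_iUnion_range_σ] at hx
    simp only [Set.mem_iUnion, Set.mem_range] at hx
    obtain ⟨i, y, rfl⟩ := hx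
    refine h i.castSucc i.succ (by simp) ?_ ?_
    · rw [letter_σ, letter_σ]; simp
    · rw [block_σ, block_σ]; simp

/-- The union of `{x₀} ⊗ Δ[n]` and `coherentIso ⊗ ∂Δ[n]`. -/
abbrev base (n : ℕ) : (coherentIso ⊗ Δ[n] : SSet.{u}).Subcomplex :=
  (Subcomplex.ofSimplex coherentIso.x₀.{u}).unionProd ∂Δ[n]

/-- A simplex lies in the base if all its vertices lie over `x₀`, or if it misses a vertex of
`Δ[n]`. -/
lemma mem_base_iff (x : (coherentIso ⊗ Δ[n] : SSet.{u}) _⦋d⦌) :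
    x ∈ (base.{u} n).obj _ ↔ (∀ i, letter x i = false) ∨ ¬ Function.Surjective (block x) := by
  refine (Subcomplex.mem_unionProd_iff _ _ _).trans ?_
  refine Iff.trans or_comm (or_congr ?_ Iff.rfl)
  rw [Subcomplex.mem_ofSimplex_obj_iff]
  constructor
  · rintro ⟨f, hf⟩ i
    have : letter x i = (Codiscrete.equivFun x.1 i).down := rfl
    rw [this, ← hf]
    rfl
  · intro h
    refine ⟨SimplexCategory.const _ _ 0, ?_⟩
    apply Codiscrete.equivFun.injective
    funext i
    exact ULift.ext _ _ (h i).symm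

/-- Prisms of the first kind: the first vertex `(x₁, n)` is at place `i + 1` and the vertex
`(x₀, n)` precedes it. -/
def KindA (x : (coherentIso ⊗ Δ[n] : SSet.{u}) _⦋d + 1⦌) (i : Fin (d + 1)) : Prop :=
  letter x i.castSucc = false ∧ block x i.castSucc = Fin.last n ∧ letter x i.succ = true ∧
    ∀ j : Fin (d + 2), j.val ≤ i.val → letter x j = true → block x j ≠ Fin.last n

/-- Prisms of the second kind: there is no vertex `(x₁, n)`, the last vertex over `x₁` is at
place `i`, and it is followed by the vertex over `x₀` with the same second coordinate. -/
def KindB (x : (coherentIso ⊗ Δ[n] : SSet.{u}) _⦋d + 1⦌) (i : Fin (d + 1)) : Prop :=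
  letter x i.castSucc = true ∧ block x i.castSucc = block x i.succ ∧
    (∀ j : Fin (d + 2), i.val < j.val → letter x j = false) ∧
    ∀ j, letter x j = true → block x j ≠ Fin.last n

end JPrism

end

section

/-! ### Pairing simplices by a vertex next to the pivot -/

namespace JPrism

variable {n d : ℕ}

/-- The pair `(i, k)` exhibits `x` as a simplex which is paired with its `k`-th face: deleting
the vertex `k` makes `i` the place of the pivot. -/
def Kind (x : (coherentIso ⊗ Δ[n] : SSet.{u}) _⦋d + 1⦌) (i : Fin (d + 1)) (k : Fin (d + 2)) :
    Prop :=
  (KindA x i ∧ k = i.castSucc) ∨ (KindB x i ∧ k = i.succ)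

/-- The pivot of a simplex which is not contained in `{x₀} ⊗ Δ[n]`: the first place of
the vertex `(x₁, n)` if it occurs, and the last place of a vertex over `x₁` otherwise. -/
def Pivot (z : (coherentIso ⊗ Δ[n] : SSet.{u}) _⦋d⦌) (i : Fin (d + 1)) : Prop :=
  letter z i = true ∧
    ((block z i = Fin.last n ∧ ∀ j < i, letter z j = true → block z j ≠ Fin.last n) ∨
      ((∀ j > i, letter z j = false) ∧ ∀ j, letter z j = true → block z j ≠ Fin.last n))

lemma Pivot.unique {z : (coherentIso ⊗ Δ[n] : SSet.{u}) _⦋d⦌} {i j : Fin (d + 1)}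
    (hi : Pivot z i) (hj : Pivot z j) : i = j := by
  obtain ⟨h1, h2⟩ := hi
  obtain ⟨h3, h4⟩ := hj
  obtain h | h | h := lt_trichotomy i j
  · grind
  · exact h
  · grind

/-- Every simplex with a vertex over `x₁` has a pivot; it is unique by `Pivot.unique`. -/
lemma exists_pivot (z : (coherentIso ⊗ Δ[n] : SSet.{u}) _⦋d⦌) (hz : ∃ i, letter z i = true) :
    ∃ i, Pivot z i := by
  classical
  by_cases h : ∃ i, letter z i = true ∧ block z i = Fin.last n
  · obtain ⟨i, hi, hi'⟩ := WellFounded.has_min (wellFounded_lt (α := Fin (d + 1)))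
      {i | letter z i = true ∧ block z i = Fin.last n} h
    exact ⟨i, hi.1, Or.inl ⟨hi.2, fun j hj h1 h2 ↦ hi' j ⟨h1, h2⟩ hj⟩⟩
  · obtain ⟨i, hi, hi'⟩ := WellFounded.has_min (wellFounded_gt (α := Fin (d + 1)))
      {i | letter z i = true} hz
    exact ⟨i, hi, Or.inr ⟨fun j hj ↦ by simpa using fun h ↦ hi' j h hj, by grind⟩⟩

/-- The place of the vertex that is inserted next to the pivot. -/
def place (z : (coherentIso ⊗ Δ[n] : SSet.{u}) _⦋d⦌) (i : Fin (d + 1)) : Fin (d + 2) :=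
  if block z i = Fin.last n then i.castSucc else i.succ

lemma predAbove_place_succAbove (z : (coherentIso ⊗ Δ[n] : SSet.{u}) _⦋d⦌) (i j : Fin (d + 1)) :
    i.predAbove ((place z i).succAbove j) = j := by
  unfold place
  split
  · exact Fin.predAbove_succAbove ..
  · obtain h | h := le_or_gt j i
    · rw [Fin.succAbove_of_castSucc_lt _ _ (by simpa [Fin.lt_def] using! Nat.lt_succ_of_le h),
        Fin.predAbove_castSucc_of_le _ _ h]
    · rw [Fin.succAbove_of_le_castSucc _ _ (by simpa [Fin.le_def] using! h),
        Fin.predAbove_succ_of_le _ _ h.le]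

/-- Insert, next to place `i`, a vertex over `x₀` with the same second coordinate. -/
def insert (z : (coherentIso ⊗ Δ[n] : SSet.{u}) _⦋d⦌) (i : Fin (d + 1)) :
    (coherentIso ⊗ Δ[n] : SSet.{u}) _⦋d + 1⦌ :=
  mk (fun j ↦ if j = place z i then false else letter z (i.predAbove j))
    ⟨fun j ↦ block z (i.predAbove j),
      fun _ _ h ↦ block_monotone z (Fin.predAbove_right_monotone i h)⟩

lemma letter_insert (z : (coherentIso ⊗ Δ[n] : SSet.{u}) _⦋d⦌) (i : Fin (d + 1)) (j) :
    letter (insert z i) j = if j = place z i then false else letter z (i.predAbove j) := rfl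

lemma block_insert (z : (coherentIso ⊗ Δ[n] : SSet.{u}) _⦋d⦌) (i : Fin (d + 1)) (j) :
    block (insert z i) j = block z (i.predAbove j) := rfl

lemma δ_insert (z : (coherentIso ⊗ Δ[n] : SSet.{u}) _⦋d⦌) (i : Fin (d + 1)) :
    (coherentIso ⊗ Δ[n] : SSet.{u}).δ (place z i) (insert z i) = z := by
  refine ext (fun j ↦ ?_) (fun j ↦ ?_)
  · rw [letter_δ, letter_insert, if_neg (Fin.succAbove_ne _ _), predAbove_place_succAbove]
  · rw [block_δ, block_insert, predAbove_place_succAbove]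

lemma Kind.place_eq {x : (coherentIso ⊗ Δ[n] : SSet.{u}) _⦋d + 1⦌} {i : Fin (d + 1)}
    {k : Fin (d + 2)} (h : Kind x i k) :
    place ((coherentIso ⊗ Δ[n] : SSet.{u}).δ k x) i = k := by
  unfold place
  rw [block_δ]
  obtain ⟨⟨h1, h2, h3, h4⟩, rfl⟩ | ⟨⟨h1, h2, h3, h4⟩, rfl⟩ := h
  · rw [if_pos]
    have := block_monotone x (Fin.castSucc_le_succ i)
    simp only [Fin.succAbove_castSucc_self]
    rw [h2] at this
    exact le_antisymm (Fin.le_last _) this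
  · rw [if_neg]
    simp only [Fin.succAbove_succ_self]
    exact h4 _ h1

/-- A paired simplex is recovered from its paired face by inserting a vertex over `x₀` next to the
pivot. -/
lemma Kind.eq_insert {x : (coherentIso ⊗ Δ[n] : SSet.{u}) _⦋d + 1⦌} {i : Fin (d + 1)}
    {k : Fin (d + 2)} (h : Kind x i k) :
    x = insert ((coherentIso ⊗ Δ[n] : SSet.{u}).δ k x) i := by
  have hp := h.place_eq
  have key (j : Fin (d + 2)) : j = k ∨ k.succAbove (i.predAbove j) = j := by
    obtain rfl | ⟨j, rfl⟩ := k.eq_self_or_eq_succAbove j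
    · exact Or.inl rfl
    · right
      nth_rw 2 [← hp]
      rw [predAbove_place_succAbove]
  have hk : letter x k = false := by
    obtain ⟨⟨h1, h2, h3, h4⟩, rfl⟩ | ⟨⟨h1, h2, h3, h4⟩, rfl⟩ := h
    · exact h1
    · exact h3 _ (by simp)
  have hk' : block x (k.succAbove (i.predAbove k)) = block x k := by
    obtain ⟨⟨h1, h2, h3, h4⟩, rfl⟩ | ⟨⟨h1, h2, h3, h4⟩, rfl⟩ := h
    · have := block_monotone x (Fin.castSucc_le_succ i)
      rw [h2] at this
      simp [h2]
      exact le_antisymm (Fin.le_last _) this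
    · simp [h2]
  refine ext (fun j ↦ ?_) (fun j ↦ ?_)
  · rw [letter_insert, hp, letter_δ]
    split
    · subst j; exact hk
    · rw [(key j).resolve_left ‹_›]
  · rw [block_insert, block_δ]
    obtain rfl | h := key j
    · exact hk'.symm
    · rw [h]

/-- The paired face of a simplex has the same pivot. -/
lemma Kind.pivot {x : (coherentIso ⊗ Δ[n] : SSet.{u}) _⦋d + 1⦌} {i : Fin (d + 1)}
    {k : Fin (d + 2)} (h : Kind x i k) :
    Pivot ((coherentIso ⊗ Δ[n] : SSet.{u}).δ k x) i := by
  unfold Pivot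
  simp only [letter_δ, block_δ]
  obtain ⟨⟨h1, h2, h3, h4⟩, rfl⟩ | ⟨⟨h1, h2, h3, h4⟩, rfl⟩ := h
  · have := block_monotone x (Fin.castSucc_le_succ i)
    rw [h2] at this
    refine ⟨by simpa using h3, Or.inl ⟨by simpa using le_antisymm (Fin.le_last _) this, ?_⟩⟩
    intro j hj
    rw [Fin.succAbove_of_castSucc_lt _ _ (by simpa using hj)]
    exact h4 _ (by simpa using hj.le)
  · refine ⟨by simpa using h1, Or.inr ⟨?_, fun j ↦ h4 _⟩⟩
    intro j hj
    rw [Fin.succAbove_of_lt_succ _ _ (by simpa using hj)]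
    exact h3 _ (by simp; omega)

/-- The paired face of a nondegenerate simplex is not itself paired with one of its faces: the two
classes of the pairing are disjoint. -/
lemma Kind.not_kind_δ {x : (coherentIso ⊗ Δ[n] : SSet.{u}) _⦋d + 2⦌} {i : Fin (d + 2)}
    {k : Fin (d + 3)} (hx : x ∈ SSet.nonDegenerate _ _) (h : Kind x i k) {i' : Fin (d + 1)}
    {k' : Fin (d + 2)} (h' : Kind ((coherentIso ⊗ Δ[n] : SSet.{u}).δ k x) i' k') : False := by
  have hp := h.pivot
  rw [mem_nonDegenerate_iff] at hx
  obtain ⟨⟨h1, h2, h3, h4⟩, -⟩ | ⟨⟨h1, h2, h3, h4⟩, -⟩ := h'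
  · have hi : i = i'.succ := by
      refine hp.unique ⟨h3, Or.inl ⟨?_, fun j hj ↦ h4 _
        (by simpa [Fin.lt_def] using! Nat.lt_succ_iff.1 hj)⟩⟩
      have := block_monotone ((coherentIso ⊗ Δ[n] : SSet.{u}).δ k x) (Fin.castSucc_le_succ i')
      rw [h2] at this
      exact le_antisymm (Fin.le_last _) this
    subst hi
    simp only [letter_δ, block_δ] at h1 h2 h3 h4
    obtain ⟨⟨g1, g2, g3, g4⟩, rfl⟩ | ⟨⟨g1, g2, g3, g4⟩, rfl⟩ := h
    · have e : i'.succ.castSucc.succAbove i'.castSucc = i'.castSucc.castSucc := by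
        grind [Fin.succAbove]
      rw [e] at h1 h2
      exact hx i'.castSucc.castSucc i'.succ.castSucc (by simp) (by rw [h1, g1]) (by rw [h2, g2])
    · have e : i'.succ.succ.succAbove i'.castSucc = i'.castSucc.castSucc := by
        grind [Fin.succAbove]
      rw [e] at h1 h2
      have := block_monotone x (show i'.castSucc.castSucc ≤ i'.succ.castSucc by
        simp [Fin.le_def])
      rw [h2] at this
      exact g4 _ g1 (le_antisymm (Fin.le_last _) this)
  · have hi : i = i'.castSucc := by
      refine hp.unique ⟨h1, Or.inr ⟨fun j hj ↦ h3 _ (by simpa using! hj), h4⟩⟩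
    subst hi
    simp only [letter_δ, block_δ] at h1 h2 h3 h4
    obtain ⟨⟨g1, g2, g3, g4⟩, rfl⟩ | ⟨⟨g1, g2, g3, g4⟩, rfl⟩ := h
    · have e : i'.castSucc.castSucc.succAbove i'.castSucc = i'.castSucc.succ := by
        grind [Fin.succAbove]
      refine h4 i'.castSucc (by rwa [e]) ?_
      rw [e]
      have := block_monotone x (show i'.castSucc.castSucc ≤ i'.castSucc.succ by
        simp [Fin.le_def])
      rw [g2] at this
      exact le_antisymm (Fin.le_last _) this
    · have e : i'.castSucc.succ.succAbove i'.succ = i'.succ.succ := by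
        grind [Fin.succAbove]
      have e' : i'.castSucc.succ.succAbove i'.castSucc = i'.castSucc.castSucc := by
        grind [Fin.succAbove]
      have e3 := h3 i'.succ (by simp)
      rw [e] at e3 h2
      rw [e'] at h2
      refine hx i'.castSucc.succ i'.succ.succ (by simp) ?_ ?_
      · rw [e3]; exact g3 _ (by simp)
      · rw [← h2, g2]

/-- A cell of the filtration: a nondegenerate simplex outside the base which has a vertex over
`x₀` next to the pivot, together with the places of the pivot and of that vertex. -/
structure Cell (n : ℕ) where
  /-- the dimension of the paired face -/
  d : ℕ
  /-- the simplex -/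
  x : (coherentIso ⊗ Δ[n] : SSet.{u}) _⦋d + 1⦌
  /-- the place of the pivot in the paired face -/
  i : Fin (d + 1)
  /-- the index of the paired face -/
  k : Fin (d + 2)
  nonDegenerate : x ∈ SSet.nonDegenerate _ _
  notMem : x ∉ (base.{u} n).obj _
  kind : Kind x i k

namespace Cell

variable (c : Cell.{u} n)

lemma surjective : Function.Surjective (block c.x) := by
  have := c.notMem
  rw [mem_base_iff] at this
  grind

lemma block_eq : block c.x (c.k.succAbove c.i) = block c.x c.k := by
  obtain ⟨⟨h1, h2, h3, h4⟩, h⟩ | ⟨⟨h1, h2, h3, h4⟩, h⟩ := c.kind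
  · have := block_monotone c.x (Fin.castSucc_le_succ c.i)
    rw [h2] at this
    rw [h, h2, Fin.succAbove_castSucc_self]
    exact le_antisymm (Fin.le_last _) this
  · rw [h, Fin.succAbove_succ_self, h2]

lemma ne_zero [NeZero n] : c.k ≠ 0 := by
  obtain ⟨⟨h1, h2, h3, h4⟩, h⟩ | ⟨-, h⟩ := c.kind
  · intro h0
    rw [h] at h0
    obtain ⟨j, hj⟩ := c.surjective 0
    have := block_monotone c.x (Fin.zero_le j)
    rw [← h0, h2, hj] at this
    have hn := NeZero.ne n
    grind
  · rw [h]; exact Fin.succ_ne_zero _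

lemma ne_last : c.k ≠ Fin.last _ := by
  obtain ⟨⟨h1, h2, h3, h4⟩, h⟩ | ⟨⟨h1, h2, h3, h4⟩, h⟩ := c.kind
  · rw [h]; exact Fin.castSucc_ne_last _
  · intro h0
    rw [h] at h0
    obtain ⟨j, hj⟩ := c.surjective (Fin.last n)
    have := block_monotone c.x (Fin.le_last j)
    rw [← h0, hj, ← h2] at this
    exact h4 _ h1 (le_antisymm (Fin.le_last _) this)

/-- Two vertices which become adjacent in the paired face cannot agree, since the pivot is the first
vertex `(x₁, n)` or the last vertex over `x₁`. -/
lemma nonDegenerate_δ :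
    (coherentIso ⊗ Δ[n] : SSet.{u}).δ c.k c.x ∈ SSet.nonDegenerate _ _ := by
  have hx := c.nonDegenerate
  have hk := c.kind
  have hne := c.ne_last
  rw [mem_nonDegenerate_iff] at hx ⊢
  generalize c.x = x at *
  generalize c.k = k at *
  generalize c.i = l at *
  intro i j hij
  simp only [letter_δ, block_δ]
  by_cases h : (k.succAbove j).val = (k.succAbove i).val + 1
  · exact hx _ _ h
  · have hi : k.succAbove i = i.castSucc := by grind [Fin.succAbove]
    have hj : k.succAbove j = j.succ := by grind [Fin.succAbove]
    have hk1 : k.val = i.val + 1 := by grind [Fin.succAbove]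
    rw [hi, hj]
    intro e1 e2
    obtain ⟨⟨h1, h2, h3, h4⟩, h⟩ | ⟨⟨h1, h2, h3, h4⟩, h⟩ := hk
    · have hj' : j = l := by grind
      subst hj'
      refine h4 i.castSucc (by simp; omega) (e1.trans h3) ?_
      have := block_monotone x (Fin.castSucc_le_succ j)
      rw [h2] at this
      rw [e2]
      exact le_antisymm (Fin.le_last _) this
    · have hi' : i = l := by grind
      subst hi'
      rw [h1] at e1
      have := h3 j.succ (by simp; omega)
      simp [this] at e1

lemma surjective_δ : Function.Surjective (block ((coherentIso ⊗ Δ[n] : SSet.{u}).δ c.k c.x)) := by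
  intro m
  obtain ⟨j, rfl⟩ := c.surjective m
  obtain rfl | ⟨j, rfl⟩ := c.k.eq_self_or_eq_succAbove j
  · exact ⟨c.i, c.block_eq⟩
  · exact ⟨j, rfl⟩

lemma notMem_δ : (coherentIso ⊗ Δ[n] : SSet.{u}).δ c.k c.x ∉ (base.{u} n).obj _ := by
  rw [mem_base_iff]
  rintro (h | h)
  · have := c.kind.pivot.1
    rw [h] at this
    simp at this
  · exact h c.surjective_δ

/-- A cell is determined by its paired face. -/
lemma ext_of_δ {c c' : Cell.{u} n} (h : S.mk ((coherentIso ⊗ Δ[n] : SSet.{u}).δ c.k c.x) =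
    S.mk ((coherentIso ⊗ Δ[n] : SSet.{u}).δ c'.k c'.x)) : c = c' := by
  obtain ⟨d, x, i, k, h1, h2, h3⟩ := c
  obtain ⟨d', x', i', k', h1', h2', h3'⟩ := c'
  rw [S.ext_iff'] at h
  obtain ⟨e, h⟩ := h
  dsimp at e
  subst e
  replace h : (coherentIso ⊗ Δ[n] : SSet.{u}).δ k x = (coherentIso ⊗ Δ[n] : SSet.{u}).δ k' x' := h
  have hp := h3.pivot
  rw [h] at hp
  obtain rfl := hp.unique h3'.pivot
  have hx := h3.eq_insert
  rw [h, ← h3'.eq_insert] at hx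
  have hk := h3.place_eq
  rw [h, h3'.place_eq] at hk
  subst hx hk
  rfl

/-- A cell is determined by its simplex. -/
lemma ext_of_eq {c c' : Cell.{u} n} (h : S.mk c.x = S.mk c'.x) : c = c' := by
  obtain ⟨d, x, i, k, h1, h2, h3⟩ := c
  obtain ⟨d', x', i', k', h1', h2', h3'⟩ := c'
  rw [S.ext_iff'] at h
  obtain ⟨e, h⟩ := h
  dsimp at e
  obtain rfl : d = d' := by omega
  obtain rfl : x = x' := h
  have : i = i' := by
    obtain ⟨⟨a1, a2, a3, a4⟩, -⟩ | ⟨⟨a1, a2, a3, a4⟩, -⟩ := h3 <;>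
    obtain ⟨⟨b1, b2, b3, b4⟩, -⟩ | ⟨⟨b1, b2, b3, b4⟩, -⟩ := h3'
    · by_contra hne
      have m1 := block_monotone x (Fin.castSucc_le_succ i)
      have m2 := block_monotone x (Fin.castSucc_le_succ i')
      rw [a2] at m1
      rw [b2] at m2
      have m1 := le_antisymm (Fin.le_last _) m1
      have m2 := le_antisymm (Fin.le_last _) m2
      obtain h | h := lt_or_gt_of_ne hne
      · exact b4 _ (by simpa using! h) a3 m1
      · exact a4 _ (by simpa using! h) b3 m2
    · have m1 := block_monotone x (Fin.castSucc_le_succ i)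
      rw [a2] at m1
      exact (b4 _ a3 (le_antisymm (Fin.le_last _) m1)).elim
    · have m1 := block_monotone x (Fin.castSucc_le_succ i')
      rw [b2] at m1
      exact (a4 _ b3 (le_antisymm (Fin.le_last _) m1)).elim
    · by_contra hne
      obtain h | h := lt_or_gt_of_ne hne
      · have := a3 i'.castSucc (by simpa using! h); simp [this] at b1
      · have := b3 i.castSucc (by simpa using! h); simp [this] at a1
  subst this
  have : k = k' := by
    have p1 := h3.pivot
    obtain ⟨⟨a1, a2, a3, a4⟩, rfl⟩ | ⟨⟨a1, a2, a3, a4⟩, rfl⟩ := h3 <;>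
    obtain ⟨⟨b1, b2, b3, b4⟩, rfl⟩ | ⟨⟨b1, b2, b3, b4⟩, rfl⟩ := h3' <;> simp_all
  subst this
  rfl

end Cell

end JPrism

end

section

/-! ### The pushout-product of `{x₀} ⟶ coherentIso` with a boundary is inner anodyne -/

namespace JPrism

variable {n d : ℕ}

/-- The insertion of a vertex next to the pivot keeps a simplex nondegenerate, unless the simplex
already contains such a vertex. -/
lemma insert_nonDegenerate {y : (coherentIso ⊗ Δ[n] : SSet.{u}) _⦋d⦌}
    (h1 : y ∈ SSet.nonDegenerate _ _) {i : Fin (d + 1)}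
    (hK : Kind (insert y i) i (place y i))
    (hy : ¬ ∃ (e : ℕ) (h : d = e + 1) (i : Fin (e + 1)) (k : Fin (e + 2)), Kind (h ▸ y) i k) :
    insert y i ∈ SSet.nonDegenerate _ _ := by
  have hA (a b : Fin (d + 1)) (hab : b.val = a.val + 1) (e1 : letter y a = false)
      (e2 : block y a = Fin.last n) (e3 : letter y b = true)
      (e4 : ∀ j : Fin (d + 1), j.val ≤ a.val → letter y j = true → block y j ≠ Fin.last n) :
      False := by
    obtain _ | e := d
    · omega
    obtain ⟨a, rfl⟩ := Fin.eq_castSucc_of_ne_last (x := a) (by grind)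
    obtain rfl : b = a.succ := by grind
    exact hy ⟨e, rfl, a, _, Or.inl ⟨⟨e1, e2, e3, e4⟩, rfl⟩⟩
  have hB (a b : Fin (d + 1)) (hab : b.val = a.val + 1) (e1 : letter y a = true)
      (e2 : block y a = block y b) (e3 : ∀ j : Fin (d + 1), a.val < j.val → letter y j = false)
      (e4 : ∀ j, letter y j = true → block y j ≠ Fin.last n) : False := by
    obtain _ | e := d
    · omega
    obtain ⟨a, rfl⟩ := Fin.eq_castSucc_of_ne_last (x := a) (by grind)
    obtain rfl : b = a.succ := by grind
    exact hy ⟨e, rfl, a, _, Or.inr ⟨⟨e1, e2, e3, e4⟩, rfl⟩⟩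
  rw [mem_nonDegenerate_iff] at h1 ⊢
  have hins (j : Fin (d + 1)) : letter (insert y i) ((place y i).succAbove j) = letter y j ∧
      block (insert y i) ((place y i).succAbove j) = block y j := by
    rw [← letter_δ, ← block_δ, δ_insert]
    exact ⟨rfl, rfl⟩
  intro j j' hjj e1 e2
  obtain ⟨⟨k1, k2, k3, k4⟩, hk⟩ | ⟨⟨k1, k2, k3, k4⟩, hk⟩ := hK
  · rw [hk] at hins
    by_cases hj : j = i.castSucc
    · obtain rfl : j' = i.succ := by grind
      rw [hj, k1, k3] at e1
      simp at e1
    obtain ⟨a, rfl⟩ := Fin.exists_succAbove_eq hj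
    by_cases hj' : j' = i.castSucc
    · have ha : a.castSucc = i.castSucc.succAbove a := by grind [Fin.succAbove]
      subst hj'
      rw [k1, (hins a).1] at e1
      rw [k2, (hins a).2] at e2
      refine hA a i (by grind) e1 e2 ?_ ?_
      · rw [← (hins i).1]; simpa using k3
      · intro l hl
        rw [← (hins l).1, ← (hins l).2]
        exact k4 _ (by grind [Fin.succAbove])
    · obtain ⟨b, rfl⟩ := Fin.exists_succAbove_eq hj'
      rw [(hins a).1, (hins b).1] at e1
      rw [(hins a).2, (hins b).2] at e2
      exact h1 a b (by grind [Fin.succAbove]) e1 e2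
  · rw [hk] at hins
    by_cases hj' : j' = i.succ
    · obtain rfl : j = i.castSucc := by grind
      rw [hj', k1, k3 _ (by simp)] at e1
      simp at e1
    obtain ⟨b, rfl⟩ := Fin.exists_succAbove_eq hj'
    by_cases hj : j = i.succ
    · have hb : b.succ = i.succ.succAbove b := by grind [Fin.succAbove]
      subst hj
      rw [← k2, (hins b).2] at e2
      have hi := (hins i).2
      rw [Fin.succAbove_succ_self] at hi
      rw [hi] at e2
      refine hB i b (by grind) ?_ e2 ?_ ?_
      · rw [← (hins i).1]; simpa using k1
      · intro l hl
        rw [← (hins l).1]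
        exact k3 _ (by grind [Fin.succAbove])
      · intro l
        rw [← (hins l).1, ← (hins l).2]
        exact k4 _
    · obtain ⟨a, rfl⟩ := Fin.exists_succAbove_eq hj
      rw [(hins a).1, (hins b).1] at e1
      rw [(hins a).2, (hins b).2] at e2
      exact h1 a b (by grind [Fin.succAbove]) e1 e2

/-- The pairing of the nondegenerate simplices outside the base. -/
def pairingCore (n : ℕ) : (base.{u} n).PairingCore where
  ι := Cell.{u} n
  dim c := c.d
  simplex c := c.x
  index c := c.k
  nonDegenerate₁ c := c.nonDegenerate
  nonDegenerate₂ c := c.nonDegenerate_δ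
  notMem₁ c := c.notMem
  notMem₂ c := c.notMem_δ
  injective_type₁' h := Cell.ext_of_eq h
  injective_type₂' h := Cell.ext_of_δ h
  type₁_ne_type₂' := by
    rintro ⟨d, x, i, k, h1, h2, h3⟩ ⟨d', x', i', k', h1', h2', h3'⟩ h
    rw [S.ext_iff'] at h
    obtain ⟨e, h⟩ := h
    dsimp at e
    subst e
    obtain rfl : x = (coherentIso ⊗ Δ[n] : SSet.{u}).δ k' x' := h
    exact h3'.not_kind_δ h1' h3
  surjective' y := by
    obtain ⟨d, y, h1, h2, rfl⟩ := Subcomplex.N.mk_surjective y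
    by_cases hy : ∃ (e : ℕ) (h : d = e + 1) (i : Fin (e + 1)) (k : Fin (e + 2)),
        Kind (h ▸ y) i k
    · obtain ⟨e, rfl, i, k, hk⟩ := hy
      exact ⟨⟨e, y, i, k, h1, h2, hk⟩, Or.inl rfl⟩
    · have h3 := h2
      rw [mem_base_iff, not_or, not_not] at h3
      obtain ⟨i, hi⟩ := exists_pivot y (by simpa using h3.1)
      have hK : Kind (insert y i) i (place y i) := by
        obtain ⟨hi1, ⟨hi2, hi3⟩ | ⟨hi2, hi3⟩⟩ := hi
        · left
          have hp : place y i = i.castSucc := by rw [place, if_pos hi2]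
          refine ⟨⟨?_, ?_, ?_, ?_⟩, hp⟩
          · rw [letter_insert, if_pos hp.symm]
          · rw [block_insert]; simpa using hi2
          · rw [letter_insert, hp, if_neg (by simp [Fin.ext_iff])]
            simpa using hi1
          · intro j hj hj'
            rw [letter_insert, hp] at hj'
            rw [block_insert]
            split_ifs at hj' with h
            refine hi3 _ ?_ hj'
            rw [Fin.predAbove_of_le_castSucc i j (by simpa [Fin.le_def] using! hj), Fin.lt_def]
            simp only [Fin.ext_iff, Fin.val_castSucc] at h
            simp only [Fin.coe_castPred]
            omega
        · right
          have hp : place y i = i.succ := by rw [place, if_neg (hi3 _ hi1)]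
          refine ⟨⟨?_, ?_, ?_, ?_⟩, hp⟩
          · rw [letter_insert, hp, if_neg (by simp [Fin.ext_iff])]
            simpa using hi1
          · rw [block_insert, block_insert]; simp
          · intro j hj
            rw [letter_insert, hp]
            split_ifs with h
            · rfl
            · refine hi2 _ ?_
              rw [Fin.predAbove_of_castSucc_lt i j (by simpa [Fin.lt_def] using! hj), gt_iff_lt,
                Fin.lt_def]
              simp only [Fin.ext_iff, Fin.val_succ] at h
              simp only [Fin.val_pred]
              omega
          · intro j hj'
            rw [letter_insert, hp] at hj'
            rw [block_insert]
            split_ifs at hj' with h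
            exact hi3 _ hj'
      have hn : insert y i ∈ SSet.nonDegenerate _ _ :=
        insert_nonDegenerate h1 hK hy
      refine ⟨⟨d, insert y i, i, place y i, hn, ?_, hK⟩, Or.inr ?_⟩
      · intro h
        refine h2 ?_
        rw [← δ_insert y i]
        exact (base n).map (SimplexCategory.δ _).op h
      · rw [S.ext_iff']
        exact ⟨rfl, (δ_insert y i).symm⟩

instance : (pairingCore.{u} n).IsProper where
  isUniquelyCodimOneFace c := by
    refine (S.IsUniquelyCodimOneFace.iff _ _).2 ⟨c.k, rfl, fun j hj ↦ ?_⟩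
    have hx := c.nonDegenerate
    rw [mem_nonDegenerate_iff] at hx
    have key (a b : Fin (c.d + 2)) (hab : a < b)
        (h : (coherentIso ⊗ Δ[n] : SSet.{u}).δ a c.x = (coherentIso ⊗ Δ[n] : SSet.{u}).δ b c.x) :
        False := by
      obtain ⟨a, rfl⟩ := Fin.eq_castSucc_of_ne_last (Fin.ne_last_of_lt hab)
      refine hx a.castSucc a.succ (by simp) ?_ ?_
      · have := congr_arg (letter · a) h
        simp only [letter_δ, Fin.succAbove_castSucc_self] at this
        rw [this, Fin.succAbove_of_castSucc_lt _ _ hab]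
      · have := congr_arg (block · a) h
        simp only [block_δ, Fin.succAbove_castSucc_self] at this
        rw [this, Fin.succAbove_of_castSucc_lt _ _ hab]
    obtain h | h | h := lt_trichotomy j c.k
    · exact (key _ _ h hj).elim
    · exact h
    · exact (key _ _ h hj.symm).elim

instance [NeZero n] : (pairingCore.{u} n).IsInner where
  ne_zero c := c.ne_zero
  ne_last c := c.ne_last

/-- The number of vertices over `x₁`. -/
def weight (x : (coherentIso ⊗ Δ[n] : SSet.{u}) _⦋d⦌) : ℕ :=
  (Finset.univ.filter (fun i ↦ letter x i = true)).card

lemma weight_eq (x : (coherentIso ⊗ Δ[n] : SSet.{u}) _⦋d + 1⦌) (k : Fin (d + 2)) :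
    weight x = weight ((coherentIso ⊗ Δ[n] : SSet.{u}).δ k x) +
      (if letter x k = true then 1 else 0) := by
  simp only [weight, Finset.card_filter]
  rw [Fin.sum_univ_succAbove _ k, add_comm]
  rfl

/-- Deleting a vertex over `x₀` other than the paired one does not change the kind. -/
lemma Kind.δ {x : (coherentIso ⊗ Δ[n] : SSet.{u}) _⦋d + 2⦌} {i : Fin (d + 2)}
    {k : Fin (d + 3)} (h : Kind x i k) (j : Fin (d + 3)) (hj : j ≠ k) (hj' : letter x j = false) :
    ∃ i' k', Kind ((coherentIso ⊗ Δ[n] : SSet.{u}).δ j x) i' k' := by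
  have hk : k = i.castSucc ∨ k = i.succ := by
    obtain ⟨-, h⟩ | ⟨-, h⟩ := h <;> simp [h]
  have hj1 : j ≠ i.castSucc ∧ j ≠ i.succ := by
    obtain ⟨⟨h1, h2, h3, h4⟩, rfl⟩ | ⟨⟨h1, h2, h3, h4⟩, rfl⟩ := h
    · exact ⟨hj, by rintro rfl; simp [h3] at hj'⟩
    · exact ⟨by rintro rfl; simp [h1] at hj', hj⟩
  obtain ⟨i', hi1, hi2⟩ : ∃ i' : Fin (d + 1), j.succAbove i'.castSucc = i.castSucc ∧
      j.succAbove i'.succ = i.succ := by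
    by_cases hlt : j < i.castSucc
    · refine ⟨⟨i.val - 1, by grind⟩, ?_, ?_⟩ <;> grind [Fin.succAbove]
    · refine ⟨⟨i.val, by grind⟩, ?_, ?_⟩ <;> grind [Fin.succAbove]
  obtain ⟨⟨h1, h2, h3, h4⟩, rfl⟩ | ⟨⟨h1, h2, h3, h4⟩, rfl⟩ := h
  · refine ⟨i', i'.castSucc, Or.inl ⟨⟨?_, ?_, ?_, ?_⟩, rfl⟩⟩
    · rw [letter_δ, hi1, h1]
    · rw [block_δ, hi1, h2]
    · rw [letter_δ, hi2, h3]
    · intro l hl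
      rw [letter_δ, block_δ]
      exact h4 _ (by grind [Fin.succAbove])
  · refine ⟨i', i'.succ, Or.inr ⟨⟨?_, ?_, ?_, ?_⟩, rfl⟩⟩
    · rw [letter_δ, hi1, h1]
    · rw [block_δ, block_δ, hi1, hi2, h2]
    · intro l hl
      rw [letter_δ]
      exact h3 _ (by grind [Fin.succAbove])
    · intro l
      rw [letter_δ, block_δ]
      exact h4 _

lemma Kind.letter {x : (coherentIso ⊗ Δ[n] : SSet.{u}) _⦋d + 1⦌} {i : Fin (d + 1)}
    {k : Fin (d + 2)} (h : Kind x i k) : letter x k = false := by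
  obtain ⟨⟨h1, h2, h3, h4⟩, rfl⟩ | ⟨⟨h1, h2, h3, h4⟩, rfl⟩ := h
  · exact h1
  · exact h3 _ (by simp)

/-- The number of vertices over `x₁` is a weak rank function. -/
def weakRankFunction (n : ℕ) : (pairingCore.{u} n).WeakRankFunction ℕ where
  rank c := weight c.x
  lt := by
    rintro ⟨d, x, i, k, h1, h2, h3⟩ ⟨d', x', i', k', h1', h2', h3'⟩ ⟨g1, g2⟩ g3
    obtain rfl : d = d' := g3
    obtain ⟨f, hf, hδ⟩ := N.le_iff_exists_mono.1 g2.le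
    change ⦋d⦌ ⟶ ⦋d + 1⦌ at f
    replace hf : Mono f := hf
    obtain ⟨j, rfl⟩ := SimplexCategory.eq_δ_of_mono f
    replace hδ : (coherentIso ⊗ Δ[n] : SSet.{u}).δ j x' =
      (coherentIso ⊗ Δ[n] : SSet.{u}).δ k x := hδ
    show weight x < weight x'
    rw [weight_eq x k, if_neg (by simp [h3.letter]), weight_eq x' j, hδ]
    by_cases hj' : JPrism.letter x' j = true
    · simp [hj']
    · exfalso
      by_cases hj : j = k'
      · subst hj
        refine g1 (Cell.ext_of_δ ?_)
        rw [S.ext_iff']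
        exact ⟨rfl, hδ.symm⟩
      · obtain _ | d := d
        · have hp := h3'.letter
          have : ∀ a b c : Fin 2, a ≠ b → c = a ∨ c = b := by decide
          have hl : ∀ l, JPrism.letter x' l = false := by
            intro l
            obtain h | h := this j k' l hj <;> simp_all
          obtain ⟨⟨-, -, a3, -⟩, -⟩ | ⟨⟨a1, -, -, -⟩, -⟩ := h3'
          · rw [hl] at a3; simp at a3
          · rw [hl] at a1; simp at a1
        · obtain ⟨i'', k'', h⟩ := h3'.δ j hj (by simpa using hj')
          rw [hδ] at h
          exact h3.not_kind_δ h1 h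

instance : (pairingCore.{u} n).IsRegular := (weakRankFunction n).isRegular

/-- For `n > 0` the pushout-product of `{x₀} ⟶ coherentIso` with the boundary inclusion of `Δ[n]` is
inner anodyne: its nondegenerate simplices are paired off by the presence of a vertex over `x₀` next
to the pivot. For `n = 0` the statement fails, which is why lifting against `{x₀} ⟶ coherentIso` is
part of the definition of an isofibration. -/
lemma innerAnodyneExtensions_base_ι (n : ℕ) [NeZero n] :
    innerAnodyneExtensions (base.{u} n).ι :=
  (pairingCore n).pairing.innerAnodyneExtensions

end JPrism

end

section

/-! ### Isofibrations -/

/-- Isofibrations: inner fibrations along which equivalences lift, once a lift of the source is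
given. -/
def IsIsofibration {X S : SSet.{u}} (p : X ⟶ S) : Prop :=
  InnerFibration p ∧ HasLiftingProperty (Subcomplex.ofSimplex coherentIso.x₀.{u}).ι p

/-- The class of maps with the left lifting property against all isofibrations. -/
def IsIsoAnodyne {A B : SSet.{u}} (i : A ⟶ B) : Prop :=
  ∀ ⦃X S : SSet.{u}⦄ (p : X ⟶ S), IsIsofibration p → HasLiftingProperty i p

lemma isIsoAnodyne_of_inner {A B : SSet.{u}} {i : A ⟶ B} (hi : innerAnodyneExtensions i) :
    IsIsoAnodyne i := fun _ _ p hp ↦ by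
  have := hp.1
  exact hi _ (mem_innerFibrations p)

lemma isIsoAnodyne_ofSimplex_ι :
    IsIsoAnodyne (Subcomplex.ofSimplex coherentIso.x₀.{u}).ι := fun _ _ _ hp ↦ hp.2

/-- The right lifting property against a pushout-product, in terms of the two maps that make up the
map out of the pushout. -/
lemma exists_extension_of_hasLiftingProperty {X₁ Y₁ X₂ Y₂ E B : SSet.{u}} {f₁ : X₁ ⟶ Y₁}
    {f₂ : X₂ ⟶ Y₂} {p : E ⟶ B} (sq : (curriedTensor SSet.{u}).PushoutObjObj f₁ f₂)
    (hp : HasLiftingProperty sq.ι p) {a : Y₁ ⊗ X₂ ⟶ E} {b : X₁ ⊗ Y₂ ⟶ E} {c : Y₁ ⊗ Y₂ ⟶ B}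
    (hab : f₁ ▷ X₂ ≫ a = X₁ ◁ f₂ ≫ b) (ha : a ≫ p = Y₁ ◁ f₂ ≫ c) (hb : b ≫ p = f₁ ▷ Y₂ ≫ c) :
    ∃ l : Y₁ ⊗ Y₂ ⟶ E, Y₁ ◁ f₂ ≫ l = a ∧ f₁ ▷ Y₂ ≫ l = b ∧ l ≫ p = c := by
  have w : sq.isPushout.desc a b hab ≫ p = sq.ι ≫ c := by
    apply sq.hom_ext
    · rw [sq.isPushout.inl_desc_assoc, sq.inl_ι_assoc]; exact ha
    · rw [sq.isPushout.inr_desc_assoc, sq.inr_ι_assoc]; exact hb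
  have sq' : CommSq (sq.isPushout.desc a b hab) sq.ι p c := ⟨w⟩
  refine ⟨sq'.lift, ?_, ?_, sq'.fac_right⟩
  · have := sq.inl ≫= sq'.fac_left
    rw [sq.inl_ι_assoc, sq.isPushout.inl_desc] at this
    exact this
  · have := sq.inr ≫= sq'.fac_left
    rw [sq.inr_ι_assoc, sq.isPushout.inr_desc] at this
    exact this

lemma hasLiftingProperty_pushoutObjObj_ι_flip {X₁ Y₁ X₂ Y₂ E B : SSet.{u}} {f₁ : X₁ ⟶ Y₁}
    {f₂ : X₂ ⟶ Y₂} {p : E ⟶ B} (sq : (curriedTensor SSet.{u}).PushoutObjObj f₁ f₂) :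
    HasLiftingProperty sq.ι p ↔ HasLiftingProperty sq.flipTensor.ι p :=
  HasLiftingProperty.iff_of_arrow_iso_left
    (show Arrow.mk sq.ι ≅ Arrow.mk sq.flipTensor.ι from Arrow.isoMk (Iso.refl _) (β_ _ _)) p

/-- The first projection `X ⊗ Δ[0] ⟶ X` is an isomorphism. -/
def prodPointIso (X : SSet.{u}) : X ⊗ Δ[0] ≅ X where
  hom := fst _ _
  inv := lift (𝟙 X) (stdSimplex.isTerminalObj₀.from X)
  hom_inv_id := by
    ext1
    · simp
    · exact stdSimplex.isTerminalObj₀.hom_ext _ _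

/-- The pushout-product of `{x₀} ⟶ coherentIso` with a monomorphism. For the boundary of a point
this is the definition of isofibrations, and for the boundary of `Δ[n]` with `n > 0` the
pushout-product is inner anodyne. -/
lemma IsIsofibration.hasLiftingProperty {A B X S : SSet.{u}} {p : X ⟶ S} (hp : IsIsofibration p)
    (i : A ⟶ B) [Mono i] (sq : (curriedTensor SSet.{u}).PushoutObjObj
      (Subcomplex.ofSimplex coherentIso.x₀.{u}).ι i) : HasLiftingProperty sq.ι p := by
  let sq₁₃ := Functor.PullbackObjObj.ofHasPullback MonoidalClosed.internalHom
    (Subcomplex.ofSimplex coherentIso.x₀.{u}).ι p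
  rw [MonoidalClosed.internalHomAdjunction₂.hasLiftingProperty_iff _ sq₁₃]
  suffices (MorphismProperty.monomorphisms _).rlp sq₁₃.π from this _ inferInstance
  rw [rlp_monomorphisms]
  rintro _ _ _ ⟨n⟩
  -- the boundary of a point is empty; a simplex of positive dimension gives an inner anodyne map
  obtain _ | n := n
  · have hI : IsInitial ((∂Δ[0] : (Δ[0] : SSet.{u}).Subcomplex) : SSet.{u}) := by
      rw [boundary_zero]
      exact Subcomplex.isInitialBot
    rw [← MonoidalClosed.internalHomAdjunction₂.hasLiftingProperty_iff
      (.ofIsInitialRight (curriedTensor _) _ _ hI)]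
    refine (HasLiftingProperty.iff_of_arrow_iso_left (Arrow.isoMk (prodPointIso _) (prodPointIso _)
      ?_) p).2 hp.2
    rfl
  · rw [← MonoidalClosed.internalHomAdjunction₂.hasLiftingProperty_iff
      (Subcomplex.unionProd.pushoutObjObj.{u} _ _),
      Subcomplex.unionProd.pushoutObjObj_ι]
    have := hp.1
    exact JPrism.innerAnodyneExtensions_base_ι (n + 1) _ (mem_innerFibrations p)

/-- By adjunction, the Leibniz exponential of an isofibration by a monomorphism is an
isofibration. -/
lemma IsIsofibration.pullbackObjObj_π {M N X S : SSet.{u}} {p : X ⟶ S} (hp : IsIsofibration p)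
    (m : M ⟶ N) [Mono m] (sq₁₃ : MonoidalClosed.internalHom.PullbackObjObj m p) :
    IsIsofibration sq₁₃.π := by
  have := hp.1
  refine ⟨innerFibration_pullbackObjObjπ sq₁₃, ?_⟩
  rw [← MonoidalClosed.internalHomAdjunction₂.hasLiftingProperty_iff
      (Functor.PushoutObjObj.ofHasPushout _ _ _),
    hasLiftingProperty_pushoutObjObj_ι_flip]
  exact hp.hasLiftingProperty _ _

lemma IsIsoAnodyne.pushoutObjObj_ι {M N A B : SSet.{u}} {i : A ⟶ B} (hi : IsIsoAnodyne i)
    {m : M ⟶ N} [Mono m] (sq : (curriedTensor SSet.{u}).PushoutObjObj m i) :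
    IsIsoAnodyne sq.ι := fun _ _ p hp ↦ by
  let sq₁₃ := Functor.PullbackObjObj.ofHasPullback MonoidalClosed.internalHom m p
  rw [MonoidalClosed.internalHomAdjunction₂.hasLiftingProperty_iff _ sq₁₃]
  exact hi _ (hp.pullbackObjObj_π m sq₁₃)

/-- Extension of maps along the pushout-product of a monomorphism and a map which has the left
lifting property against isofibrations. -/
lemma IsIsofibration.exists_extension {M N A B X S : SSet.{u}} {p : X ⟶ S} (hp : IsIsofibration p)
    (m : M ⟶ N) [Mono m] {i : A ⟶ B} (hi : IsIsoAnodyne i)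
    {a : N ⊗ A ⟶ X} {b : M ⊗ B ⟶ X} {c : N ⊗ B ⟶ S} (hab : m ▷ A ≫ a = M ◁ i ≫ b)
    (ha : a ≫ p = N ◁ i ≫ c) (hb : b ≫ p = m ▷ B ≫ c) :
    ∃ l : N ⊗ B ⟶ X, N ◁ i ≫ l = a ∧ m ▷ B ≫ l = b ∧ l ≫ p = c :=
  exists_extension_of_hasLiftingProperty (Functor.PushoutObjObj.ofHasPushout _ _ _)
    (hi.pushoutObjObj_ι _ _ hp) hab ha hb

/-! ### Cylinders -/

/-- The end of the cylinder `coherentIso ⊗ X` over `x₀`. -/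
abbrev end₀ (X : SSet.{u}) : X ⟶ coherentIso.{u} ⊗ X := lift (SSet.const coherentIso.x₀.{u}) (𝟙 X)

/-- The end of the cylinder `coherentIso ⊗ X` over `x₁`. -/
abbrev end₁ (X : SSet.{u}) : X ⟶ coherentIso.{u} ⊗ X := lift (SSet.const coherentIso.x₁.{u}) (𝟙 X)

lemma end₀_whiskerLeft {X Y : SSet.{u}} (f : X ⟶ Y) :
    end₀ X ≫ coherentIso ◁ f = f ≫ end₀ Y := by
  ext1 <;> simp

lemma end₁_whiskerLeft {X Y : SSet.{u}} (f : X ⟶ Y) :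
    end₁ X ≫ coherentIso ◁ f = f ≫ end₁ Y := by
  ext1 <;> simp

lemma ofSimplex_ι_whiskerRight (Y : SSet.{u}) :
    (Subcomplex.ofSimplex coherentIso.x₀.{u}).ι ▷ Y = snd _ Y ≫ end₀ Y := by
  ext1
  · simp
  · simp

/-- Extension of homotopies from the end over `x₀`. -/
lemma IsIsofibration.exists_homotopy₀ {A B X S : SSet.{u}} {p : X ⟶ S} (hp : IsIsofibration p)
    (i : A ⟶ B) [Mono i] {h : coherentIso ⊗ A ⟶ X} {x : B ⟶ X} {k : coherentIso ⊗ B ⟶ S}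
    (hx : end₀ A ≫ h = i ≫ x) (hk : h ≫ p = coherentIso ◁ i ≫ k) (hxk : x ≫ p = end₀ B ≫ k) :
    ∃ l : coherentIso ⊗ B ⟶ X, coherentIso ◁ i ≫ l = h ∧ end₀ B ≫ l = x ∧ l ≫ p = k := by
  obtain ⟨l, h1, h2, h3⟩ := exists_extension_of_hasLiftingProperty
    (Functor.PushoutObjObj.ofHasPushout _ (Subcomplex.ofSimplex coherentIso.x₀.{u}).ι i)
    (hp.hasLiftingProperty i _) (a := h) (b := snd _ _ ≫ x) (c := k)
    (by rw [ofSimplex_ι_whiskerRight, Category.assoc, hx]; simp) hk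
    (by rw [ofSimplex_ι_whiskerRight, Category.assoc, Category.assoc, hxk])
  refine ⟨l, h1, ?_, h3⟩
  rw [ofSimplex_ι_whiskerRight] at h2
  have := lift (SSet.const (Y := (Subcomplex.ofSimplex coherentIso.x₀.{u} : SSet.{u}))
    ⟨coherentIso.x₀.{u}, Subcomplex.mem_ofSimplex_obj _⟩) (𝟙 B) ≫= h2
  simpa only [Category.assoc, lift_snd_assoc, Category.id_comp] using this

end

section

/-! ### The two ends of a cylinder -/

instance {X Y : SSet.{u}} (f : X ⟶ Y) [Mono f] (Z : SSet.{u}) : Mono (f ▷ Z) where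
  right_cancellation a b h := by
    ext1
    · rw [← cancel_mono f]
      simpa using h =≫ fst _ _
    · simpa using h =≫ snd _ _

/-- The endomorphism of `coherentIso` that exchanges the two vertices. -/
def swap : coherentIso.{u} ⟶ coherentIso where
  app n := ↾fun x ↦ Codiscrete.equivFun.symm fun i ↦
    ⟨!(Codiscrete.equivFun (n := n.unop.len) x i).down⟩

lemma hom_ext_coherentIso {X : SSet.{u}} {f g : X ⟶ coherentIso.{u}}
    (h : ∀ (n : ℕ) (x : X _⦋n⦌) (i : Fin (n + 1)),
      (Codiscrete.equivFun (f.app _ x) i).down = (Codiscrete.equivFun (g.app _ x) i).down) :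
    f = g := by
  ext ⟨n⟩ x i
  exact h n.len x i

@[simp]
lemma swap_swap : swap.{u} ≫ swap = 𝟙 _ := hom_ext_coherentIso fun n x i ↦ by
  exact Bool.not_not _

lemma end₀_swap (X : SSet.{u}) : end₀ X ≫ swap ▷ X = end₁ X := by
  ext1
  · simp
    exact hom_ext_coherentIso fun n x i ↦ rfl
  · simp

lemma end₁_swap (X : SSet.{u}) : end₁ X ≫ swap ▷ X = end₀ X := by
  rw [← end₀_swap, Category.assoc, ← comp_whiskerRight, swap_swap]
  simp

/-- Extension of homotopies from the end over `x₁`. -/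
lemma IsIsofibration.exists_homotopy₁ {A B X S : SSet.{u}} {p : X ⟶ S} (hp : IsIsofibration p)
    (i : A ⟶ B) [Mono i] {h : coherentIso ⊗ A ⟶ X} {x : B ⟶ X} {k : coherentIso ⊗ B ⟶ S}
    (hx : end₁ A ≫ h = i ≫ x) (hk : h ≫ p = coherentIso ◁ i ≫ k) (hxk : x ≫ p = end₁ B ≫ k) :
    ∃ l : coherentIso ⊗ B ⟶ X, coherentIso ◁ i ≫ l = h ∧ end₁ B ≫ l = x ∧ l ≫ p = k := by
  obtain ⟨l, h1, h2, h3⟩ := hp.exists_homotopy₀ i (h := swap ▷ A ≫ h) (x := x) (k := swap ▷ B ≫ k)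
    (by rw [reassoc_of% end₀_swap, hx]) (by rw [Category.assoc, hk, whisker_exchange_assoc])
    (by rw [reassoc_of% end₀_swap, hxk])
  refine ⟨swap ▷ B ≫ l, ?_, ?_, ?_⟩
  · rw [whisker_exchange_assoc, h1, ← comp_whiskerRight_assoc, swap_swap]; simp
  · rw [reassoc_of% end₁_swap, h2]
  · rw [Category.assoc, h3, ← comp_whiskerRight_assoc, swap_swap]; simp

/-- The discrete subcomplex of `coherentIso` with the two vertices. -/
def ends : (coherentIso.{u}).Subcomplex where
  obj n := {x | ∃ b, ∀ i, (Codiscrete.equivFun (n := n.unop.len) x i).down = b}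
  map f := by
    rintro x ⟨b, hb⟩
    exact ⟨b, fun i ↦ hb _⟩

namespace ends

/-- The vertex `x₀` of `ends`. -/
def v₀ : (ends.{u} : SSet.{u}) _⦋0⦌ := ⟨coherentIso.x₀, false, fun _ ↦ rfl⟩

/-- The vertex `x₁` of `ends`. -/
def v₁ : (ends.{u} : SSet.{u}) _⦋0⦌ := ⟨coherentIso.x₁, true, fun _ ↦ rfl⟩

/-- The copy of `A` over `x₀`. -/
abbrev in₀ (A : SSet.{u}) : A ⟶ (ends.{u} : SSet.{u}) ⊗ A := lift (SSet.const v₀) (𝟙 A)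

/-- The copy of `A` over `x₁`. -/
abbrev in₁ (A : SSet.{u}) : A ⟶ (ends.{u} : SSet.{u}) ⊗ A := lift (SSet.const v₁) (𝟙 A)

lemma in₀_ι (A : SSet.{u}) : in₀ A ≫ ends.ι ▷ A = end₀ A := rfl

lemma in₁_ι (A : SSet.{u}) : in₁ A ≫ ends.ι ▷ A = end₁ A := rfl

lemma eq_const {n : SimplexCategoryᵒᵖ} (x : (ends.{u} : SSet.{u}).obj n) :
    x = (SSet.const v₀ : (ends.{u} : SSet.{u}) ⟶ _).app n x ∨
      x = (SSet.const v₁ : (ends.{u} : SSet.{u}) ⟶ _).app n x := by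
  obtain ⟨x, b, hb⟩ := x
  obtain _ | _ := b
  · left
    refine Subtype.ext ?_
    apply (Codiscrete.equivFun (n := n.unop.len)).injective
    funext i
    exact ULift.ext _ _ (hb i)
  · right
    refine Subtype.ext ?_
    apply (Codiscrete.equivFun (n := n.unop.len)).injective
    funext i
    exact ULift.ext _ _ (hb i)

lemma hom_ext {A Y : SSet.{u}} {f g : (ends.{u} : SSet.{u}) ⊗ A ⟶ Y}
    (h₀ : in₀ A ≫ f = in₀ A ≫ g) (h₁ : in₁ A ≫ f = in₁ A ≫ g) : f = g := by
  ext n ⟨x, a⟩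
  obtain h | h := eq_const x
  · rw [h]; exact ConcreteCategory.congr_hom (congr_app h₀ n) a
  · rw [h]; exact ConcreteCategory.congr_hom (congr_app h₁ n) a

/-- The map out of two copies of `A` given by two maps. -/
def desc {A Y : SSet.{u}} (f g : A ⟶ Y) : (ends.{u} : SSet.{u}) ⊗ A ⟶ Y where
  app n := ↾fun x ↦ bif (Codiscrete.equivFun (n := n.unop.len) x.1.1 0).down then g.app n x.2
    else f.app n x.2
  naturality n m φ := by
    ext ⟨x, a⟩
    have hx : (Codiscrete.equivFun (n := m.unop.len) ((ends.{u} : SSet.{u}).map φ x).1 0).down =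
        (Codiscrete.equivFun (n := n.unop.len) x.1 0).down := by
      obtain ⟨x, b, hb⟩ := x
      exact (hb _).trans (hb _).symm
    change (bif (Codiscrete.equivFun (n := m.unop.len) ((ends.{u} : SSet.{u}).map φ x).1 0).down
      then g.app m (A.map φ a) else f.app m (A.map φ a)) =
        Y.map φ (bif (Codiscrete.equivFun (n := n.unop.len) x.1 0).down
          then g.app n a else f.app n a)
    rw [hx]
    cases h : (Codiscrete.equivFun (n := n.unop.len) x.1 0).down
    · exact NatTrans.naturality_apply f φ a
    · exact NatTrans.naturality_apply g φ a

@[simp]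
lemma in₀_desc {A Y : SSet.{u}} (f g : A ⟶ Y) : in₀ A ≫ desc f g = f := rfl

@[simp]
lemma in₁_desc {A Y : SSet.{u}} (f g : A ⟶ Y) : in₁ A ≫ desc f g = g := rfl

end ends

/-- Extension of homotopies with both ends prescribed. -/
lemma IsIsofibration.exists_homotopy {A B X S : SSet.{u}} {p : X ⟶ S} (hp : IsIsofibration p)
    {i : A ⟶ B} (hi : IsIsoAnodyne i) {h : coherentIso ⊗ A ⟶ X} {x y : B ⟶ X}
    {k : coherentIso ⊗ B ⟶ S} (hx : end₀ A ≫ h = i ≫ x) (hy : end₁ A ≫ h = i ≫ y)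
    (hk : h ≫ p = coherentIso ◁ i ≫ k) (hxk : x ≫ p = end₀ B ≫ k) (hyk : y ≫ p = end₁ B ≫ k) :
    ∃ l : coherentIso ⊗ B ⟶ X, coherentIso ◁ i ≫ l = h ∧ end₀ B ≫ l = x ∧ end₁ B ≫ l = y ∧
      l ≫ p = k := by
  have e₀ : ends.in₀ A ≫ (ends.{u} : SSet.{u}) ◁ i = i ≫ ends.in₀ B := by ext1 <;> simp
  have e₁ : ends.in₁ A ≫ (ends.{u} : SSet.{u}) ◁ i = i ≫ ends.in₁ B := by ext1 <;> simp
  obtain ⟨l, h1, h2, h3⟩ := hp.exists_extension ends.ι hi (a := h) (b := ends.desc x y) (c := k)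
    (by
      apply ends.hom_ext
      · rw [reassoc_of% ends.in₀_ι, hx, reassoc_of% e₀, ends.in₀_desc]
      · rw [reassoc_of% ends.in₁_ι, hy, reassoc_of% e₁, ends.in₁_desc]) hk
    (by
      apply ends.hom_ext
      · rw [reassoc_of% ends.in₀_ι, reassoc_of% ends.in₀_desc, hxk]
      · rw [reassoc_of% ends.in₁_ι, reassoc_of% ends.in₁_desc, hyk])
  refine ⟨l, h1, ?_, ?_, h3⟩
  · rw [← reassoc_of% ends.in₀_ι, h2, ends.in₀_desc]
  · rw [← reassoc_of% ends.in₁_ι, h2, ends.in₁_desc]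

/-- Homotopies of homotopies: extension from the end over `x₀` of the outer cylinder, with
prescribed values over the two ends of the inner one. -/
lemma IsIsofibration.exists_homotopy₂ {B X S : SSet.{u}} {p : X ⟶ S} (hp : IsIsofibration p)
    {a b x : coherentIso ⊗ B ⟶ X} {k : coherentIso ⊗ coherentIso ⊗ B ⟶ S}
    (ha : end₀ B ≫ a = end₀ B ≫ x) (hb : end₀ B ≫ b = end₁ B ≫ x)
    (hak : a ≫ p = coherentIso ◁ end₀ B ≫ k) (hbk : b ≫ p = coherentIso ◁ end₁ B ≫ k)
    (hxk : x ≫ p = end₀ _ ≫ k) :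
    ∃ l : coherentIso ⊗ coherentIso ⊗ B ⟶ X, coherentIso ◁ end₀ B ≫ l = a ∧
      coherentIso ◁ end₁ B ≫ l = b ∧ end₀ _ ≫ l = x ∧ l ≫ p = k := by
  let ρ : coherentIso ⊗ (ends.{u} : SSet.{u}) ⊗ B ⟶ (ends.{u} : SSet.{u}) ⊗ coherentIso ⊗ B :=
    lift (snd _ _ ≫ fst _ _) (lift (fst _ _) (snd _ _ ≫ snd _ _))
  have e₀ : coherentIso ◁ ends.in₀ B ≫ ρ = ends.in₀ _ := by
    ext1
    · simp [ρ]
    · ext1 <;> simp [ρ]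
  have e₁ : coherentIso ◁ ends.in₁ B ≫ ρ = ends.in₁ _ := by
    ext1
    · simp [ρ]
    · ext1 <;> simp [ρ]
  have ext' {Y : SSet.{u}} {f g : coherentIso ⊗ (ends.{u} : SSet.{u}) ⊗ B ⟶ Y}
      (h₀ : coherentIso ◁ ends.in₀ B ≫ f = coherentIso ◁ ends.in₀ B ≫ g)
      (h₁ : coherentIso ◁ ends.in₁ B ≫ f = coherentIso ◁ ends.in₁ B ≫ g) : f = g := by
    ext n ⟨x, y, a⟩
    obtain h | h := ends.eq_const y
    · rw [h]; exact ConcreteCategory.congr_hom (congr_app h₀ n)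
        (show (coherentIso ⊗ B : SSet.{u}).obj n from (x, a))
    · rw [h]; exact ConcreteCategory.congr_hom (congr_app h₁ n)
        (show (coherentIso ⊗ B : SSet.{u}).obj n from (x, a))
  obtain ⟨l, h1, h2, h3⟩ := hp.exists_homotopy₀ (ends.ι ▷ B) (h := ρ ≫ ends.desc a b) (x := x)
    (k := k)
    (by
      apply ends.hom_ext
      · rw [← reassoc_of% end₀_whiskerLeft, reassoc_of% e₀, ends.in₀_desc, ha,
          reassoc_of% ends.in₀_ι]
      · rw [← reassoc_of% end₀_whiskerLeft, reassoc_of% e₁, ends.in₁_desc, hb,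
          reassoc_of% ends.in₁_ι])
    (by
      apply ext'
      · rw [Category.assoc, reassoc_of% e₀, reassoc_of% ends.in₀_desc, hak,
          ← whiskerLeft_comp_assoc, ends.in₀_ι]
      · rw [Category.assoc, reassoc_of% e₁, reassoc_of% ends.in₁_desc, hbk,
          ← whiskerLeft_comp_assoc, ends.in₁_ι]) hxk
  refine ⟨l, ?_, ?_, h2, h3⟩
  · rw [← ends.in₀_ι, whiskerLeft_comp_assoc, h1, reassoc_of% e₀, ends.in₀_desc]
  · rw [← ends.in₁_ι, whiskerLeft_comp_assoc, h1, reassoc_of% e₁, ends.in₁_desc]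

end

section

/-! ### Stability properties of isofibrations -/

lemma isIsofibration_terminal_from (X : SSet.{u}) [Quasicategory X] :
    IsIsofibration (terminal.from X) := by
  refine ⟨(quasicategory_iff_innerFibration X).1 inferInstance, ⟨fun {u v} sq ↦ ?_⟩⟩
  refine ⟨⟨⟨SSet.const (u.app _ ⟨_, Subcomplex.mem_ofSimplex_obj _⟩), ?_, Subsingleton.elim _ _⟩⟩⟩
  ext n ⟨_, f, rfl⟩
  obtain rfl : f = (SimplexCategory.const _ _ 0).op := Quiver.Hom.unop_inj (Subsingleton.elim _ _)
  exact (NatTrans.naturality_apply u _ _).symm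

lemma IsIsofibration.of_isPullback {X S X' S' : SSet.{u}} {p : X ⟶ S} (hp : IsIsofibration p)
    {p' : X' ⟶ S'} {a : X' ⟶ X} {b : S' ⟶ S} (h : IsPullback a p' p b) : IsIsofibration p' := by
  have := hp.1
  refine ⟨⟨innerFibrations.of_isPullback h (mem_innerFibrations p)⟩, ?_⟩
  have := hp.2
  exact h.hasLiftingProperty _

lemma IsIsofibration.comp {X Y Z : SSet.{u}} {f : X ⟶ Y} {g : Y ⟶ Z} (hf : IsIsofibration f)
    (hg : IsIsofibration g) : IsIsofibration (f ≫ g) := by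
  have := hf.1
  have := hg.1
  have := hf.2
  have := hg.2
  exact ⟨⟨innerFibrations.comp_mem _ _ (mem_innerFibrations f) (mem_innerFibrations g)⟩,
    inferInstance⟩

lemma IsIsofibration.of_isIsoAnodyne {X S : SSet.{u}} {p : X ⟶ S}
    (h : ∀ ⦃A B : SSet.{u}⦄ (i : A ⟶ B) [Mono i], IsIsoAnodyne i → HasLiftingProperty i p) :
    IsIsofibration p := by
  refine ⟨⟨?_⟩, h _ isIsoAnodyne_ofSimplex_ι⟩
  rintro _ _ _ ⟨i, h0, hn⟩
  exact h _ (isIsoAnodyne_of_inner (innerAnodyneExtensions.horn_ι h0 hn))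

lemma IsIsofibration.quasicategory {X S : SSet.{u}} {p : X ⟶ S} (hp : IsIsofibration p)
    [Quasicategory S] : Quasicategory X := by
  rw [quasicategory_iff_innerFibration, ← terminal.comp_from p]
  exact (hp.comp (isIsofibration_terminal_from S)).1

/-! ### Trivial fibrations -/

/-- Trivial fibrations: maps with the right lifting property against monomorphisms. -/
def IsTrivialFibration {X S : SSet.{u}} (p : X ⟶ S) : Prop :=
  ∀ ⦃A B : SSet.{u}⦄ (i : A ⟶ B) [Mono i], HasLiftingProperty i p

namespace IsTrivialFibration

variable {X S : SSet.{u}} {p : X ⟶ S}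

lemma exists_lift (hp : IsTrivialFibration p) {A B : SSet.{u}} (i : A ⟶ B) [Mono i] {x : A ⟶ X}
    {s : B ⟶ S} (h : x ≫ p = i ≫ s) : ∃ l : B ⟶ X, i ≫ l = x ∧ l ≫ p = s := by
  have := hp i
  have sq : CommSq x i p s := ⟨h⟩
  exact ⟨sq.lift, sq.fac_left, sq.fac_right⟩

/-- Maps lift along a trivial fibration. -/
lemma exists_lift' (hp : IsTrivialFibration p) {B : SSet.{u}} (s : B ⟶ S) :
    ∃ l : B ⟶ X, l ≫ p = s := by
  obtain ⟨l, -, hl⟩ := hp.exists_lift (initial.to B) (x := initial.to X) (s := s)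
    (initial.hom_ext _ _)
  exact ⟨l, hl⟩

lemma isIsofibration (hp : IsTrivialFibration p) : IsIsofibration p :=
  .of_isIsoAnodyne fun _ _ i _ _ ↦ hp i

lemma of_isPullback (hp : IsTrivialFibration p) {X' S' : SSet.{u}}
    {p' : X' ⟶ S'} {a : X' ⟶ X} {b : S' ⟶ S} (h : IsPullback a p' p b) :
    IsTrivialFibration p' := fun _ _ i _ ↦ by
  have := hp i
  exact h.hasLiftingProperty _

/-- Two lifts of the same map along a trivial fibration are fibrewise homotopic. -/
lemma exists_homotopy (hp : IsTrivialFibration p) {A : SSet.{u}} {x y : A ⟶ X}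
    (h : x ≫ p = y ≫ p) : ∃ k : coherentIso ⊗ A ⟶ X, end₀ A ≫ k = x ∧ end₁ A ≫ k = y ∧
      k ≫ p = snd _ _ ≫ x ≫ p := by
  obtain ⟨k, h1, h2⟩ := hp.exists_lift (ends.ι ▷ A) (x := ends.desc x y) (s := snd _ _ ≫ x ≫ p)
    (by
      apply ends.hom_ext
      · rw [reassoc_of% ends.in₀_ι, reassoc_of% ends.in₀_desc, lift_snd_assoc, Category.id_comp]
      · rw [reassoc_of% ends.in₁_ι, reassoc_of% ends.in₁_desc, lift_snd_assoc, Category.id_comp, h])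
  exact ⟨k, by rw [← reassoc_of% ends.in₀_ι, h1, ends.in₀_desc],
    by rw [← reassoc_of% ends.in₁_ι, h1, ends.in₁_desc], h2⟩

end IsTrivialFibration

/-! ### Natural equivalences and categorical equivalences -/

namespace NatEquivalent

variable {X Y Z : SSet.{u}}

lemma refl (f : X ⟶ Y) : NatEquivalent f f :=
  ⟨snd _ _ ≫ f, by simp, by simp⟩

lemma of_eq {f g : X ⟶ Y} (h : f = g) : NatEquivalent f g := h ▸ refl f

lemma symm {f g : X ⟶ Y} (h : NatEquivalent f g) : NatEquivalent g f := by
  obtain ⟨k, h0, h1⟩ := h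
  exact ⟨swap ▷ X ≫ k, by rw [reassoc_of% end₀_swap, h1], by rw [reassoc_of% end₁_swap, h0]⟩

lemma trans [Quasicategory Y] {f g k : X ⟶ Y} (h : NatEquivalent f g) (h' : NatEquivalent g k) :
    NatEquivalent f k := by
  obtain ⟨x, hx0, hx1⟩ := h
  obtain ⟨b, hb0, hb1⟩ := h'
  obtain ⟨l, h1, h2, h3, -⟩ := (isIsofibration_terminal_from Y).exists_homotopy₂
    (a := snd _ _ ≫ f) (b := b) (x := x) (k := terminal.from _) (by rw [hx0]; simp)
    (by rw [hx1, hb0]) (Subsingleton.elim _ _) (Subsingleton.elim _ _) (Subsingleton.elim _ _)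
  refine ⟨end₁ _ ≫ l, ?_, ?_⟩
  · rw [← reassoc_of% end₁_whiskerLeft, h1]; simp
  · rw [← reassoc_of% end₁_whiskerLeft, h2, hb1]

lemma whiskerLeft (f : X ⟶ Y) {g g' : Y ⟶ Z} (h : NatEquivalent g g') :
    NatEquivalent (f ≫ g) (f ≫ g') := by
  obtain ⟨k, h0, h1⟩ := h
  exact ⟨coherentIso ◁ f ≫ k, by rw [reassoc_of% end₀_whiskerLeft, h0],
    by rw [reassoc_of% end₁_whiskerLeft, h1]⟩

lemma whiskerRight {f f' : X ⟶ Y} (h : NatEquivalent f f') (g : Y ⟶ Z) :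
    NatEquivalent (f ≫ g) (f' ≫ g) := by
  obtain ⟨k, h0, h1⟩ := h
  exact ⟨k ≫ g, by rw [← h0, Category.assoc], by rw [← h1, Category.assoc]⟩

end NatEquivalent

namespace IsCategoricalEquivalence

variable {X Y Z : SSet.{u}}

lemma id (X : SSet.{u}) : IsCategoricalEquivalence (𝟙 X) :=
  ⟨𝟙 X, .of_eq (by simp), .of_eq (by simp)⟩

lemma comp [Quasicategory X] [Quasicategory Y] [Quasicategory Z] {f : X ⟶ Y} {g : Y ⟶ Z}
    (hf : IsCategoricalEquivalence f)
    (hg : IsCategoricalEquivalence g) : IsCategoricalEquivalence (f ≫ g) := by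
  obtain ⟨f', h1, h2⟩ := hf
  obtain ⟨g', h3, h4⟩ := hg
  refine ⟨g' ≫ f', ?_, ?_⟩
  · have := (h3.whiskerRight f').whiskerLeft f
    simp only [Category.assoc, Category.id_comp] at this ⊢
    exact this.trans h1
  · have := (h2.whiskerRight g).whiskerLeft g'
    simp only [Category.assoc, Category.id_comp] at this ⊢
    exact this.trans h4

lemma of_comp_right [Quasicategory X] [Quasicategory Y] {f : X ⟶ Y} {g : Y ⟶ Z}
    (hg : IsCategoricalEquivalence g)
    (hfg : IsCategoricalEquivalence (f ≫ g)) : IsCategoricalEquivalence f := by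
  obtain ⟨g', h1, h2⟩ := hg
  obtain ⟨k, h3, h4⟩ := hfg
  refine ⟨g ≫ k, by simpa using h3, ?_⟩
  -- `g k f ∼ g k f g g' ∼ g g' ∼ 1`
  have e1 := (h1.whiskerLeft (g ≫ k ≫ f)).symm
  have e2 := (h4.whiskerRight g').whiskerLeft g
  simp only [Category.assoc, Category.id_comp, Category.comp_id] at e1 e2 ⊢
  exact (e1.trans e2).trans h1

lemma of_comp_left [Quasicategory Y] [Quasicategory Z] {f : X ⟶ Y} {g : Y ⟶ Z}
    (hf : IsCategoricalEquivalence f)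
    (hfg : IsCategoricalEquivalence (f ≫ g)) : IsCategoricalEquivalence g := by
  obtain ⟨f', h1, h2⟩ := hf
  obtain ⟨k, h3, h4⟩ := hfg
  refine ⟨k ≫ f, ?_, by simpa using h4⟩
  -- `g k f ∼ f' f g k f ∼ f' f ∼ 1`
  have e1 := (h2.whiskerRight (g ≫ k ≫ f)).symm
  have e2 := (h3.whiskerRight f).whiskerLeft f'
  simp only [Category.assoc, Category.id_comp] at e1 e2 ⊢
  exact (e1.trans e2).trans h2

end IsCategoricalEquivalence

lemma IsTrivialFibration.isCategoricalEquivalence {X S : SSet.{u}} {p : X ⟶ S}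
    (hp : IsTrivialFibration p) : IsCategoricalEquivalence p := by
  obtain ⟨s, hs⟩ := hp.exists_lift' (𝟙 S)
  obtain ⟨k, h0, h1, -⟩ := hp.exists_homotopy (x := p ≫ s) (y := 𝟙 X) (by simp [hs])
  exact ⟨s, ⟨k, h0, h1⟩, .of_eq hs⟩

/-- The map `coherentIso ⊗ coherentIso ⟶ coherentIso` which on vertices is
`(v, u) ↦ u ∧ ¬ v`. -/
def andNot : coherentIso.{u} ⊗ coherentIso ⟶ coherentIso where
  app n := ↾fun x ↦ Codiscrete.equivFun.symm fun i ↦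
    ⟨(Codiscrete.equivFun (n := n.unop.len) x.2 i).down &&
      !(Codiscrete.equivFun (n := n.unop.len) x.1 i).down⟩

/-- The homotopy of homotopies from the identity of a homotopy to the constant homotopy,
which is the reverse homotopy on one end. -/
def contraction (X : SSet.{u}) : coherentIso ⊗ coherentIso ⊗ X ⟶ coherentIso ⊗ X :=
  lift (lift (fst _ _) (snd _ _ ≫ fst _ _) ≫ andNot) (snd _ _ ≫ snd _ _)

lemma end₀_contraction (X : SSet.{u}) : end₀ _ ≫ contraction X = 𝟙 _ := by
  ext1
  · apply hom_ext_coherentIso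
    intro n x i
    exact Bool.and_true _
  · simp [contraction]

lemma end₁_contraction (X : SSet.{u}) : end₁ _ ≫ contraction X = snd _ _ ≫ end₀ X := by
  ext1
  · apply hom_ext_coherentIso
    intro n x i
    exact Bool.and_false (Codiscrete.equivFun (n := n) x.1 i).down
  · simp [contraction]

lemma whiskerLeft_end₀_contraction (X : SSet.{u}) :
    coherentIso ◁ end₀ X ≫ contraction X = snd _ _ ≫ end₀ X := by
  ext1
  · apply hom_ext_coherentIso
    intro n x i
    exact Bool.false_and !(Codiscrete.equivFun (n := n) x.1 i).down
  · simp [contraction]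

lemma whiskerLeft_end₁_contraction (X : SSet.{u}) :
    coherentIso ◁ end₁ X ≫ contraction X = swap ▷ X := by
  ext1
  · apply hom_ext_coherentIso
    intro n x i
    exact Bool.true_and _
  · simp [contraction]

/-- An isofibration which is an equivalence has a section, and the homotopy between
the identity and the resulting idempotent can be chosen fibrewise. -/
lemma IsIsofibration.exists_section {X S : SSet.{u}} [Quasicategory X] {p : X ⟶ S}
    (hp : IsIsofibration p) (h : IsCategoricalEquivalence p) :
    ∃ (s : S ⟶ X) (k : coherentIso ⊗ X ⟶ X), s ≫ p = 𝟙 S ∧ end₀ X ≫ k = 𝟙 X ∧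
      end₁ X ≫ k = p ≫ s ∧ k ≫ p = snd _ _ ≫ p := by
  obtain ⟨g, hg, m, hm0, hm1⟩ := h
  have hi : Mono (initial.to S) := inferInstance
  have hI : IsInitial (coherentIso ⊗ ⊥_ SSet.{u}) :=
    IsInitial.isInitialObj (tensorLeft _) _ initialIsInitial
  obtain ⟨l, -, hl0, hl⟩ := hp.exists_homotopy₀ (initial.to S) (h := hI.to X) (x := g) (k := m)
    (initialIsInitial.hom_ext _ _) (hI.hom_ext _ _) hm0.symm
  -- lifting the homotopy from `g ≫ p` to the identity turns the inverse `g` into a strict section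
  let s : S ⟶ X := end₁ S ≫ l
  have hs : s ≫ p = 𝟙 S := by rw [Category.assoc, hl, hm1]
  have hgs : NatEquivalent g s := ⟨l, hl0, rfl⟩
  obtain ⟨H, hH0, hH1⟩ := hg.symm.trans (hgs.whiskerLeft p)
  have hHp : end₁ X ≫ H ≫ p = p := by
    have := hH1 =≫ p
    rw [Category.assoc, Category.assoc, hs, Category.comp_id] at this
    exact this
  -- the homotopy `H` lies over the loop `H ≫ p`, which is contracted against its own reverse
  obtain ⟨Θ, h1, h2, h3, h4⟩ := hp.exists_homotopy₂ (a := snd _ _) (b := swap ▷ X ≫ H ≫ p ≫ s)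
    (x := H) (k := contraction X ≫ H ≫ p) (by rw [hH0]; simp)
    (by rw [reassoc_of% end₀_swap, reassoc_of% hHp, hH1])
    (by rw [reassoc_of% whiskerLeft_end₀_contraction, reassoc_of% hH0])
    (by rw [reassoc_of% whiskerLeft_end₁_contraction]; simp [hs])
    (by rw [reassoc_of% end₀_contraction])
  refine ⟨s, end₁ _ ≫ Θ, hs, ?_, ?_, ?_⟩
  · rw [← reassoc_of% end₁_whiskerLeft, h1]; simp
  · rw [← reassoc_of% end₁_whiskerLeft, h2, reassoc_of% end₁_swap, reassoc_of% hH0]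
  · rw [Category.assoc, h4, reassoc_of% end₁_contraction, reassoc_of% hH0]

/-- An isofibration of quasicategories which is a categorical equivalence is a trivial fibration: a
lifting problem is solved up to a fibrewise homotopy by a section, and the solution is corrected by
extending this homotopy. -/
lemma IsIsofibration.isTrivialFibration {X S : SSet.{u}} [Quasicategory X] {p : X ⟶ S}
    (hp : IsIsofibration p) (h : IsCategoricalEquivalence p) : IsTrivialFibration p := by
  intro A B i _
  obtain ⟨s, k, hs, hk0, hk1, hk⟩ := hp.exists_section h
  refine ⟨fun {x b} sq ↦ ?_⟩
  obtain ⟨l, h1, h2, h3⟩ := hp.exists_homotopy₁ i (h := coherentIso ◁ x ≫ k) (x := b ≫ s)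
    (k := snd _ _ ≫ b)
    (by rw [reassoc_of% end₁_whiskerLeft, hk1, reassoc_of% sq.w])
    (by rw [Category.assoc, hk, whiskerLeft_snd_assoc, whiskerLeft_snd_assoc, sq.w])
    (by rw [Category.assoc, hs, lift_snd_assoc, Category.comp_id, Category.id_comp])
  refine ⟨⟨⟨end₀ B ≫ l, ?_, ?_⟩⟩⟩
  · rw [← reassoc_of% end₀_whiskerLeft, h1, reassoc_of% end₀_whiskerLeft, hk0, Category.comp_id]
  · rw [Category.assoc, h3, lift_snd_assoc, Category.id_comp]

end

section

/-! ### Path spaces -/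

/-- The space of pairs of a point `y` of `Y` and an equivalence in `Z` out of `φ y`, which is
constant over `T`, described by its universal property. For a terminal `T` this is the
isofibrant replacement of `φ`. -/
structure PathSpace {Y Z T : SSet.{u}} (φ : Y ⟶ Z) (r : Z ⟶ T) where
  /-- the simplicial set of pairs -/
  pt : SSet.{u}
  /-- the projection to the point of `Y` -/
  src : pt ⟶ Y
  /-- the universal equivalence -/
  path : coherentIso ⊗ pt ⟶ Z
  end₀_path : end₀ pt ≫ path = src ≫ φ
  path_comp : path ≫ r = snd _ _ ≫ src ≫ φ ≫ r
  exists_lift {A : SSet.{u}} (y : A ⟶ Y) (h : coherentIso ⊗ A ⟶ Z) (hy : end₀ A ≫ h = y ≫ φ)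
    (hr : h ≫ r = snd _ _ ≫ y ≫ φ ≫ r) : ∃ a : A ⟶ pt, a ≫ src = y ∧ coherentIso ◁ a ≫ path = h
  hom_ext {A : SSet.{u}} {a b : A ⟶ pt} (h : a ≫ src = b ≫ src)
    (h' : coherentIso ◁ a ≫ path = coherentIso ◁ b ≫ path) : a = b

namespace PathSpace

variable {Y Z T : SSet.{u}} {φ : Y ⟶ Z} {r : Z ⟶ T} (P : PathSpace φ r)

/-- The target of the equivalence. -/
def tgt : P.pt ⟶ Z := end₁ _ ≫ P.path

lemma end₁_path : end₁ _ ≫ P.path = P.tgt := rfl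

lemma tgt_comp : P.tgt ≫ r = P.src ≫ φ ≫ r := by
  rw [tgt, Category.assoc, P.path_comp]; simp

lemma exists_incl : ∃ j : Y ⟶ P.pt, j ≫ P.src = 𝟙 Y ∧ coherentIso ◁ j ≫ P.path = snd _ _ ≫ φ :=
  P.exists_lift _ _ (by simp) (by simp)

/-- The constant equivalences. -/
def incl : Y ⟶ P.pt := P.exists_incl.choose

@[simp]
lemma incl_src : P.incl ≫ P.src = 𝟙 Y := P.exists_incl.choose_spec.1

lemma incl_path : coherentIso ◁ P.incl ≫ P.path = snd _ _ ≫ φ := P.exists_incl.choose_spec.2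

@[simp]
lemma incl_tgt : P.incl ≫ P.tgt = φ := by
  rw [tgt, ← reassoc_of% end₁_whiskerLeft, P.incl_path]; simp

/-- Forgetting the equivalence is a trivial fibration, since homotopies extend from the end over
`x₀`. -/
lemma isTrivialFibration_src (hr : IsIsofibration r) : IsTrivialFibration P.src := by
  intro A B i _
  refine ⟨fun {x y} sq ↦ ?_⟩
  obtain ⟨l, h1, h2, h3⟩ := hr.exists_homotopy₀ i (h := coherentIso ◁ x ≫ P.path) (x := y ≫ φ)
    (k := snd _ _ ≫ y ≫ φ ≫ r) (by rw [reassoc_of% end₀_whiskerLeft, P.end₀_path, sq.w_assoc])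
    (by rw [Category.assoc, P.path_comp, whiskerLeft_snd_assoc, sq.w_assoc, whiskerLeft_snd_assoc])
    (by simp)
  obtain ⟨a, h4, h5⟩ := P.exists_lift y l h2 h3
  refine ⟨⟨⟨a, P.hom_ext ?_ ?_, h4⟩⟩⟩
  · rw [Category.assoc, h4, sq.w]
  · rw [whiskerLeft_comp, Category.assoc, h5, h1]

/-- The target map is an isofibration: both ends of the required homotopy can be prescribed. -/
lemma isIsofibration_tgt (hr : IsIsofibration r) (hφ : IsIsofibration (φ ≫ r)) :
    IsIsofibration P.tgt := by
  refine .of_isIsoAnodyne fun A B i _ hi ↦ ⟨fun {x z} sq ↦ ?_⟩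
  have := hi _ hφ
  have sq' : CommSq (x ≫ P.src) i (φ ≫ r) (z ≫ r) := ⟨by
    rw [Category.assoc, ← P.tgt_comp, sq.w_assoc]⟩
  obtain ⟨l, h1, h2, h3, h4⟩ := hr.exists_homotopy hi (h := coherentIso ◁ x ≫ P.path)
    (x := sq'.lift ≫ φ) (y := z) (k := snd _ _ ≫ z ≫ r)
    (by rw [reassoc_of% end₀_whiskerLeft, P.end₀_path, sq'.fac_left_assoc, Category.assoc])
    (by rw [reassoc_of% end₁_whiskerLeft, P.end₁_path, sq.w])
    (by rw [Category.assoc, P.path_comp, whiskerLeft_snd_assoc, whiskerLeft_snd_assoc,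
      ← P.tgt_comp, sq.w_assoc])
    (by rw [lift_snd_assoc, Category.id_comp, Category.assoc, sq'.fac_right]) (by simp)
  obtain ⟨a, h5, h6⟩ := P.exists_lift sq'.lift l h2 (by rw [h4, sq'.fac_right])
  refine ⟨⟨⟨a, P.hom_ext ?_ ?_, ?_⟩⟩⟩
  · rw [Category.assoc, h5, sq'.fac_left]
  · rw [whiskerLeft_comp, Category.assoc, h6, h1]
  · rw [← P.end₁_path, ← reassoc_of% end₁_whiskerLeft, h6, h3]

lemma isCategoricalEquivalence_incl [Quasicategory Y] (hr : IsIsofibration r)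
    [Quasicategory P.pt] : IsCategoricalEquivalence P.incl := by
  refine (P.isTrivialFibration_src hr).isCategoricalEquivalence.of_comp_right ?_
  rw [incl_src]
  exact .id _

/-- A homotopy, constant over `Y`, from the identity to the constant equivalences. -/
lemma exists_homotopy_incl (hr : IsIsofibration r) : ∃ k : coherentIso ⊗ P.pt ⟶ P.pt,
    end₀ _ ≫ k = 𝟙 _ ∧ end₁ _ ≫ k = P.src ≫ P.incl ∧ k ≫ P.src = snd _ _ ≫ P.src := by
  obtain ⟨k, h0, h1, h2⟩ := (P.isTrivialFibration_src hr).exists_homotopy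
    (x := 𝟙 _) (y := P.src ≫ P.incl) (by simp)
  exact ⟨k, h0, h1, by simpa using h2⟩

/-! ### The isofibrant replacement as a path space -/

lemma uncurry_evalAt {A S : SSet.{u}} (j : coherentIso.{u} _⦋0⦌)
    (h : A ⟶ (ihom coherentIso.{u}).obj S) :
    h ≫ evalAt S j = lift (SSet.const j) (𝟙 A) ≫ MonoidalClosed.uncurry h := by
  rw [evalAt, MonoidalClosed.uncurry_eq, ← Category.assoc, ← Category.assoc]
  congr 1

/-- The equivalence in `S` which is part of a point of the replacement. -/
def _root_.ICat.Repl.equiv {X S : SSet.{u}} (p : X ⟶ S) : Repl p ⟶ (ihom coherentIso.{u}).obj S :=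
  pullback.snd p (evalAt S coherentIso.x₀)

lemma _root_.ICat.Repl.isPullback {X S : SSet.{u}} (p : X ⟶ S) :
    IsPullback (Repl.source p) (Repl.equiv p) p (evalAt S coherentIso.x₀) :=
  IsPullback.of_hasPullback _ _

/-- The isofibrant replacement is the path space over the terminal object. -/
def ofRepl {X S : SSet.{u}} (p : X ⟶ S) : PathSpace p (terminal.from S) where
  pt := Repl p
  src := Repl.source p
  path := MonoidalClosed.uncurry (Repl.equiv p)
  end₀_path := by
    rw [← uncurry_evalAt, (Repl.isPullback p).w]
  path_comp := Subsingleton.elim _ _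
  exists_lift {A} y h hy _ := by
    refine ⟨(Repl.isPullback p).lift y (MonoidalClosed.curry h) ?_,
      (Repl.isPullback p).lift_fst _ _ _, ?_⟩
    · rw [uncurry_evalAt, MonoidalClosed.uncurry_curry, hy]
    · rw [← MonoidalClosed.uncurry_natural_left, (Repl.isPullback p).lift_snd,
        MonoidalClosed.uncurry_curry]
  hom_ext {A a b} h h' := by
    rw [← MonoidalClosed.uncurry_natural_left, ← MonoidalClosed.uncurry_natural_left] at h'
    exact (Repl.isPullback p).hom_ext h (MonoidalClosed.uncurry_injective h')

lemma ofRepl_tgt {X S : SSet.{u}} (p : X ⟶ S) : (ofRepl p).tgt = Repl.proj p :=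
  (uncurry_evalAt _ (Repl.equiv p)).symm

lemma ofRepl_incl {X S : SSet.{u}} (p : X ⟶ S) : (ofRepl p).incl = Repl.incl p := by
  apply (ofRepl p).hom_ext
  · rw [incl_src]
    exact (pullback.lift_fst _ _ _).symm
  · rw [incl_path]
    have : Repl.incl p ≫ Repl.equiv p = p ≫ MonoidalClosed.curry (snd coherentIso.{u} S) :=
      pullback.lift_snd _ _ _
    refine Eq.trans ?_ (MonoidalClosed.uncurry_natural_left (Repl.incl p) (Repl.equiv p))
    rw [this, MonoidalClosed.uncurry_natural_left, MonoidalClosed.uncurry_curry, whiskerLeft_snd]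

/-! ### Relative path spaces -/

/-- The equivalences which are constant over `T` form a path space. -/
def rel (φ : Y ⟶ Z) (r : Z ⟶ T) : PathSpace φ r where
  pt := equalizer (MonoidalClosed.curry ((ofRepl φ).path ≫ r))
    (MonoidalClosed.curry (snd _ _ ≫ (ofRepl φ).src ≫ φ ≫ r))
  src := equalizer.ι _ _ ≫ (ofRepl φ).src
  path := coherentIso ◁ equalizer.ι _ _ ≫ (ofRepl φ).path
  end₀_path := by
    rw [reassoc_of% end₀_whiskerLeft, end₀_path, Category.assoc]
  path_comp := by
    have := equalizer.condition (MonoidalClosed.curry ((ofRepl φ).path ≫ r))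
      (MonoidalClosed.curry (snd _ _ ≫ (ofRepl φ).src ≫ φ ≫ r))
    rw [← MonoidalClosed.curry_natural_left, ← MonoidalClosed.curry_natural_left] at this
    rw [Category.assoc, MonoidalClosed.curry_injective this]
    simp
  exists_lift {A} y h hy hr := by
    obtain ⟨a, h1, h2⟩ := (ofRepl φ).exists_lift y h hy (Subsingleton.elim _ _)
    refine ⟨equalizer.lift a ?_, ?_, ?_⟩
    · rw [← MonoidalClosed.curry_natural_left, ← MonoidalClosed.curry_natural_left,
        reassoc_of% h2, hr, whiskerLeft_snd_assoc, reassoc_of% h1]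
    · rw [equalizer.lift_ι_assoc, h1]
    · rw [← whiskerLeft_comp_assoc, equalizer.lift_ι, h2]
  hom_ext {A a b} h h' := by
    apply equalizer.hom_ext
    apply (ofRepl φ).hom_ext
    · simpa using h
    · simpa using h'

end PathSpace

end

section

/-! ### Lifting problems with a fixed top side -/

/-- Every lifting problem for `i` against `p` with top side `σ` has a solution. -/
def LiftsAt {A B X S : SSet.{u}} (i : A ⟶ B) (p : X ⟶ S) (σ : A ⟶ X) : Prop :=
  ∀ τ : B ⟶ S, σ ≫ p = i ≫ τ → ∃ l : B ⟶ X, i ≫ l = σ ∧ l ≫ p = τ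

lemma hasLiftingProperty_iff_forall_liftsAt {A B X S : SSet.{u}} {i : A ⟶ B} {p : X ⟶ S} :
    HasLiftingProperty i p ↔ ∀ σ, LiftsAt i p σ := by
  constructor
  · intro h σ τ w
    have sq : CommSq σ i p τ := ⟨w⟩
    exact ⟨sq.lift, sq.fac_left, sq.fac_right⟩
  · intro h
    refine ⟨fun {σ τ} sq ↦ ?_⟩
    obtain ⟨l, h1, h2⟩ := h σ τ sq.w
    exact ⟨⟨⟨l, h1, h2⟩⟩⟩

namespace LiftsAt

variable {A B X S X' S' : SSet.{u}} {i : A ⟶ B}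

lemma of_isPullback {p : X ⟶ S} {p' : X' ⟶ S'} {a : X' ⟶ X} {b : S' ⟶ S}
    (h : IsPullback a p' p b) {σ : A ⟶ X'} (hσ : LiftsAt i p (σ ≫ a)) : LiftsAt i p' σ := by
  intro τ w
  obtain ⟨l, h1, h2⟩ := hσ (τ ≫ b) (by rw [Category.assoc, h.w, reassoc_of% w])
  refine ⟨h.lift l τ h2, h.hom_ext ?_ ?_, h.lift_snd _ _ _⟩
  · rw [Category.assoc, h.lift_fst, h1]
  · rw [Category.assoc, h.lift_snd, w]

/-- A trivial fibration in front of `p` does not affect the solvability of lifting problems. -/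
lemma trivial_comp [Mono i] {t : X' ⟶ X} (ht : IsTrivialFibration t) {p : X ⟶ S} {σ : A ⟶ X'}
    (hσ : LiftsAt i p (σ ≫ t)) : LiftsAt i (t ≫ p) σ := by
  intro τ w
  obtain ⟨l, h1, h2⟩ := hσ τ (by simpa using w)
  obtain ⟨l', h3, h4⟩ := ht.exists_lift i h1.symm
  exact ⟨l', h3, by rw [reassoc_of% h4, h2]⟩

/-- The solvability of lifting problems descends from `p'` to `p` along a commutative square whose
side `b` between the targets is a trivial fibration. -/
lemma descend [Mono i] {p : X ⟶ S} {p' : X' ⟶ S'} {a : X' ⟶ X} {b : S' ⟶ S}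
    (hb : IsTrivialFibration b) (w : a ≫ p = p' ≫ b) {σ : A ⟶ X'} (hσ : LiftsAt i p' σ) :
    LiftsAt i p (σ ≫ a) := by
  intro τ hτ
  obtain ⟨τ', h1, h2⟩ := hb.exists_lift i (x := σ ≫ p') (s := τ)
    (by rw [Category.assoc, ← w, ← hτ, Category.assoc])
  obtain ⟨l, h3, h4⟩ := hσ τ' h1.symm
  exact ⟨l ≫ a, by rw [reassoc_of% h3], by rw [Category.assoc, w, reassoc_of% h4, h2]⟩

/-- Lifting problems can be moved along an equivalence: from `P.tgt` to the map `φ` itself. -/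
lemma tgt [Mono i] {Y Z T : SSet.{u}} {φ : Y ⟶ Z} {r : Z ⟶ T} (hr : IsIsofibration r)
    (P : PathSpace φ r) {σ : A ⟶ P.pt} (hσ : LiftsAt i φ (σ ≫ P.src)) : LiftsAt i P.tgt σ := by
  intro τ hτ
  obtain ⟨k, h1, h2, h3⟩ := hr.exists_homotopy₁ i (h := coherentIso ◁ σ ≫ P.path) (x := τ)
    (k := snd _ _ ≫ τ ≫ r) (by rw [reassoc_of% end₁_whiskerLeft, P.end₁_path, hτ])
    (by rw [Category.assoc, P.path_comp, ← P.tgt_comp, whiskerLeft_snd_assoc,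
      whiskerLeft_snd_assoc, reassoc_of% hτ]) (by simp)
  obtain ⟨l, h4, h5⟩ := hσ (end₀ B ≫ k)
    (by rw [← reassoc_of% end₀_whiskerLeft, h1, reassoc_of% end₀_whiskerLeft, P.end₀_path,
      Category.assoc])
  obtain ⟨a, h6, h7⟩ := P.exists_lift l k h5.symm
    (by rw [h3, reassoc_of% h5, h3, lift_snd_assoc, Category.id_comp])
  refine ⟨a, P.hom_ext ?_ ?_, ?_⟩
  · rw [Category.assoc, h6, h4]
  · rw [whiskerLeft_comp_assoc, h7, h1]
  · rw [← P.end₁_path, ← reassoc_of% end₁_whiskerLeft, h7, h2]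

/-- Invariance of lifting problems against an isofibration under equivalence of the top side. -/
lemma of_homotopy [Mono i] {p : X ⟶ S} (hp : IsIsofibration p) [Quasicategory S]
    {h : coherentIso ⊗ A ⟶ X} (h₀ : LiftsAt i p (end₀ A ≫ h)) : LiftsAt i p (end₁ A ≫ h) := by
  intro τ hτ
  obtain ⟨k, h1, h2, -⟩ := (isIsofibration_terminal_from S).exists_homotopy₁ i (h := h ≫ p)
    (x := τ) (k := terminal.from _) (by rw [← hτ, Category.assoc]) (Subsingleton.elim _ _)
    (Subsingleton.elim _ _)
  obtain ⟨l, h3, h4⟩ := h₀ (end₀ B ≫ k)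
    (by rw [← reassoc_of% end₀_whiskerLeft, h1, Category.assoc])
  obtain ⟨m, h5, h6, h7⟩ := hp.exists_homotopy₀ i (h := h) (x := l) (k := k) h3.symm h1.symm h4
  exact ⟨end₁ B ≫ m, by rw [← reassoc_of% end₁_whiskerLeft, h5], by rw [Category.assoc, h7, h2]⟩

end LiftsAt

/-! ### Cartesian edges -/

lemma mono_of_strictMono {n d : ℕ} {x : (Δ[n] : SSet.{u}) _⦋d⦌} (hx : StrictMono x) :
    Mono (yonedaEquiv.symm x) :=
  Nonsingular.mono' _ (stdSimplex.mem_nonDegenerate_iff_strictMono _ |>.2 hx)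

/-- The inclusion of the last edge in an outer horn. -/
def lastEdgeι (n : ℕ) : Δ[1] ⟶ (Λ[n + 2, Fin.last (n + 2)] : SSet.{u}) :=
  yonedaEquiv.symm (lastEdge n)

instance (n : ℕ) : Mono (lastEdgeι.{u} n) := by
  have : Mono (lastEdgeι.{u} n ≫ Λ[n + 2, Fin.last (n + 2)].ι) := by
    have h : lastEdgeι.{u} n ≫ Λ[n + 2, Fin.last (n + 2)].ι =
        yonedaEquiv.symm (lastEdge.{u} n).1 := rfl
    rw [h]
    apply mono_of_strictMono
    intro a b hab
    fin_cases a <;> fin_cases b <;> simp at hab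
    exact Fin.castSucc_lt_last _
  exact mono_of_mono _ Λ[n + 2, Fin.last (n + 2)].ι

/-- Cartesian edges with respect to an inner fibration, given as maps out of `Δ[1]`. -/
def IsCartesian {X S : SSet.{u}} (p : X ⟶ S) (e : Δ[1] ⟶ X) : Prop :=
  ∀ (n : ℕ) (σ : (Λ[n + 2, Fin.last (n + 2)] : SSet.{u}) ⟶ X), lastEdgeι n ≫ σ = e →
    LiftsAt Λ[n + 2, Fin.last (n + 2)].ι p σ

lemma isCartesianLift_iff {X S : SSet.{u}} {p : X ⟶ S} {e : X _⦋1⦌} :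
    IsCartesianLift p e ↔ IsCartesian p (yonedaEquiv.symm e) := by
  have key (n : ℕ) (σ : (Λ[n + 2, Fin.last (n + 2)] : SSet.{u}) ⟶ X) :
      lastEdgeι n ≫ σ = yonedaEquiv.symm e ↔ σ.app _ (lastEdge n) = e := by
    rw [lastEdgeι, yonedaEquiv_symm_comp]
    exact yonedaEquiv.symm.injective.eq_iff
  constructor
  · intro h n σ hσ τ hτ
    exact h n σ τ hτ ((key n σ).1 hσ)
  · intro h n σ τ hτ hσ
    exact h n σ ((key n σ).2 hσ) τ hτ

lemma isCartesianLift_yonedaEquiv {X S : SSet.{u}} {p : X ⟶ S} {e : Δ[1] ⟶ X} :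
    IsCartesianLift p (yonedaEquiv e) ↔ IsCartesian p e := by
  rw [isCartesianLift_iff, Equiv.symm_apply_apply]

/-- The existence of Cartesian lifts. -/
def HasCartesianLifts {X S : SSet.{u}} (p : X ⟶ S) : Prop :=
  ∀ (y : Δ[0] ⟶ X) (v : Δ[1] ⟶ S), stdSimplex.δ 0 ≫ v = y ≫ p →
    ∃ e : Δ[1] ⟶ X, stdSimplex.δ 0 ≫ e = y ∧ e ≫ p = v ∧ IsCartesian p e

lemma isCartesianInnerFibration_iff {X S : SSet.{u}} {p : X ⟶ S} :
    IsCartesianInnerFibration p ↔ InnerFibration p ∧ HasCartesianLifts p := by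
  refine and_congr_right fun _ ↦ ⟨fun h y v w ↦ ?_, fun h y v w ↦ ?_⟩
  · obtain ⟨e, h1, h2, h3⟩ := h (yonedaEquiv y) (yonedaEquiv v)
      (by rw [← yonedaEquiv_comp, ← w, stdSimplex.yonedaEquiv_δ_comp])
    refine ⟨yonedaEquiv.symm e, ?_, ?_, isCartesianLift_iff.1 h3⟩
    · rw [stdSimplex.δ_comp_yonedaEquiv_symm, h1, Equiv.symm_apply_apply]
    · rw [yonedaEquiv_symm_comp, h2, Equiv.symm_apply_apply]
  · obtain ⟨e, h1, h2, h3⟩ := h (yonedaEquiv.symm y) (yonedaEquiv.symm v)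
      (by rw [yonedaEquiv_symm_comp, stdSimplex.δ_comp_yonedaEquiv_symm, w])
    refine ⟨yonedaEquiv e, ?_, ?_, isCartesianLift_yonedaEquiv.2 h3⟩
    · rw [← stdSimplex.yonedaEquiv_δ_comp, h1, Equiv.apply_symm_apply]
    · rw [← yonedaEquiv_comp, h2, Equiv.apply_symm_apply]

namespace IsCartesian

variable {X S X' S' : SSet.{u}}

lemma of_isPullback {p : X ⟶ S} {p' : X' ⟶ S'} {a : X' ⟶ X} {b : S' ⟶ S}
    (h : IsPullback a p' p b) {e : Δ[1] ⟶ X'} (he : IsCartesian p (e ≫ a)) : IsCartesian p' e :=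
  fun n σ hσ ↦ .of_isPullback h (he n _ (by rw [reassoc_of% hσ]))

lemma trivial_comp {t : X' ⟶ X} (ht : IsTrivialFibration t) {p : X ⟶ S} {e : Δ[1] ⟶ X'}
    (he : IsCartesian p (e ≫ t)) : IsCartesian (t ≫ p) e :=
  fun n σ hσ ↦ .trivial_comp ht (he n _ (by rw [reassoc_of% hσ]))

lemma descend {p : X ⟶ S} {p' : X' ⟶ S'} {a : X' ⟶ X} {b : S' ⟶ S} (ha : IsTrivialFibration a)
    (hb : IsTrivialFibration b) (w : a ≫ p = p' ≫ b) {e : Δ[1] ⟶ X'} (he : IsCartesian p' e) :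
    IsCartesian p (e ≫ a) := fun n σ hσ ↦ by
  obtain ⟨σ', h1, rfl⟩ := ha.exists_lift (lastEdgeι n) hσ.symm
  exact (he n σ' h1).descend hb w

lemma tgt {Y Z T : SSet.{u}} {φ : Y ⟶ Z} {r : Z ⟶ T} (hr : IsIsofibration r) (P : PathSpace φ r)
    {e : Δ[1] ⟶ P.pt} (he : IsCartesian φ (e ≫ P.src)) : IsCartesian P.tgt e :=
  fun n σ hσ ↦ .tgt hr P (he n _ (by rw [reassoc_of% hσ]))

/-- Invariance of Cartesian edges under equivalence. -/
lemma of_homotopy {p : X ⟶ S} (hp : IsIsofibration p) [Quasicategory X] [Quasicategory S]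
    {h : coherentIso ⊗ Δ[1] ⟶ X} (h₀ : IsCartesian p (end₀ _ ≫ h)) :
    IsCartesian p (end₁ _ ≫ h) := fun n σ hσ ↦ by
  obtain ⟨k, h1, rfl, -⟩ := (isIsofibration_terminal_from X).exists_homotopy₁ (lastEdgeι n)
    (h := h) (x := σ) (k := terminal.from _) hσ.symm (Subsingleton.elim _ _)
    (Subsingleton.elim _ _)
  exact .of_homotopy hp (h₀ n _ (by rw [← reassoc_of% end₀_whiskerLeft, h1]))

lemma of_homotopy' {p : X ⟶ S} (hp : IsIsofibration p) [Quasicategory X] [Quasicategory S]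
    {h : coherentIso ⊗ Δ[1] ⟶ X} (h₁ : IsCartesian p (end₁ _ ≫ h)) :
    IsCartesian p (end₀ _ ≫ h) := by
  rw [← reassoc_of% end₁_swap]
  apply of_homotopy hp
  rwa [reassoc_of% end₀_swap]

end IsCartesian

namespace HasCartesianLifts

variable {X S X' S' : SSet.{u}}

lemma of_isPullback {p : X ⟶ S} {p' : X' ⟶ S'} {a : X' ⟶ X} {b : S' ⟶ S}
    (h : IsPullback a p' p b) (hp : HasCartesianLifts p) : HasCartesianLifts p' := by
  intro y v w
  obtain ⟨e, h1, h2, h3⟩ := hp (y ≫ a) (v ≫ b) (by rw [reassoc_of% w, Category.assoc, h.w])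
  refine ⟨h.lift e v h2, h.hom_ext ?_ ?_, h.lift_snd _ _ _, .of_isPullback h ?_⟩
  · rw [Category.assoc, h.lift_fst, h1]
  · rw [Category.assoc, h.lift_snd, w]
  · rwa [h.lift_fst]

lemma trivial_comp {t : X' ⟶ X} (ht : IsTrivialFibration t) {p : X ⟶ S}
    (hp : HasCartesianLifts p) : HasCartesianLifts (t ≫ p) := by
  intro y v w
  obtain ⟨e, h1, h2, h3⟩ := hp (y ≫ t) v (by rw [w, Category.assoc])
  obtain ⟨e', h4, rfl⟩ := ht.exists_lift (stdSimplex.δ 0) h1.symm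
  exact ⟨e', h4, by rw [← h2, Category.assoc], h3.trivial_comp ht⟩

lemma descend {p : X ⟶ S} {p' : X' ⟶ S'} {a : X' ⟶ X} {b : S' ⟶ S} (ha : IsTrivialFibration a)
    (hb : IsTrivialFibration b) (w : a ≫ p = p' ≫ b) (hp : HasCartesianLifts p') :
    HasCartesianLifts p := by
  intro y v hv
  obtain ⟨y, rfl⟩ := ha.exists_lift' y
  obtain ⟨v', h1, h2⟩ := hb.exists_lift (stdSimplex.δ 0) (x := y ≫ p') (s := v)
    (by rw [hv, Category.assoc, Category.assoc, w])
  obtain ⟨e, h3, h4, h5⟩ := hp y v' h1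
  exact ⟨e ≫ a, by rw [reassoc_of% h3], by rw [Category.assoc, w, reassoc_of% h4, h2],
    h5.descend ha hb w⟩

lemma tgt {Y Z T : SSet.{u}} {φ : Y ⟶ Z} {r : Z ⟶ T} (hr : IsIsofibration r) (P : PathSpace φ r)
    (hφ : HasCartesianLifts φ) : HasCartesianLifts P.tgt := by
  intro y v hv
  obtain ⟨k, h1, h2, h3⟩ := hr.exists_homotopy₁ (stdSimplex.δ 0) (h := coherentIso ◁ y ≫ P.path)
    (x := v) (k := snd _ _ ≫ v ≫ r) (by rw [reassoc_of% end₁_whiskerLeft, P.end₁_path, hv])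
    (by rw [Category.assoc, P.path_comp, ← P.tgt_comp, whiskerLeft_snd_assoc,
      whiskerLeft_snd_assoc, reassoc_of% hv]) (by simp)
  obtain ⟨e, h4, h5, h6⟩ := hφ (y ≫ P.src) (end₀ _ ≫ k)
    (by rw [← reassoc_of% end₀_whiskerLeft, h1, reassoc_of% end₀_whiskerLeft, P.end₀_path,
      Category.assoc])
  obtain ⟨a, h7, h8⟩ := P.exists_lift e k h5.symm
    (by rw [h3, reassoc_of% h5, h3, lift_snd_assoc, Category.id_comp])
  refine ⟨a, P.hom_ext ?_ ?_, ?_, .tgt hr P (by rwa [h7])⟩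
  · rw [Category.assoc, h7, h4]
  · rw [whiskerLeft_comp_assoc, h8, h1]
  · rw [← P.end₁_path, ← reassoc_of% end₁_whiskerLeft, h8, h2]

end HasCartesianLifts

end

section

/-! ### Invariance of Cartesian and right fibrations under equivalence -/

namespace PathSpace

variable {X S : SSet.{u}}

lemma quasicategory_pt {Y Z T : SSet.{u}} {φ : Y ⟶ Z} {r : Z ⟶ T} (P : PathSpace φ r)
    (hr : IsIsofibration r) [Quasicategory Y] : Quasicategory P.pt :=
  (P.isTrivialFibration_src hr).isIsofibration.quasicategory

lemma ofRepl_isIsofibration_tgt [Quasicategory X] [Quasicategory S] (p : X ⟶ S) :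
    IsIsofibration (ofRepl p).tgt := by
  apply (ofRepl p).isIsofibration_tgt (isIsofibration_terminal_from S)
  rw [terminal.comp_from]
  exact isIsofibration_terminal_from X

lemma isCategoricalEquivalence_ofRepl_tgt [Quasicategory X] [Quasicategory S] {p : X ⟶ S}
    (hp : IsCategoricalEquivalence p) : IsCategoricalEquivalence (ofRepl p).tgt := by
  have := (ofRepl p).quasicategory_pt (isIsofibration_terminal_from S)
  apply ((ofRepl p).isCategoricalEquivalence_incl (isIsofibration_terminal_from S)).of_comp_left
  rwa [incl_tgt]

/-- The isofibrant replacement of a categorical equivalence is a trivial fibration. -/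
lemma isTrivialFibration_ofRepl_tgt [Quasicategory X] [Quasicategory S] {p : X ⟶ S}
    (hp : IsCategoricalEquivalence p) : IsTrivialFibration (ofRepl p).tgt := by
  have := (ofRepl p).quasicategory_pt (isIsofibration_terminal_from S)
  exact (ofRepl_isIsofibration_tgt p).isTrivialFibration (isCategoricalEquivalence_ofRepl_tgt hp)

end PathSpace

open PathSpace

/-- A commutative square of equivalences between isofibrations is resolved by trivial fibrations
and a pullback: `p` is dominated, along trivial fibrations `u` and `w`, by `t ≫ s`, where `t` is
a trivial fibration and `s` a base change of `p'`. -/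
lemma exists_trivial_zigzag {X S X' S' : SSet.{u}} [Quasicategory X] [Quasicategory S]
    [Quasicategory X'] [Quasicategory S'] {p : X ⟶ S} {p' : X' ⟶ S'} (hp : IsIsofibration p)
    (hp' : IsIsofibration p') {a : X ⟶ X'} {b : S ⟶ S'} (ha : IsCategoricalEquivalence a)
    (hb : IsCategoricalEquivalence b) (w : a ≫ p' = p ≫ b) :
    ∃ (X'' S'' W : SSet.{u}) (u : X'' ⟶ X) (v : S'' ⟶ S) (t : X'' ⟶ W) (m : W ⟶ X')
      (s : W ⟶ S'') (n : S'' ⟶ S'), IsTrivialFibration u ∧ IsTrivialFibration v ∧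
      IsTrivialFibration t ∧ IsPullback m s p' n ∧ u ≫ p = (t ≫ s) ≫ v := by
  let P := ofRepl a
  let Q := ofRepl b
  have hX' := isIsofibration_terminal_from X'
  have hS' := isIsofibration_terminal_from S'
  have : Quasicategory P.pt := P.quasicategory_pt hX'
  obtain ⟨p'', h1, h2⟩ := Q.exists_lift (P.src ≫ p) (P.path ≫ p')
    (by rw [reassoc_of% P.end₀_path, w, Category.assoc]) (Subsingleton.elim _ _)
  have h3 : P.tgt ≫ p' = p'' ≫ Q.tgt := by
    rw [← P.end₁_path, ← Q.end₁_path, Category.assoc, ← h2, reassoc_of% end₁_whiskerLeft]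
  have hW := IsPullback.of_hasPullback p' Q.tgt
  have hfst : IsTrivialFibration (pullback.fst p' Q.tgt) :=
    (isTrivialFibration_ofRepl_tgt hb).of_isPullback hW.flip
  have : Quasicategory (pullback p' Q.tgt) := hfst.isIsofibration.quasicategory
  refine ⟨P.pt, Q.pt, pullback p' Q.tgt, P.src, Q.src, hW.lift P.tgt p'' h3, _, _, _,
    P.isTrivialFibration_src hX', Q.isTrivialFibration_src hS', ?_, hW, by rw [hW.lift_snd, h1]⟩
  -- the comparison map to the pullback is an isofibration, and an equivalence by two out of three
  refine IsIsofibration.isTrivialFibration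
    (.of_isIsoAnodyne fun A B i _ hi ↦ ⟨fun {x z} sq ↦ ?_⟩) ?_
  · have e1 := sq.w =≫ pullback.fst _ _
    have e2 := sq.w =≫ pullback.snd _ _
    rw [Category.assoc, Category.assoc, hW.lift_fst] at e1
    rw [Category.assoc, Category.assoc, hW.lift_snd] at e2
    have := hi _ hp
    have sq' : CommSq (x ≫ P.src) i p (z ≫ pullback.snd _ _ ≫ Q.src) := ⟨by
      rw [Category.assoc, ← h1, reassoc_of% e2]⟩
    obtain ⟨l, g1, g2, g3, g4⟩ := hp'.exists_homotopy hi (h := coherentIso ◁ x ≫ P.path)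
      (x := sq'.lift ≫ a) (y := z ≫ pullback.fst _ _)
      (k := coherentIso ◁ (z ≫ pullback.snd _ _) ≫ Q.path)
      (by rw [reassoc_of% end₀_whiskerLeft, P.end₀_path, sq'.fac_left_assoc, Category.assoc])
      (by rw [reassoc_of% end₁_whiskerLeft, P.end₁_path, e1])
      (by rw [Category.assoc, ← h2, ← whiskerLeft_comp_assoc, ← whiskerLeft_comp_assoc, e2])
      (by rw [reassoc_of% end₀_whiskerLeft, Q.end₀_path, Category.assoc, w, sq'.fac_right_assoc]
          simp)
      (by rw [reassoc_of% end₁_whiskerLeft, Q.end₁_path, Category.assoc, Category.assoc, hW.w])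
    obtain ⟨c, g5, g6⟩ := P.exists_lift sq'.lift l g2 (Subsingleton.elim _ _)
    refine ⟨⟨⟨c, P.hom_ext ?_ ?_, hW.hom_ext ?_ (Q.hom_ext ?_ ?_)⟩⟩⟩
    · rw [Category.assoc, g5, sq'.fac_left]
    · rw [whiskerLeft_comp_assoc, g6, g1]
    · rw [Category.assoc, hW.lift_fst, ← P.end₁_path, ← reassoc_of% end₁_whiskerLeft, g6, g3]
    · rw [Category.assoc, Category.assoc, hW.lift_snd_assoc, h1, reassoc_of% g5, sq'.fac_right,
        Category.assoc]
    · rw [Category.assoc, hW.lift_snd, whiskerLeft_comp_assoc, h2, reassoc_of% g6, g4]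
  · refine hfst.isCategoricalEquivalence.of_comp_right ?_
    rw [hW.lift_fst]
    exact isCategoricalEquivalence_ofRepl_tgt ha

/-- A commutative square of equivalences induces one between the isofibrant replacements. -/
lemma exists_trivial_zigzag_repl {X S X' S' : SSet.{u}} [Quasicategory X] [Quasicategory S]
    [Quasicategory X'] [Quasicategory S'] {p : X ⟶ S} {p' : X' ⟶ S'}
    (h : EquivalentFunctors p p') :
    ∃ (X'' S'' W : SSet.{u}) (u : X'' ⟶ (ofRepl p).pt) (v : S'' ⟶ S) (t : X'' ⟶ W)
      (m : W ⟶ (ofRepl p').pt)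
      (s : W ⟶ S'') (n : S'' ⟶ S'), IsTrivialFibration u ∧ IsTrivialFibration v ∧
      IsTrivialFibration t ∧ IsPullback m s (ofRepl p').tgt n ∧
      u ≫ (ofRepl p).tgt = (t ≫ s) ≫ v := by
  obtain ⟨a, b, ha, hb, w⟩ := h
  have hS := isIsofibration_terminal_from S
  have hS' := isIsofibration_terminal_from S'
  have := (ofRepl p).quasicategory_pt hS
  have := (ofRepl p').quasicategory_pt hS'
  obtain ⟨c, h1, h2⟩ := (ofRepl p').exists_lift ((ofRepl p).src ≫ a) ((ofRepl p).path ≫ b)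
    (by rw [reassoc_of% end₀_path, ← w, Category.assoc]) (Subsingleton.elim _ _)
  refine exists_trivial_zigzag (ofRepl_isIsofibration_tgt p) (ofRepl_isIsofibration_tgt p')
    (a := c) ?_ hb ?_
  · have e : (ofRepl p).incl ≫ c = a ≫ (ofRepl p').incl := by
      apply (ofRepl p').hom_ext
      · rw [Category.assoc, h1, reassoc_of% (ofRepl p).incl_src, Category.assoc, incl_src,
          Category.comp_id]
      · rw [whiskerLeft_comp_assoc, whiskerLeft_comp_assoc, h2, incl_path, reassoc_of% incl_path,
          whiskerLeft_snd_assoc, w]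
    refine ((ofRepl p).isCategoricalEquivalence_incl hS).of_comp_left ?_
    rw [e]
    exact ha.comp ((ofRepl p').isCategoricalEquivalence_incl hS')
  · rw [← end₁_path, ← end₁_path, Category.assoc, ← h2, reassoc_of% end₁_whiskerLeft]

/-- The isofibrant replacement of a Cartesian fibration has Cartesian lifts in the strict sense,
although a Cartesian fibration need only be equivalent to some functor that has them. -/
lemma IsCartesianFibration.hasCartesianLifts {X S : SSet.{u}} [Quasicategory X] [Quasicategory S]
    {p : X ⟶ S} (hp : IsCartesianFibration p) : HasCartesianLifts (ofRepl p).tgt := by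
  obtain ⟨X', S', p', hX', hS', h, h'⟩ := hp
  obtain ⟨X'', S'', W, u, v, t, m, s, n, hu, hv, ht, hW, w⟩ := exists_trivial_zigzag_repl h'
  exact ((((isCartesianInnerFibration_iff.1 h).2.tgt (isIsofibration_terminal_from S')
    (ofRepl p')).of_isPullback hW).trivial_comp ht).descend hu hv w

/-- The isofibrant replacement of a right fibration is a strict right fibration. -/
lemma IsRightFibration.isStrictRightFibration {X S : SSet.{u}} [Quasicategory X]
    [Quasicategory S] {p : X ⟶ S} (hp : IsRightFibration p) :
    IsStrictRightFibration (ofRepl p).tgt := by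
  obtain ⟨X', S', p', hX', hS', h, h'⟩ := hp
  obtain ⟨X'', S'', W, u, v, t, m, s, n, hu, hv, ht, hW, w⟩ := exists_trivial_zigzag_repl h'
  intro k i hi
  have := h k i hi
  rw [hasLiftingProperty_iff_forall_liftsAt] at this ⊢
  intro σ
  obtain ⟨σ, rfl⟩ := hu.exists_lift' σ
  exact ((((this _).tgt (isIsofibration_terminal_from S')
    (ofRepl p')).of_isPullback hW).trivial_comp ht).descend hv w

end

section

/-! ### Attaching cells along toggle pairs -/

/-- A map out of a subcomplex extends over a cell attached along a monomorphism. -/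
lemma exists_glue {X Y Z : SSet.{u}} {A T : Y.Subcomplex} (hAT : A ≤ T) {ε : Z ⟶ Y} [Mono ε]
    (hT : ∀ d (y : Y.obj d), y ∈ T.obj d → y ∈ A.obj d ∨ ∃ z, ε.app d z = y)
    (g : (A : SSet) ⟶ X) (l : Z ⟶ X)
    (hgl : ∀ d (z : Z.obj d) (h : ε.app d z ∈ A.obj d), g.app d ⟨_, h⟩ = l.app d z) :
    ∃ g' : (T : SSet) ⟶ X, Subcomplex.homOfLE hAT ≫ g' = g ∧
      ∀ d (z : Z.obj d) (h : ε.app d z ∈ T.obj d), g'.app d ⟨_, h⟩ = l.app d z := by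
  classical
  have hinj (d) : Function.Injective (ε.app d) := (mono_iff_injective _).1 inferInstance
  choose r hr using fun d (y : Y.obj d) (h : y ∈ T.obj d) (h' : y ∉ A.obj d) ↦
    (hT d y h).resolve_left h'
  let F (d) (y : T.toSSet.obj d) : X.obj d :=
    if h : y.1 ∈ A.obj d then g.app d ⟨_, h⟩ else l.app d (r d y.1 y.2 h)
  have hF (d) (z : Z.obj d) (h : ε.app d z ∈ T.obj d) : F d ⟨_, h⟩ = l.app d z := by
    by_cases h' : ε.app d z ∈ A.obj d
    · simp only [F, dif_pos h', hgl]
    · simp only [F, dif_neg h']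
      rw [hinj d (hr d _ h h')]
  have hF' (d) (y : T.toSSet.obj d) (h : y.1 ∈ A.obj d) : F d y = g.app d ⟨_, h⟩ := dif_pos h
  refine ⟨{ app d := ↾(F d), naturality := ?_ }, ?_, fun d z h ↦ hF d z h⟩
  · intro d d' f
    ext ⟨y, hy⟩
    obtain h | ⟨z, rfl⟩ := hT d y hy
    · have e1 := hF' d ⟨y, hy⟩ h
      have e2 := hF' d' (T.toSSet.map f ⟨y, hy⟩) (A.map f h)
      refine e2.trans ?_
      refine Eq.trans ?_ (congr_arg (X.map f) e1).symm
      exact ConcreteCategory.congr_hom (g.naturality f) ⟨y, h⟩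
    · have e0 := ConcreteCategory.congr_hom (ε.naturality f) z
      have e1 := hF d z hy
      have e2 := hF d' (Z.map f z) (by
        have := T.map f hy
        exact (congr_arg (· ∈ T.obj d') e0).mpr this)
      refine Eq.trans ?_ (Eq.trans e2 ?_)
      · exact congr_arg (F d') (Subtype.ext e0.symm)
      · refine Eq.trans ?_ (congr_arg (X.map f) e1).symm
        exact ConcreteCategory.congr_hom (l.naturality f) z
  · ext d ⟨y, hy⟩
    exact hF' d ⟨y, hAT _ hy⟩ hy

/-- The subcomplex of `Δ[N]` consisting of the simplices whose vertices lie in a member of the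
family `F`. -/
def spanned (N : ℕ) (F : Set (Finset ℕ)) : (Δ[N] : SSet.{u}).Subcomplex where
  obj d := {x | ∃ s ∈ F, ∀ i, (stdSimplex.asOrderHom x i : ℕ) ∈ s}
  map f x := by
    rintro ⟨s, hs, h⟩
    exact ⟨s, hs, fun i ↦ h _⟩

lemma mem_spanned_iff {N d : ℕ} {F : Set (Finset ℕ)} {x : (Δ[N] : SSet.{u}) _⦋d⦌} :
    x ∈ (spanned N F).obj _ ↔ ∃ s ∈ F, ∀ i, (x i : ℕ) ∈ s := Iff.rfl

lemma spanned_le {N : ℕ} {F G : Set (Finset ℕ)} (h : ∀ s ∈ F, ∃ t ∈ G, s ⊆ t) :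
    spanned.{u} N F ≤ spanned N G := by
  rintro d x ⟨s, hs, hx⟩
  obtain ⟨t, ht, hst⟩ := h s hs
  exact ⟨t, ht, fun i ↦ hst (hx i)⟩

lemma spanned_mono {N : ℕ} {F G : Set (Finset ℕ)} (h : F ⊆ G) :
    spanned.{u} N F ≤ spanned N G :=
  spanned_le fun s hs ↦ ⟨s, h hs, subset_rfl⟩

/-- The map of standard simplices given by a monotone map of vertices. -/
def simplexMap {m n : ℕ} (f : Fin (m + 1) →o Fin (n + 1)) : (Δ[m] : SSet.{u}) ⟶ Δ[n] :=
  SSet.stdSimplex.map (SimplexCategory.Hom.mk f)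

@[simp]
lemma simplexMap_app_apply {m n d : ℕ} (f : Fin (m + 1) →o Fin (n + 1))
    (x : (Δ[m] : SSet.{u}) _⦋d⦌) (i : Fin (d + 1)) : (simplexMap f).app _ x i = f (x i) := rfl

lemma mono_simplexMap {m n : ℕ} {f : Fin (m + 1) →o Fin (n + 1)} (hf : StrictMono f) :
    Mono (simplexMap.{u} f) := by
  have : simplexMap.{u} f = SSet.yonedaEquiv.symm (SSet.stdSimplex.objMk f) := rfl
  rw [this]
  exact mono_of_strictMono hf

/-- All edges of the subcomplex `A` with marked endpoints are sent to `p`-Cartesian edges. -/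
def SendsMarked {X S : SSet.{u}} (p : X ⟶ S) (M : ℕ → ℕ → Prop) {N : ℕ}
    {A : (Δ[N] : SSet.{u}).Subcomplex} (g : (A : SSet) ⟶ X) : Prop :=
  ∀ (x : (Δ[N] : SSet.{u}) _⦋1⦌) (hx : x ∈ A.obj _), M (x 0) (x 1) →
    IsCartesian p (yonedaEquiv.symm (g.app _ ⟨x, hx⟩))

/-- The cell `c` can be filled against `p` from its horn opposite to `v`: either the horn is
inner, or it is the last outer horn and its last edge is marked. -/
def IsFillable {X S : SSet.{u}} (p : X ⟶ S) (M : ℕ → ℕ → Prop) (c : Finset ℕ) (v : ℕ) : Prop :=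
  (InnerFibration p ∧ ∃ a ∈ c, ∃ b ∈ c, a < v ∧ v < b) ∨
  (HasCartesianLifts p ∧ (∀ x ∈ c, x ≤ v) ∧ ∃ w ∈ c, w < v ∧ (∀ x ∈ c, x < v → x ≤ w) ∧ M w v)

/-- A nonempty finite set of vertices is the image of a face of the standard simplex. -/
lemma exists_strictMono_range {N : ℕ} {c : Finset ℕ} (hc : ∀ x ∈ c, x ≤ N) (hc' : c.Nonempty) :
    ∃ (m : ℕ) (f : Fin (m + 1) →o Fin (N + 1)), StrictMono f ∧
      ∀ x, x ∈ c ↔ ∃ i, (f i : ℕ) = x := by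
  obtain ⟨m, hm⟩ : ∃ m, c.card = m + 1 := ⟨c.card - 1, by have := hc'.card_pos; omega⟩
  have hmem (i) : c.orderEmbOfFin hm i ∈ c := c.orderEmbOfFin_mem hm i
  refine ⟨m, ⟨fun i ↦ ⟨c.orderEmbOfFin hm i, by have := hc _ (hmem i); omega⟩, ?_⟩, ?_, ?_⟩
  · intro i j hij
    exact (c.orderEmbOfFin hm).monotone hij
  · intro i j hij
    exact (c.orderEmbOfFin hm).strictMono hij
  · intro x
    have := Finset.range_orderEmbOfFin c hm
    rw [← Finset.mem_coe, ← this]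
    rfl

variable {X S : SSet.{u}} {p : X ⟶ S} {M : ℕ → ℕ → Prop} {N : ℕ}

/-- Attaching one cell: a map out of `spanned N F` extends over the cell `c`, provided that
the faces of `c` other than the one opposite to `v` already belong to the family. -/
lemma exists_extension_cell {F : Set (Finset ℕ)} {c : Finset ℕ} {v : ℕ} (hcN : ∀ x ∈ c, x ≤ N)
    (hv : v ∈ c) (hface : ∀ w ∈ c, w ≠ v → ∃ s ∈ F, c.erase w ⊆ s)
    (hfresh : ∀ s ∈ F, ¬ c.erase v ⊆ s) (hfill : IsFillable p M c v)
    (hM : ∀ a b, M a b → a < b) (hcM : ∀ a b, M a b → c.erase v ≠ {a, b})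
    (g : (spanned.{u} N F : SSet) ⟶ X) (k : (spanned.{u} N (insert c F) : SSet) ⟶ S)
    (hgk : g ≫ p = Subcomplex.homOfLE (spanned_mono (Set.subset_insert c F)) ≫ k)
    (hg : SendsMarked p M g) :
    ∃ g' : (spanned.{u} N (insert c F) : SSet) ⟶ X,
      Subcomplex.homOfLE (spanned_mono (Set.subset_insert c F)) ≫ g' = g ∧ g' ≫ p = k ∧
      SendsMarked p M g' := by
  obtain ⟨m, f, hf, hfc⟩ := exists_strictMono_range hcN ⟨v, hv⟩
  obtain ⟨j, hj⟩ := (hfc v).1 hv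
  have hfinj {a b} (h : (f a : ℕ) = f b) : a = b := hf.injective (Fin.ext h)
  have := mono_simplexMap.{u} hf
  let ε := simplexMap.{u} f
  have hmem {d : ℕ} (z : (Δ[m] : SSet.{u}) _⦋d⦌) :
      ε.app _ z ∈ (spanned N F).obj _ ↔ z ∈ (Λ[m, j]).obj _ := by
    rw [mem_horn_iff_notMem_range, mem_spanned_iff]
    constructor
    · rintro ⟨s, hs, h⟩
      by_contra! h'
      refine hfresh s hs fun x hx ↦ ?_
      rw [Finset.mem_erase] at hx
      obtain ⟨i, rfl⟩ := (hfc x).1 hx.2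
      obtain ⟨l, rfl⟩ := h' i (by rintro rfl; exact hx.1 hj)
      exact h l
    · rintro ⟨i, hi, h⟩
      obtain ⟨s, hs, h'⟩ := hface (f i) ((hfc _).2 ⟨i, rfl⟩) (fun e ↦ hi (hfinj (e.trans hj.symm)))
      refine ⟨s, hs, fun l ↦ h' (Finset.mem_erase.2 ⟨fun e ↦ h ⟨l, hfinj e⟩, (hfc _).2 ⟨_, rfl⟩⟩)⟩
  have hεT {d : ℕ} (z : (Δ[m] : SSet.{u}) _⦋d⦌) : ε.app _ z ∈ (spanned N (insert c F)).obj _ :=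
    mem_spanned_iff.2 ⟨c, Set.mem_insert _ _, fun i ↦ (hfc _).2 ⟨_, rfl⟩⟩
  have hT {d : ℕ} (y : (Δ[N] : SSet.{u}) _⦋d⦌) (hy : y ∈ (spanned N (insert c F)).obj _) :
      y ∈ (spanned N F).obj _ ∨ ∃ z, ε.app _ z = y := by
    obtain ⟨s, hs, h⟩ := mem_spanned_iff.1 hy
    obtain rfl | hs := hs
    · refine Or.inr ?_
      choose r hr using fun i ↦ (hfc _).1 (h i)
      have hr' (i) : f (r i) = y i := Fin.ext (hr i)
      refine ⟨stdSimplex.objMk ⟨r, fun a b hab ↦ hf.le_iff_le.1 ?_⟩, ?_⟩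
      · rw [hr', hr']
        exact stdSimplex.monotone_apply y hab
      · apply SSet.stdSimplex.ext
        exact hr'
    · exact Or.inl ⟨s, hs, h⟩
  let σ : (Λ[m, j] : SSet.{u}) ⟶ (spanned.{u} N F : SSet) :=
    Subcomplex.lift (Λ[m, j].ι ≫ ε) (by
      rintro ⟨d⟩ _ ⟨⟨z, hz⟩, rfl⟩
      induction d using SimplexCategory.rec with | _ d
      exact (hmem z).2 hz)
  let τ : Δ[m] ⟶ (spanned.{u} N (insert c F) : SSet) :=
    Subcomplex.lift ε (by
      rintro ⟨d⟩ _ ⟨z, rfl⟩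
      induction d using SimplexCategory.rec with | _ d
      exact hεT z)
  have hστ : (σ ≫ g) ≫ p = Λ[m, j].ι ≫ τ ≫ k := by
    rw [Category.assoc, hgk]; rfl
  -- the filler, which is moreover Cartesian when the cell is a marked edge
  obtain ⟨l, hl1, hl2, hl3⟩ : ∃ l : Δ[m] ⟶ X, Λ[m, j].ι ≫ l = σ ≫ g ∧ l ≫ p = τ ≫ k ∧
      ∀ a b, M a b → c = {a, b} → ∀ (e : (Δ[m] : SSet.{u}) _⦋1⦌),
        (f (e 0) : ℕ) = a → (f (e 1) : ℕ) = b →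
        IsCartesian p (yonedaEquiv.symm (l.app _ e)) := by
    obtain ⟨hp, a, ha, b, hb, hav, hvb⟩ | ⟨hp, hmax, w, hw, hwv, hw', hMw⟩ := hfill
    · obtain ⟨a, rfl⟩ := (hfc a).1 ha
      obtain ⟨b, rfl⟩ := (hfc b).1 hb
      have haj : a < j := hf.lt_iff_lt.1 (by rw [← hj] at hav; exact hav)
      have hjb : j < b := hf.lt_iff_lt.1 (by rw [← hj] at hvb; exact hvb)
      have := hp.mem _ (horn_ι_mem_innerHornInclusions.{u} (i := j)
        ((Fin.zero_le a).trans_lt haj) (hjb.trans_le (Fin.le_last b)))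
      have sq : CommSq (σ ≫ g) Λ[m, j].ι p (τ ≫ k) := ⟨hστ⟩
      refine ⟨sq.lift, sq.fac_left, sq.fac_right, ?_⟩
      intro a' b' hab hc
      rw [hc] at ha hb hv
      simp only [Finset.mem_insert, Finset.mem_singleton] at ha hb hv
      omega
    · obtain rfl : j = Fin.last m := by
        refine le_antisymm (Fin.le_last j) (hf.le_iff_le.1 ?_)
        have := hmax _ ((hfc _).2 ⟨Fin.last m, rfl⟩)
        rw [← hj] at this
        exact this
      obtain ⟨w, rfl⟩ := (hfc w).1 hw
      have hwl : w < Fin.last m := hf.lt_iff_lt.1 (by rw [← hj] at hwv; exact hwv)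
      obtain _ | _ | n := m
      · lia
      · have hhorn {d : ℕ} (z : (Δ[1] : SSet.{u}) _⦋d⦌) (hz : z ∈ (Λ[1, 1]).obj _) :
            ∃ z', (SSet.stdSimplex.δ (0 : Fin 2)).app _ z' = z := by
          obtain ⟨i, hi, h⟩ := (mem_horn_iff_notMem_range _ _).1 hz
          refine ⟨stdSimplex.const 0 0 _, ?_⟩
          apply SSet.stdSimplex.ext
          intro l
          change (1 : Fin 2) = z l
          have : z l ≠ i := fun e ↦ h ⟨l, e⟩
          lia
        let y₀ : Δ[0] ⟶ (Λ[1, 1] : SSet.{u}) := Subcomplex.lift (SSet.stdSimplex.δ (0 : Fin 2)) (by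
          rintro ⟨d⟩ _ ⟨z, rfl⟩
          induction d using SimplexCategory.rec with | _ d
          refine (mem_horn_iff_notMem_range _ _).2 ⟨0, Fin.zero_ne_one, ?_⟩
          rintro ⟨i, hi⟩
          exact Fin.succAbove_ne (0 : Fin 2) (z i) hi)
        obtain ⟨l, h1, h2, h3⟩ := hp (y₀ ≫ σ ≫ g) (τ ≫ k) (by
          rw [Category.assoc, hστ]; rfl)
        refine ⟨l, ?_, h2, ?_⟩
        · ext ⟨d⟩ ⟨z, hz⟩
          induction d using SimplexCategory.rec with | _ d
          obtain ⟨z, rfl⟩ := hhorn z hz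
          exact ConcreteCategory.congr_hom (NatTrans.congr_app h1 _) z
        · intro a b hab hc e hea heb
          have : e = yonedaEquiv (𝟙 Δ[1]) := by
            have hlt : e 0 < e 1 := hf.lt_iff_lt.1 (by
              have := hM a b hab
              rw [← hea, ← heb] at this
              exact this)
            apply SSet.stdSimplex.ext
            intro i
            change e i = i
            fin_cases i
            · change e 0 = 0; lia
            · change e 1 = 1; lia
          rw [this]
          exact (Equiv.symm_apply_apply _ l).symm ▸ h3
      · have hlw : w = (Fin.last (n + 1)).castSucc := by
          refine le_antisymm (Fin.le_castSucc_iff.2 hwl) (hf.le_iff_le.1 ?_)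
          refine hw' _ ((hfc _).2 ⟨_, rfl⟩) ?_
          rw [← hj]
          exact hf (Fin.castSucc_lt_last _)
        have hle : (lastEdge n).1 ∈ (Λ[n + 2, Fin.last (n + 2)]).obj _ := (lastEdge n).2
        obtain ⟨l, h1, h2⟩ := hg (ε.app _ (lastEdge n).1) ((hmem _).2 hle)
          (by rw [hlw, ← hj] at hMw; exact hMw) n (σ ≫ g) (by
            rw [lastEdgeι, yonedaEquiv_symm_comp]; rfl) (τ ≫ k) hστ
        refine ⟨l, h1, h2, fun a b _ hc ↦ ?_⟩
        have h3 : c.card ≤ 2 := by rw [hc]; exact Finset.card_le_two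
        have h4 : (Finset.univ.image fun i ↦ (f i : ℕ)).card = n + 1 + 1 + 1 := by
          rw [Finset.card_image_of_injective _ fun a b h ↦ hfinj h, Finset.card_fin]
        have h5 : (Finset.univ.image fun i ↦ (f i : ℕ)) = c := by
          ext x
          simp [hfc]
        rw [h5] at h4
        omega
  obtain ⟨g', hg', hl'⟩ := exists_glue (spanned_mono (Set.subset_insert c F)) (ε := ε) (by
      rintro ⟨d⟩ y hy
      induction d using SimplexCategory.rec with | _ d
      exact hT y hy) g l (by
      rintro ⟨d⟩ z hz
      induction d using SimplexCategory.rec with | _ d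
      exact (ConcreteCategory.congr_hom (NatTrans.congr_app hl1 _) ⟨z, (hmem z).1 hz⟩).symm)
  refine ⟨g', hg', ?_, ?_⟩
  · ext ⟨d⟩ ⟨y, hy⟩
    induction d using SimplexCategory.rec with | _ d
    obtain h | ⟨z, rfl⟩ := hT y hy
    · have e1 := ConcreteCategory.congr_hom (NatTrans.congr_app hgk _) ⟨y, h⟩
      rw [← hg'] at e1
      exact e1
    · exact (congr_arg (p.app _) (hl' _ z hy)).trans
        (ConcreteCategory.congr_hom (NatTrans.congr_app hl2 _) z)
  · intro x hx hMx
    by_cases h : x ∈ (spanned N F).obj _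
    · have := hg x h hMx
      rw [← hg'] at this
      exact this
    · obtain ⟨z, rfl⟩ := (hT x hx).resolve_left h
      rw [hl' _ z hx]
      refine hl3 _ _ hMx ?_ z rfl rfl
      have h1 : c.erase v ⊆ {(f (z 0) : ℕ), (f (z 1) : ℕ)} := by
        intro y hy
        rw [Finset.mem_erase] at hy
        obtain ⟨i, rfl⟩ := (hfc y).1 hy.2
        rw [hmem, mem_horn_iff_notMem_range] at h
        push Not at h
        obtain ⟨l, rfl⟩ := h i (by rintro rfl; exact hy.1 hj)
        fin_cases l <;> simp
      have h2 : ({(f (z 0) : ℕ), (f (z 1) : ℕ)} : Finset ℕ) ⊆ c := by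
        intro y hy
        simp only [Finset.mem_insert, Finset.mem_singleton] at hy
        obtain rfl | rfl := hy <;> exact (hfc _).2 ⟨_, rfl⟩
      by_cases h3 : v ∈ ({(f (z 0) : ℕ), (f (z 1) : ℕ)} : Finset ℕ)
      · refine subset_antisymm (fun y hy ↦ ?_) h2
        by_cases hyv : y = v
        · rwa [hyv]
        · exact h1 (Finset.mem_erase.2 ⟨hyv, hy⟩)
      · exact absurd (subset_antisymm h1 (Finset.subset_erase.2 ⟨h2, h3⟩)) (hcM _ _ hMx)

/-- The combinatorics of an extension along toggle pairs. The simplices of `B` which are not in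
`A` are paired by adding or removing the vertex `t s`; the pairs are attached by increasing rank
`r`, and then by increasing dimension. -/
structure TogglePairing (A B : Set (Finset ℕ)) (N : ℕ) (t r : Finset ℕ → ℕ) : Prop where
  subset : A ⊆ B
  isLowerSet : IsLowerSet A
  isLowerSet' : IsLowerSet B
  le_of_mem : ∀ s ∈ B, ∀ x ∈ s, x ≤ N
  insert_mem : ∀ s ∈ B, s ∉ A → insert (t s) s ∈ B
  erase_notMem : ∀ s ∈ B, s ∉ A → s.erase (t s) ∉ A
  rank_toggle : ∀ s ∈ B, s ∉ A → r (insert (t s) s) ≤ r (s.erase (t s))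
  rank_mono : ∀ s ∈ B, ∀ e ⊆ s, e ∉ A → r e ≤ r s
  toggle_eq : ∀ s ∈ B, ∀ e ⊆ s, e ∉ A → r e = r s → t e = t s

namespace TogglePairing

variable {A B : Set (Finset ℕ)} {t r : Finset ℕ → ℕ}

lemma toggle_insert (h : TogglePairing A B N t r) {s : Finset ℕ} (hs : s ∈ B) (hs' : s ∉ A) :
    r (insert (t s) s) = r s ∧ t (insert (t s) s) = t s := by
  have h1 := h.insert_mem s hs hs'
  have h2 := h.rank_mono _ h1 s (Finset.subset_insert _ _) hs'
  have h3 := h.rank_toggle s hs hs'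
  have h4 := h.rank_mono _ hs _ (Finset.erase_subset _ _) (h.erase_notMem s hs hs')
  have h5 : r (insert (t s) s) = r s := by omega
  exact ⟨h5, (h.toggle_eq _ h1 s (Finset.subset_insert _ _) hs' h5.symm).symm⟩

lemma toggle_erase (h : TogglePairing A B N t r) {s : Finset ℕ} (hs : s ∈ B) (hs' : s ∉ A) :
    r (s.erase (t s)) = r s ∧ t (s.erase (t s)) = t s := by
  have h4 := h.rank_mono _ hs _ (Finset.erase_subset _ _) (h.erase_notMem s hs hs')
  have h5 : r (s.erase (t s)) = r s := by
    have h3 := h.rank_toggle s hs hs'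
    have := (h.toggle_insert hs hs').1
    omega
  exact ⟨h5, h.toggle_eq _ hs _ (Finset.erase_subset _ _) (h.erase_notMem s hs hs') h5⟩

/-- Extension along toggle pairs. -/
theorem exists_extension (h : TogglePairing A B N t r)
    (hfill : ∀ s ∈ B, s ∉ A → t s ∈ s → IsFillable p M s (t s))
    (hM : ∀ a b, M a b → a < b) (hBM : ∀ a b, M a b → {a, b} ∈ B → {a, b} ∉ A → t {a, b} ∈
      ({a, b} : Finset ℕ))
    (g : (spanned.{u} N A : SSet) ⟶ X) (k : (spanned.{u} N B : SSet) ⟶ S)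
    (hgk : g ≫ p = Subcomplex.homOfLE (spanned_mono h.subset) ≫ k)
    (hg : SendsMarked p M g) :
    ∃ g' : (spanned.{u} N B : SSet) ⟶ X,
      Subcomplex.homOfLE (spanned_mono h.subset) ≫ g' = g ∧ g' ≫ p = k ∧ SendsMarked p M g' := by
  classical
  -- the larger member of each pair, ordered by rank and then by dimension
  let ρ (s : Finset ℕ) : ℕ ×ₗ ℕ := toLex (r s, s.card)
  let isBig (s : Finset ℕ) : Prop := s ∈ B ∧ s ∉ A ∧ t s ∈ s
  let U₀ : Finset (Finset ℕ) := (Finset.range (N + 1)).powerset.filter isBig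
  have hU₀ (s) : s ∈ U₀ ↔ isBig s := by
    simp only [U₀, Finset.mem_filter, Finset.mem_powerset, and_iff_right_iff_imp]
    intro hs x hx
    simpa [Nat.lt_succ_iff] using h.le_of_mem s hs.1 x hx
  have big_insert {s} (hs : s ∈ B) (hs' : s ∉ A) : isBig (insert (t s) s) := by
    refine ⟨h.insert_mem s hs hs', fun h' ↦ hs' (h.isLowerSet (Finset.subset_insert _ _) h'), ?_⟩
    rw [(h.toggle_insert hs hs').2]
    exact Finset.mem_insert_self _ _
  have key (U : Finset (Finset ℕ)) : (∀ s ∈ U, isBig s) →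
      (∀ s ∈ U, ∀ s', isBig s' → ρ s' < ρ s → s' ∈ U) → ∀ hUB : A ∪ U ⊆ B,
      ∃ g' : (spanned.{u} N (A ∪ U) : SSet) ⟶ X,
        Subcomplex.homOfLE (spanned_mono Set.subset_union_left) ≫ g' = g ∧
        g' ≫ p = Subcomplex.homOfLE (spanned_mono hUB) ≫ k ∧ SendsMarked p M g' := by
    induction U using Finset.induction_on_max_value ρ with
    | empty =>
      intro _ _ hUB
      have h1 : spanned.{u} N (A ∪ (∅ : Finset (Finset ℕ))) ≤ spanned N A :=
        spanned_mono (by simp)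
      refine ⟨Subcomplex.homOfLE h1 ≫ g, rfl, ?_, fun x hx hMx ↦ hg x (h1 _ hx) hMx⟩
      rw [Category.assoc, hgk]; rfl
    | insert c U hcU hmax ih =>
      intro hbig hinit hUB
      have hUB' : A ∪ U ⊆ B :=
        (Set.union_subset_union_right _ (by simp)).trans hUB
      obtain ⟨g₁, h1, h2, h3⟩ := ih (fun s hs ↦ hbig s (Finset.mem_insert_of_mem hs))
        (fun s hs s' hs' hlt ↦ (Finset.mem_insert.1 (hinit s (Finset.mem_insert_of_mem hs) s' hs'
          hlt)).resolve_left (by rintro rfl; exact (hmax s hs).not_gt hlt)) hUB'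
      obtain ⟨hcB, hcA, htc⟩ := hbig c (Finset.mem_insert_self _ _)
      have hle : spanned.{u} N (insert c (A ∪ U)) ≤ spanned N B :=
        spanned_mono (Set.insert_subset hcB hUB')
      obtain ⟨he1, he2⟩ := h.toggle_erase hcB hcA
      obtain ⟨g₂, h4, h5, h6⟩ := exists_extension_cell (h.le_of_mem c hcB) htc
        -- every face other than the paired one already belongs to the union
        (by
          intro w hw hwt
          by_cases hA : c.erase w ∈ A
          · exact ⟨_, Or.inl hA, subset_rfl⟩
          · have hB : c.erase w ∈ B := h.isLowerSet' (Finset.erase_subset _ _) hcB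
            have hr := h.rank_mono c hcB _ (Finset.erase_subset w _) hA
            have hlt : ρ (insert (t (c.erase w)) (c.erase w)) < ρ c := by
              rw [Prod.Lex.toLex_lt_toLex, (h.toggle_insert hB hA).1]
              obtain hr | hr := hr.lt_or_eq
              · exact Or.inl hr
              · refine Or.inr ⟨hr, ?_⟩
                rw [h.toggle_eq c hcB _ (Finset.erase_subset w _) hA hr,
                  Finset.insert_eq_of_mem (Finset.mem_erase.2 ⟨hwt.symm, htc⟩)]
                exact Finset.card_erase_lt_of_mem hw
            have := hinit c (Finset.mem_insert_self _ _) _ (big_insert hB hA) hlt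
            refine ⟨_, Or.inr ((Finset.mem_insert.1 this).resolve_left ?_),
              Finset.subset_insert _ _⟩
            intro e
            rw [e] at hlt
            exact lt_irrefl _ hlt)
        -- the paired face does not yet belong to the union
        (by
          have hA := h.erase_notMem c hcB hcA
          rintro d (hd | hd) hcd
          · exact hA (h.isLowerSet hcd hd)
          · obtain ⟨hdB, hdA, htd⟩ := hbig d (Finset.mem_insert_of_mem hd)
            have h7 := h.rank_mono d hdB _ hcd hA
            have h8 := hmax d hd
            rw [Prod.Lex.toLex_le_toLex] at h8
            have h9 : r c = r d := by dsimp at h8; omega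
            have h10 := h.toggle_eq d hdB _ hcd hA (by omega)
            have h11 : c ⊆ d := by
              rw [← Finset.insert_erase htc]
              refine Finset.insert_subset ?_ hcd
              rwa [← he2, h10]
            have := Finset.eq_of_subset_of_card_le h11 (by dsimp at h8; omega)
            exact hcU (this ▸ hd))
        (hfill c hcB hcA htc) hM
        (by
          intro a b hab e
          have h7 := hBM a b hab (e ▸ h.isLowerSet' (Finset.erase_subset _ _) hcB)
            (e ▸ h.erase_notMem c hcB hcA)
          rw [← e, he2] at h7
          exact Finset.notMem_erase _ _ h7) g₁ (Subcomplex.homOfLE hle ≫ k) h2 h3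
      have hle' : spanned.{u} N (A ∪ (insert c U : Finset _)) ≤ spanned N (insert c (A ∪ U)) :=
        spanned_mono (by rw [Finset.coe_insert, Set.union_insert])
      refine ⟨Subcomplex.homOfLE hle' ≫ g₂, ?_, ?_, fun x hx hMx ↦ h6 x (hle' _ hx) hMx⟩
      · rw [← h1, ← h4]; rfl
      · rw [Category.assoc, h5]; rfl
  obtain ⟨g', h1, h2, h3⟩ := key U₀ (fun s hs ↦ (hU₀ s).1 hs) (fun s _ s' hs' _ ↦ (hU₀ s').2 hs')
    (Set.union_subset h.subset fun s hs ↦ ((hU₀ s).1 hs).1)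
  have hle : spanned.{u} N B ≤ spanned N (A ∪ U₀) := by
    apply spanned_le
    intro s hs
    by_cases hs' : s ∈ A
    · exact ⟨s, Or.inl hs', subset_rfl⟩
    · exact ⟨_, Or.inr ((hU₀ _).2 (big_insert hs hs')), Finset.subset_insert _ _⟩
  exact ⟨Subcomplex.homOfLE hle ≫ g', h1, by rw [Category.assoc, h2]; rfl,
    fun x hx hMx ↦ h3 x (hle _ hx) hMx⟩

end TogglePairing

end

section

/-! ### The combinatorics of the comparison prism -/

/-- The chains of the poset with elements `0`, `i'`, `i`, `x`, `n`, where `i'` (for `1 ≤ i ≤ n`)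
is encoded as `i`, `i` (for `1 ≤ i < n`) as `n + i`, `x` as `2 * n` and `n` as `2 * n + 1`; the
order is the one of the codes, except that `i' ≤ j` only for `i ≤ j`. -/
def prismChains (n : ℕ) : Set (Finset ℕ) :=
  {s | (∀ x ∈ s, x ≤ 2 * n + 1) ∧
    ∀ a ∈ s, ∀ b ∈ s, 1 ≤ a → a ≤ n → n < b → b < 2 * n → n + a ≤ b}

/-- The image of `s` under the projection `i', i ↦ i`, `x, n ↦ n` avoids some `j < n`. -/
def Misses (n : ℕ) (s : Finset ℕ) : Prop :=
  0 ∉ s ∨ ∃ j, 1 ≤ j ∧ j < n ∧ j ∉ s ∧ n + j ∉ s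

/-- The vertices `i'` of a chain. -/
def primes (n : ℕ) (s : Finset ℕ) : Finset ℕ := s.filter fun x ↦ 1 ≤ x ∧ x ≤ n

/-- The partner of the last vertex `i'`, or the last vertex of all if there is no `i'`. -/
def primeToggle (n : ℕ) (s : Finset ℕ) : ℕ :=
  if h : (primes n s).Nonempty then n + (primes n s).max' h else 2 * n + 1

/-- The edges `i' ⟶ i`, `n' ⟶ x` and `x ⟶ n`. -/
def PrismMarked (n a b : ℕ) : Prop :=
  (1 ≤ a ∧ a ≤ n ∧ b = n + a) ∨ (a = 2 * n ∧ b = 2 * n + 1)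

/-- The vertices `i` (for `1 ≤ i`) of a chain, including the last one but not `x`. -/
def unprimed (n : ℕ) (s : Finset ℕ) : Finset ℕ := s.filter fun x ↦ n < x ∧ x ≠ 2 * n

/-- The partner `i'` of the first vertex `i`; if this is the last vertex, its partner is `x`, and
if there is none the partner of `x` is `n'`. -/
def unprimedToggle (n : ℕ) (s : Finset ℕ) : ℕ :=
  if h : (unprimed n s).Nonempty then
    if (unprimed n s).min' h = 2 * n + 1 then 2 * n else (unprimed n s).min' h - n
  else n

variable {n : ℕ} {s e : Finset ℕ}

lemma isLowerSet_prismChains : IsLowerSet (prismChains n) :=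
  fun _ _ hts hs ↦ ⟨fun x hx ↦ hs.1 x (hts hx), fun a ha b hb ↦ hs.2 a (hts ha) b (hts hb)⟩

lemma Misses.mono (h : Misses n s) (hes : e ⊆ s) : Misses n e := by
  obtain h | ⟨j, h1, h2, h3, h4⟩ := h
  · exact Or.inl fun h' ↦ h (hes h')
  · exact Or.inr ⟨j, h1, h2, fun h' ↦ h3 (hes h'), fun h' ↦ h4 (hes h')⟩

lemma not_misses_iff : ¬ Misses n s ↔ 0 ∈ s ∧ ∀ j, 1 ≤ j → j < n → j ∈ s ∨ n + j ∈ s := by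
  unfold Misses
  grind

lemma Misses.insert {x : ℕ} (h : Misses n s) (hx : x ≠ 0)
    (hx' : ∀ j, 1 ≤ j → j < n → x = j ∨ x = n + j → j ∈ s ∨ n + j ∈ s) :
    Misses n (insert x s) := by
  obtain h | ⟨j, h1, h2, h3, h4⟩ := h
  · exact Or.inl fun h' ↦ (Finset.mem_insert.1 h').elim (fun e ↦ hx e.symm) h
  · refine Or.inr ⟨j, h1, h2, fun h' ↦ ?_, fun h' ↦ ?_⟩
    · obtain rfl | h' := Finset.mem_insert.1 h'
      · exact (hx' j h1 h2 (Or.inl rfl)).elim h3 h4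
      · exact h3 h'
    · obtain rfl | h' := Finset.mem_insert.1 h'
      · exact (hx' j h1 h2 (Or.inr rfl)).elim h3 h4
      · exact h4 h'

lemma Misses.of_erase {x : ℕ} (h : Misses n (s.erase x)) (hx : x ≠ 0)
    (hx' : ∀ j, 1 ≤ j → j < n → x = j ∨ x = n + j → j ∈ s.erase x ∨ n + j ∈ s.erase x) :
    Misses n s :=
  (h.insert hx hx').mono fun y hy ↦ by
    by_cases hyx : y = x
    · simp [hyx]
    · exact Finset.mem_insert_of_mem (Finset.mem_erase.2 ⟨hyx, hy⟩)

lemma mem_primes {x : ℕ} : x ∈ primes n s ↔ x ∈ s ∧ 1 ≤ x ∧ x ≤ n := Finset.mem_filter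

lemma mem_unprimed {x : ℕ} : x ∈ unprimed n s ↔ x ∈ s ∧ n < x ∧ x ≠ 2 * n := Finset.mem_filter

lemma primeToggle_cases (n : ℕ) (s : Finset ℕ) :
    (∃ i ∈ s, 1 ≤ i ∧ i ≤ n ∧ (∀ x ∈ s, x ≤ n → x ≤ i) ∧ primeToggle n s = n + i) ∨
    ((∀ x ∈ s, x = 0 ∨ n < x) ∧ primeToggle n s = 2 * n + 1) := by
  unfold primeToggle
  split_ifs with h
  · have := mem_primes.1 ((primes n s).max'_mem h)
    refine Or.inl ⟨_, this.1, this.2.1, this.2.2, fun x hx hxn ↦ ?_, rfl⟩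
    by_cases hx0 : x = 0
    · omega
    · exact Finset.le_max' _ _ (mem_primes.2 ⟨hx, by omega, hxn⟩)
  · refine Or.inr ⟨fun x hx ↦ ?_, rfl⟩
    by_contra!
    exact h ⟨x, mem_primes.2 ⟨hx, by omega, by omega⟩⟩

lemma primeToggle_congr (h : primes n e = primes n s) : primeToggle n e = primeToggle n s := by
  unfold primeToggle
  simp only [h]

lemma unprimedToggle_congr (h : unprimed n e = unprimed n s) :
    unprimedToggle n e = unprimedToggle n s := by
  unfold unprimedToggle
  simp only [h]

lemma unprimedToggle_cases (n : ℕ) (s : Finset ℕ) :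
    (∃ m ∈ s, n < m ∧ m ≠ 2 * n ∧ m ≠ 2 * n + 1 ∧ (∀ x ∈ s, n < x → x ≠ 2 * n → m ≤ x) ∧
      unprimedToggle n s = m - n) ∨
    (2 * n + 1 ∈ s ∧ (∀ x ∈ s, n < x → x ≠ 2 * n → 2 * n < x) ∧ unprimedToggle n s = 2 * n) ∨
    ((∀ x ∈ s, n < x → x = 2 * n) ∧ unprimedToggle n s = n) := by
  unfold unprimedToggle
  split_ifs with h h'
  · have := mem_unprimed.1 ((unprimed n s).min'_mem h)
    refine Or.inr (Or.inl ⟨h' ▸ this.1, fun x hx h1 h2 ↦ ?_, rfl⟩)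
    have := Finset.min'_le _ _ (mem_unprimed.2 ⟨hx, h1, h2⟩)
    omega
  · have := mem_unprimed.1 ((unprimed n s).min'_mem h)
    exact Or.inl ⟨_, this.1, this.2.1, this.2.2, h', fun x hx h1 h2 ↦
      Finset.min'_le _ _ (mem_unprimed.2 ⟨hx, h1, h2⟩), rfl⟩
  · refine Or.inr (Or.inr ⟨fun x hx h1 ↦ ?_, rfl⟩)
    by_contra! h2
    exact h ⟨x, mem_unprimed.2 ⟨hx, h1, h2⟩⟩

section

variable {A B : Set (Finset ℕ)}

/-- The pairing given by `primeToggle`. -/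
lemma togglePairing_primeToggle (hAB : A ⊆ B) (hA : IsLowerSet A) (hB : IsLowerSet B)
    (hchain : B ⊆ prismChains n)
    (h₁ : ∀ s ∈ B, s ∉ A → ∀ i ∈ s, 1 ≤ i → i ≤ n → (∀ x ∈ s, x ≤ n → x ≤ i) →
      insert (n + i) s ∈ B ∧ s.erase (n + i) ∉ A)
    (h₂ : ∀ s ∈ B, s ∉ A → (∀ x ∈ s, x = 0 ∨ n < x) →
      insert (2 * n + 1) s ∈ B ∧ s.erase (2 * n + 1) ∉ A) :
    TogglePairing A B (2 * n + 1) (primeToggle n) (fun s ↦ (primes n s).card) where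
  subset := hAB
  isLowerSet := hA
  isLowerSet' := hB
  le_of_mem s hs := (hchain hs).1
  insert_mem s hs hs' := by
    obtain ⟨i, hi, h1, h2, h3, h⟩ | ⟨h1, h⟩ := primeToggle_cases n s
    · rw [h]; exact (h₁ s hs hs' i hi h1 h2 h3).1
    · rw [h]; exact (h₂ s hs hs' h1).1
  erase_notMem s hs hs' := by
    obtain ⟨i, hi, h1, h2, h3, h⟩ | ⟨h1, h⟩ := primeToggle_cases n s
    · rw [h]; exact (h₁ s hs hs' i hi h1 h2 h3).2
    · rw [h]; exact (h₂ s hs hs' h1).2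
  rank_toggle s hs hs' := by
    apply Finset.card_le_card
    have : n < primeToggle n s := by
      obtain ⟨i, hi, h1, h2, h3, h⟩ | ⟨h1, h⟩ := primeToggle_cases n s <;> omega
    intro x hx
    rw [mem_primes, Finset.mem_insert] at hx
    rw [mem_primes, Finset.mem_erase]
    obtain ⟨rfl | hx, h1, h2⟩ := hx
    · omega
    · exact ⟨⟨by omega, hx⟩, h1, h2⟩
  rank_mono s _ e hes _ := Finset.card_le_card (Finset.filter_subset_filter _ hes)
  toggle_eq s _ e hes _ h :=
    primeToggle_congr (Finset.eq_of_subset_of_card_le (Finset.filter_subset_filter _ hes) h.ge)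

/-- The larger member of a pair given by `primeToggle` can be filled from the horn opposite to the
toggled vertex: the horn is inner, or its last edge is marked. -/
lemma isFillable_primeToggle {X S : SSet.{u}} {p : X ⟶ S} (hp : InnerFibration p)
    (hp' : HasCartesianLifts p) (hs : s ∈ prismChains n)
    (hs' : (∀ x ∈ s, x = 0 ∨ n < x) → 2 * n ∈ s) :
    IsFillable p (PrismMarked n) s (primeToggle n s) := by
  obtain ⟨i, hi, h1, h2, h3, h⟩ | ⟨h1, h⟩ := primeToggle_cases n s
  · rw [h]
    by_cases hmax : ∀ x ∈ s, x ≤ n + i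
    · refine Or.inr ⟨hp', hmax, i, hi, by omega, fun x hx hxi ↦ ?_, Or.inl ⟨h1, h2, rfl⟩⟩
      by_contra! h4
      have h5 := h3 x hx
      have h6 := hs.2 i hi x hx h1 h2
      omega
    · push Not at hmax
      obtain ⟨b, hb, hib⟩ := hmax
      exact Or.inl ⟨hp, i, hi, b, hb, by omega, hib⟩
  · rw [h]
    exact Or.inr ⟨hp', hs.1, 2 * n, hs' h1, by omega, fun x _ hx ↦ by omega, Or.inr ⟨rfl, rfl⟩⟩

/-- A marked edge other than `x ⟶ n` is the larger member of its pair, so that it is added as a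
Cartesian lift and not as the free face of a larger cell. -/
lemma primeToggle_mem_of_prismMarked {a b : ℕ} (h : PrismMarked n a b) (hn : 1 ≤ n)
    (hab : ({a, b} : Finset ℕ) ≠ {2 * n, 2 * n + 1}) :
    primeToggle n {a, b} ∈ ({a, b} : Finset ℕ) := by
  obtain ⟨h1, h2, rfl⟩ | ⟨rfl, rfl⟩ := h
  · obtain ⟨i, hi, h4, h5, h6, h⟩ | ⟨h4, h⟩ := primeToggle_cases n {a, n + a}
    · rw [h]
      simp only [Finset.mem_insert, Finset.mem_singleton] at hi ⊢
      omega
    · have := h4 a (by simp)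
      omega
  · exact absurd rfl hab

end

/-- The horn together with a triangle over its last edge. -/
def prismStart (n : ℕ) : Set (Finset ℕ) :=
  {s | s ∈ prismChains n ∧ (∀ x ∈ s, x = 0 ∨ n < x) ∧ Misses n s ∧
    (2 * n ∉ s ∨ ∀ x ∈ s, 2 * n - 1 ≤ x)}

/-- The chains whose projection is contained in the last horn. -/
def prismHorn (n : ℕ) : Set (Finset ℕ) := {s | s ∈ prismChains n ∧ Misses n s}

/-- The chains whose projection is contained in the last horn, and those of the original
simplex. -/
def prismHornTop (n : ℕ) : Set (Finset ℕ) :=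
  {s | s ∈ prismChains n ∧ (Misses n s ∨ ((∀ x ∈ s, x = 0 ∨ n < x) ∧ 2 * n ∉ s))}

/-- The chains whose projection is contained in the last horn, and those of the simplex with
vertices `0` and `i'`. -/
def prismHornBot (n : ℕ) : Set (Finset ℕ) :=
  {s | s ∈ prismChains n ∧ (Misses n s ∨ ∀ x ∈ s, x ≤ n)}

lemma insert_mem_prismChains (hs : s ∈ prismChains n) {i : ℕ} (h1 : 1 ≤ i)
    (h2 : i ≤ n) (h3 : ∀ x ∈ s, x ≤ n → x ≤ i) : insert (n + i) s ∈ prismChains n := by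
  obtain ⟨ha, hb⟩ := hs
  refine ⟨fun x hx ↦ ?_, fun a ha b hb ↦ ?_⟩ <;> grind

lemma insert_last_mem_prismChains (hs : s ∈ prismChains n) :
    insert (2 * n + 1) s ∈ prismChains n := by
  obtain ⟨ha, hb⟩ := hs
  refine ⟨fun x hx ↦ ?_, fun a ha b hb ↦ ?_⟩ <;> grind

/-- The part of the prism over the horn is obtained from the horn and the triangle by filling
cells. -/
lemma togglePairing_prismStart (hn : 2 ≤ n) :
    TogglePairing (prismStart n) (prismHorn n) (2 * n + 1) (primeToggle n)
      (fun s ↦ (primes n s).card) := by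
  apply togglePairing_primeToggle
  · exact fun s hs ↦ ⟨hs.1, hs.2.2.1⟩
  · rintro s e hes ⟨h1, h2, h3, h4⟩
    exact ⟨isLowerSet_prismChains hes h1, fun x hx ↦ h2 x (hes hx), h3.mono hes,
      h4.imp (fun h h' ↦ h (hes h')) fun h x hx ↦ h x (hes hx)⟩
  · exact fun s e hes ⟨h1, h2⟩ ↦ ⟨isLowerSet_prismChains hes h1, h2.mono hes⟩
  · exact fun s hs ↦ hs.1
  · rintro s ⟨h1, h2⟩ hs' i hi h3 h4 h5
    refine ⟨⟨insert_mem_prismChains h1 h3 h4 h5, ?_⟩, fun h ↦ ?_⟩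
    · exact h2.insert (by omega) fun j _ _ e ↦ Or.inl ((by omega : i = j) ▸ hi)
    · have := h.2.1 i (Finset.mem_erase.2 ⟨by omega, hi⟩)
      omega
  · rintro s ⟨h1, h2⟩ hs' h3
    refine ⟨⟨insert_last_mem_prismChains h1, ?_⟩, fun h ↦ hs' ⟨h1, h3, h2, ?_⟩⟩
    · exact h2.insert (by omega) fun j _ _ e ↦ by omega
    · have := h.2.2.2
      grind

/-- The whole prism is obtained from the part over the horn and the original simplex by filling
cells. -/
lemma togglePairing_prismHornTop (hn : 2 ≤ n) :
    TogglePairing (prismHornTop n) (prismChains n) (2 * n + 1) (primeToggle n)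
      (fun s ↦ (primes n s).card) := by
  apply togglePairing_primeToggle
  · exact fun s hs ↦ hs.1
  · rintro s e hes ⟨h1, h2⟩
    exact ⟨isLowerSet_prismChains hes h1, h2.imp (·.mono hes)
      fun h ↦ ⟨fun x hx ↦ h.1 x (hes hx), fun h' ↦ h.2 (hes h')⟩⟩
  · exact isLowerSet_prismChains
  · exact subset_rfl
  · rintro s h1 hs' i hi h3 h4 h5
    refine ⟨insert_mem_prismChains h1 h3 h4 h5, fun h ↦ ?_⟩
    obtain h | h := h.2
    · exact hs' ⟨h1, Or.inl (h.of_erase (by omega) fun j _ _ e ↦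
        Or.inl (Finset.mem_erase.2 ⟨by omega, (by omega : i = j) ▸ hi⟩))⟩
    · have := h.1 i (Finset.mem_erase.2 ⟨by omega, hi⟩)
      omega
  · rintro s h1 hs' h3
    refine ⟨insert_last_mem_prismChains h1, fun h ↦ hs' ⟨h1, h.2.imp (fun h ↦ ?_) fun h ↦ ?_⟩⟩
    · exact h.of_erase (by omega) fun j _ _ e ↦ by omega
    · grind

/-- The whole prism is obtained from the part over the horn and the simplex with vertices `0` and
`i'`; this pairing uses inner horns only. -/
lemma togglePairing_prismHornBot (hn : 2 ≤ n) :
    TogglePairing (prismHornBot n) (prismChains n) (2 * n + 1) (unprimedToggle n)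
      (fun s ↦ (unprimed n s).card) where
  subset := fun s hs ↦ hs.1
  isLowerSet := by
    rintro s e hes ⟨h1, h2⟩
    exact ⟨isLowerSet_prismChains hes h1, h2.imp (·.mono hes) fun h x hx ↦ h x (hes hx)⟩
  isLowerSet' := isLowerSet_prismChains
  le_of_mem s hs := hs.1
  insert_mem s hs hs' := by
    obtain ⟨m, hm, h1, h2, h3, h4, h⟩ | ⟨h1, h2, h⟩ | ⟨h1, h⟩ := unprimedToggle_cases n s
    all_goals
      rw [h]
      obtain ⟨ha, hb⟩ := hs
      refine ⟨fun x hx ↦ ?_, fun a ha b hb ↦ ?_⟩ <;> grind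
  erase_notMem s hs hs' h' := by
    refine hs' ⟨hs, ?_⟩
    have h5 := h'.2
    have := hs.1
    obtain ⟨m, hm, h1, h2, h3, h4, h⟩ | ⟨h1, h2, h⟩ | ⟨h1, h⟩ := unprimedToggle_cases n s
    · rw [h] at h5
      have := this m hm
      obtain h5 | h5 := h5
      · refine Or.inl (h5.of_erase (by omega) fun j _ _ e ↦ Or.inr (Finset.mem_erase.2
          ⟨by omega, ?_⟩))
        exact (by omega : m = n + j) ▸ hm
      · have := h5 m (Finset.mem_erase.2 ⟨by omega, hm⟩)
        omega
    · rw [h] at h5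
      obtain h5 | h5 := h5
      · exact Or.inl (h5.of_erase (by omega) fun j _ _ e ↦ by omega)
      · have := h5 _ (Finset.mem_erase.2 ⟨by omega, h1⟩)
        omega
    · rw [h] at h5
      obtain h5 | h5 := h5
      · exact Or.inl (h5.of_erase (by omega) fun j _ _ e ↦ by omega)
      · refine Or.inr fun x hx ↦ ?_
        by_cases hxn : x = n
        · omega
        · exact h5 x (Finset.mem_erase.2 ⟨hxn, hx⟩)
  rank_toggle s hs hs' := by
    apply Finset.card_le_card
    have : unprimedToggle n s ≤ n ∨ unprimedToggle n s = 2 * n := by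
      obtain ⟨m, hm, h1, h2, h3, h4, h⟩ | ⟨h1, h2, h⟩ | ⟨h1, h⟩ := unprimedToggle_cases n s
      · have := hs.1 m hm
        omega
      · omega
      · omega
    intro x hx
    rw [mem_unprimed, Finset.mem_insert] at hx
    rw [mem_unprimed, Finset.mem_erase]
    obtain ⟨rfl | hx, h1, h2⟩ := hx
    · omega
    · exact ⟨⟨by omega, hx⟩, h1, h2⟩
  rank_mono s _ e hes _ := Finset.card_le_card (Finset.filter_subset_filter _ hes)
  toggle_eq s _ e hes _ h :=
    unprimedToggle_congr (Finset.eq_of_subset_of_card_le (Finset.filter_subset_filter _ hes) h.ge)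

/-- The vertex `0` and a vertex beyond the primed ones lie on both sides of the toggled vertex,
which makes the horn inner. -/
lemma isFillable_unprimedToggle {X S : SSet.{u}} {p : X ⟶ S} {M : ℕ → ℕ → Prop}
    (hp : InnerFibration p) (hn : 2 ≤ n) (hs : s ∈ prismChains n) (hs' : s ∉ prismHornBot n) :
    IsFillable p M s (unprimedToggle n s) := by
  have h0 : ¬ Misses n s ∧ ∃ x ∈ s, n < x := by
    by_contra! h
    refine hs' ⟨hs, ?_⟩
    by_cases h1 : Misses n s
    · exact Or.inl h1
    · exact Or.inr (h h1)
  obtain ⟨h0, x, hx, hnx⟩ := h0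
  rw [not_misses_iff] at h0
  refine Or.inl ⟨hp, 0, h0.1, ?_⟩
  have := hs.1
  obtain ⟨m, hm, h1, h2, h3, h4, h⟩ | ⟨h1, h2, h⟩ | ⟨h1, h⟩ := unprimedToggle_cases n s
  · exact ⟨m, hm, by omega, by omega⟩
  · exact ⟨_, h1, by omega, by omega⟩
  · exact ⟨x, hx, by omega, by have := h1 x hx; omega⟩

end

section

/-! ### Extensions over the comparison prism -/

lemma hom_ext_spanned {X : SSet.{u}} {N : ℕ} {F : Set (Finset ℕ)}
    {g h : (spanned.{u} N F : SSet) ⟶ X}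
    (H : ∀ d (x : (Δ[N] : SSet.{u}) _⦋d⦌) (hx : x ∈ (spanned N F).obj _),
      g.app _ ⟨x, hx⟩ = h.app _ ⟨x, hx⟩) : g = h := by
  ext ⟨d⟩ ⟨x, hx⟩
  induction d using SimplexCategory.rec with | _ d
  exact H d x hx

lemma hom_ext_horn {X : SSet.{u}} {n : ℕ} {i : Fin (n + 1)} {g h : (Λ[n, i] : SSet.{u}) ⟶ X}
    (H : ∀ d (x : (Δ[n] : SSet.{u}) _⦋d⦌) (hx : x ∈ Λ[n, i].obj _),
      g.app _ ⟨x, hx⟩ = h.app _ ⟨x, hx⟩) : g = h := by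
  ext ⟨d⟩ ⟨x, hx⟩
  induction d using SimplexCategory.rec with | _ d
  exact H d x hx

/-- The map to a subcomplex induced by a map to the standard simplex. -/
def liftSpanned {Z : SSet.{u}} {N : ℕ} {F : Set (Finset ℕ)} (f : Z ⟶ Δ[N])
    (h : ∀ d (z : Z _⦋d⦌), f.app _ z ∈ (spanned N F).obj _) : Z ⟶ (spanned.{u} N F : SSet) :=
  Subcomplex.lift f (by
    rintro ⟨d⟩ _ ⟨z, rfl⟩
    induction d using SimplexCategory.rec with | _ d
    exact h d z)

/-- Gluing a map on a family of faces and a map on a single face; the last clause is the uniqueness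
of the result after composition with a map `p`. -/
lemma exists_glue_simplexMap {X : SSet.{u}} {m N : ℕ} {F G : Set (Finset ℕ)} (hFG : F ⊆ G)
    {f : Fin (m + 1) →o Fin (N + 1)} (hf : StrictMono f)
    (hG : ∀ s ∈ G, s ∈ F ∨ ∀ x ∈ s, ∃ i, (f i : ℕ) = x)
    (g : (spanned.{u} N F : SSet) ⟶ X) (l : Δ[m] ⟶ X)
    (hgl : ∀ d (z : (Δ[m] : SSet.{u}) _⦋d⦌) (h : (simplexMap f).app _ z ∈ (spanned N F).obj _),
      g.app _ ⟨_, h⟩ = l.app _ z) :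
    ∃ g' : (spanned.{u} N G : SSet) ⟶ X, Subcomplex.homOfLE (spanned_mono hFG) ≫ g' = g ∧
      (∀ d (z : (Δ[m] : SSet.{u}) _⦋d⦌) (h : (simplexMap f).app _ z ∈ (spanned N G).obj _),
        g'.app _ ⟨_, h⟩ = l.app _ z) ∧
      ∀ (S : SSet.{u}) (p : X ⟶ S) (k : (spanned.{u} N G : SSet) ⟶ S),
        g ≫ p = Subcomplex.homOfLE (spanned_mono hFG) ≫ k →
        (∀ d (z : (Δ[m] : SSet.{u}) _⦋d⦌) (h : (simplexMap f).app _ z ∈ (spanned N G).obj _),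
          p.app _ (l.app _ z) = k.app _ ⟨_, h⟩) → g' ≫ p = k := by
  have := mono_simplexMap.{u} hf
  have hT {d : ℕ} (y : (Δ[N] : SSet.{u}) _⦋d⦌) (hy : y ∈ (spanned N G).obj _) :
      y ∈ (spanned N F).obj _ ∨ ∃ z, (simplexMap f).app _ z = y := by
    obtain ⟨s, hs, h⟩ := mem_spanned_iff.1 hy
    obtain hs | hs := hG s hs
    · exact Or.inl ⟨s, hs, h⟩
    · refine Or.inr ?_
      choose r hr using fun i ↦ hs _ (h i)
      have hr' (i) : f (r i) = y i := Fin.ext (hr i)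
      refine ⟨stdSimplex.objMk ⟨r, fun a b hab ↦ hf.le_iff_le.1 ?_⟩, ?_⟩
      · rw [hr', hr']
        exact stdSimplex.monotone_apply y hab
      · apply SSet.stdSimplex.ext
        exact hr'
  obtain ⟨g', h1, h2⟩ := exists_glue (spanned_mono hFG) (ε := simplexMap f) (by
    rintro ⟨d⟩ y hy
    induction d using SimplexCategory.rec with | _ d
    exact hT y hy) g l (by
    rintro ⟨d⟩ z hz
    induction d using SimplexCategory.rec with | _ d
    exact hgl d z hz)
  refine ⟨g', h1, fun d z h ↦ h2 _ z h, fun S p k h3 h4 ↦ hom_ext_spanned fun d x hx ↦ ?_⟩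
  obtain h | ⟨z, rfl⟩ := hT x hx
  · rw [← h1] at h3
    exact ConcreteCategory.congr_hom (NatTrans.congr_app h3 _) ⟨x, h⟩
  · exact (congr_arg (p.app _) (h2 _ z hx)).trans (h4 d z hx)

/-- The projection `0, i' ↦ 0`, `i ↦ i`, `x ↦ n - 1`, `n ↦ n`. -/
def prismCollapse (n : ℕ) : Fin (2 * n + 1 + 1) →o Fin (n + 1) where
  toFun x := ⟨if (x : ℕ) ≤ n then 0 else if (x : ℕ) < 2 * n then x - n else x - n - 1, by
    split_ifs <;> omega⟩
  monotone' x y h := by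
    have : (x : ℕ) ≤ y := h
    simp only [Fin.mk_le_mk]
    split_ifs <;> omega

/-- The vertices `0`, `i`, `n`. -/
def prismTop (n : ℕ) : Fin (n + 1) →o Fin (2 * n + 1 + 1) where
  toFun x := ⟨if (x : ℕ) = 0 then 0 else if (x : ℕ) < n then n + x else n + x + 1, by
    split_ifs <;> omega⟩
  monotone' x y h := by
    have : (x : ℕ) ≤ y := h
    simp only [Fin.mk_le_mk]
    split_ifs <;> omega

/-- The vertices `0`, `i'`. -/
def prismBot (n : ℕ) : Fin (n + 1) →o Fin (2 * n + 1 + 1) where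
  toFun x := ⟨x, by omega⟩
  monotone' x y h := h

/-- The vertices `n - 1`, `x`, `n`. -/
def prismTriangle (n : ℕ) : Fin (2 + 1) →o Fin (2 * n + 1 + 1) where
  toFun x := ⟨2 * n + 1 - (2 - x), by omega⟩
  monotone' x y h := by
    have : (x : ℕ) ≤ y := h
    simp only [Fin.mk_le_mk]
    omega

lemma prismCollapse_val (n : ℕ) (x : Fin (2 * n + 1 + 1)) : (prismCollapse n x : ℕ) =
    if (x : ℕ) ≤ n then 0 else if (x : ℕ) < 2 * n then x - n else x - n - 1 := rfl

lemma prismTop_val (n : ℕ) (x : Fin (n + 1)) : (prismTop n x : ℕ) =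
    if (x : ℕ) = 0 then 0 else if (x : ℕ) < n then n + x else n + x + 1 := rfl

lemma prismBot_val (n : ℕ) (x : Fin (n + 1)) : (prismBot n x : ℕ) = x := rfl

lemma prismTriangle_val (n : ℕ) (x : Fin (2 + 1)) :
    (prismTriangle n x : ℕ) = 2 * n + 1 - (2 - x) := rfl

lemma prismTop_strictMono (n : ℕ) : StrictMono (prismTop n) := by
  intro x y h
  have : (x : ℕ) < y := h
  change (_ : ℕ) < _
  rw [prismTop_val, prismTop_val]
  split_ifs <;> omega

lemma prismBot_strictMono (n : ℕ) : StrictMono (prismBot n) := fun _ _ h ↦ h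

lemma prismTriangle_strictMono {n : ℕ} (hn : 1 ≤ n) : StrictMono (prismTriangle n) := by
  intro x y h
  have : (x : ℕ) < y := h
  change (_ : ℕ) < _
  rw [prismTriangle_val, prismTriangle_val]
  omega

lemma prismCollapse_prismTop {n : ℕ} (hn : 1 ≤ n) (x : Fin (n + 1)) :
    prismCollapse n (prismTop n x) = x := by
  ext
  rw [prismCollapse_val, prismTop_val]
  split_ifs <;> omega

lemma simplexMap_prismTop_comp {n : ℕ} (hn : 1 ≤ n) :
    simplexMap.{u} (prismTop n) ≫ simplexMap (prismCollapse n) = 𝟙 _ := by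
  ext ⟨d⟩ x
  induction d using SimplexCategory.rec with | _ d
  apply SSet.stdSimplex.ext
  intro i
  exact prismCollapse_prismTop hn (x i)

/-- The degenerate triangle with vertices `n - 1`, `n - 1` and `n`. -/
def lastTriangle (n : ℕ) : Δ[2] ⟶ (Δ[n] : SSet.{u}) :=
  simplexMap (prismTriangle n) ≫ simplexMap (prismCollapse n)

section

variable {E C : SSet.{u}} {p : E ⟶ C} {m : ℕ}

lemma yonedaEquiv_symm_edge :
    SSet.yonedaEquiv.symm (stdSimplex.edge.{u} 2 1 2 (by decide)) = SSet.stdSimplex.δ 0 := by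
  apply SSet.yonedaEquiv.injective
  apply SSet.stdSimplex.ext
  intro i
  fin_cases i <;> rfl

lemma mem_spanned_prismTop {n d : ℕ} (hn : 1 ≤ n) {z : (Δ[n] : SSet.{u}) _⦋d⦌}
    (hz : z ∈ Λ[n, Fin.last n].obj _) : (simplexMap (prismTop n)).app _ z ∈
      (spanned.{u} (2 * n + 1) {s | s ∈ prismStart n ∧ 2 * n ∉ s}).obj _ := by
  obtain ⟨j, hj, h⟩ := (mem_horn_iff_notMem_range _ _).1 hz
  have hj' : (j : ℕ) < n := Fin.lt_last_iff_ne_last.2 hj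
  have key {y : ℕ} (hy : y ∈ Finset.univ.image fun i ↦ (prismTop n (z i) : ℕ)) :
      ∃ i ≤ n, i ≠ j ∧ y = if i = 0 then 0 else if i < n then n + i else n + i + 1 := by
    obtain ⟨i, -, rfl⟩ := Finset.mem_image.1 hy
    exact ⟨z i, by omega, fun e ↦ h ⟨i, Fin.ext e⟩, rfl⟩
  refine mem_spanned_iff.2 ⟨Finset.univ.image fun i ↦ (prismTop n (z i) : ℕ),
    ⟨⟨⟨fun y hy ↦ ?_, fun a ha b _ h1 h2 _ _ ↦ ?_⟩, fun y hy ↦ ?_, ?_,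
      Or.inl fun hy ↦ ?_⟩, fun hy ↦ ?_⟩, fun i ↦ Finset.mem_image.2 ⟨i, Finset.mem_univ i, rfl⟩⟩
  · obtain ⟨i, h1, h2, rfl⟩ := key hy
    split_ifs <;> omega
  · obtain ⟨i, h1, h2, rfl⟩ := key ha
    split_ifs at * <;> omega
  · obtain ⟨i, h1, h2, rfl⟩ := key hy
    split_ifs <;> omega
  · by_cases h0 : (j : ℕ) = 0
    · refine Or.inl fun hy ↦ ?_
      obtain ⟨i, h1, h2, h3⟩ := key hy
      split_ifs at h3 <;> omega
    · refine Or.inr ⟨j, by omega, hj', fun hy ↦ ?_, fun hy ↦ ?_⟩ <;>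
      · obtain ⟨i, h1, h2, h3⟩ := key hy
        split_ifs at h3 <;> omega
  all_goals
    obtain ⟨i, h1, h2, h3⟩ := key hy
    split_ifs at h3 <;> omega

lemma lastEdge_apply (m : ℕ) (i : Fin 2) :
    ((lastEdge.{u} m).1 i : ℕ) = m + 1 + i := by
  fin_cases i <;> rfl

/-- The image in the horn of a simplex of the last edge. -/
lemma lastEdgeι_app_apply {d : ℕ} (m : ℕ) (z : (Δ[1] : SSet.{u}) _⦋d⦌) (i : Fin (d + 1)) :
    (((lastEdgeι.{u} m).app _ z).1 i : ℕ) = m + 1 + z i :=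
  lastEdge_apply.{u} m (z i)

/-- A horn in `E` is pulled back along Cartesian edges to the fibre over its initial vertex. The
result is a map on the part of the prism over the horn, which is prescribed on the horn itself and
on a triangle `t` that factors the last edge. -/
lemma exists_extension_prismHorn (hp : InnerFibration p) (hp' : HasCartesianLifts p)
    (σ : (Λ[m + 2, Fin.last (m + 2)] : SSet.{u}) ⟶ E) (t : Δ[2] ⟶ E) (θ : Δ[m + 2] ⟶ C)
    (h₁ : lastEdgeι m ≫ σ = SSet.stdSimplex.δ 1 ≫ t)
    (h₂ : σ ≫ p = Λ[m + 2, Fin.last (m + 2)].ι ≫ θ)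
    (h₃ : t ≫ p = lastTriangle (m + 2) ≫ θ) (h₄ : IsCartesian p (SSet.stdSimplex.δ 0 ≫ t)) :
    ∃ g : (spanned.{u} (2 * (m + 2) + 1) (prismHorn (m + 2)) : SSet) ⟶ E,
      g ≫ p = (spanned.{u} (2 * (m + 2) + 1) (prismHorn (m + 2))).ι ≫
        simplexMap (prismCollapse (m + 2)) ≫ θ ∧
      SendsMarked p (PrismMarked (m + 2)) g ∧
      (∀ d (z : (Δ[m + 2] : SSet.{u}) _⦋d⦌) (hz : z ∈ Λ[m + 2, Fin.last (m + 2)].obj _)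
        (hz' : (simplexMap (prismTop (m + 2))).app _ z ∈
          (spanned.{u} (2 * (m + 2) + 1) (prismHorn (m + 2))).obj _),
        g.app _ ⟨_, hz'⟩ = σ.app _ ⟨z, hz⟩) ∧
      (∀ d (z : (Δ[2] : SSet.{u}) _⦋d⦌)
        (hz' : (simplexMap (prismTriangle (m + 2))).app _ z ∈
          (spanned.{u} (2 * (m + 2) + 1) (prismHorn (m + 2))).obj _),
        g.app _ ⟨_, hz'⟩ = t.app _ z) := by
  let F : Set (Finset ℕ) := {s | s ∈ prismStart (m + 2) ∧ 2 * (m + 2) ∉ s}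
  have hF {d : ℕ} {x : (Δ[2 * (m + 2) + 1] : SSet.{u}) _⦋d⦌} (hx : x ∈ (spanned _ F).obj _) :
      (simplexMap (prismCollapse (m + 2))).app _ x ∈ Λ[m + 2, Fin.last (m + 2)].obj _ := by
    obtain ⟨s, ⟨⟨h1, h2, h3, -⟩, h4⟩, h5⟩ := mem_spanned_iff.1 hx
    rw [mem_horn_iff_notMem_range]
    obtain h3 | ⟨j, h6, h7, h8, h9⟩ := h3
    · refine ⟨0, (Fin.last_pos' (n := m + 2)).ne, ?_⟩
      rintro ⟨i, hi⟩
      rw [simplexMap_app_apply, Fin.ext_iff, prismCollapse_val] at hi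
      have e1 := h2 _ (h5 i)
      have e2 : (x i : ℕ) ≠ 0 := fun e ↦ h3 (e ▸ h5 i)
      have e3 : (x i : ℕ) ≠ 2 * (m + 2) := fun e ↦ h4 (e ▸ h5 i)
      simp only [Fin.val_zero] at hi
      split_ifs at hi <;> omega
    · refine ⟨⟨j, by omega⟩, ?_, ?_⟩
      · rw [ne_eq, Fin.ext_iff]
        exact h7.ne
      rintro ⟨i, hi⟩
      rw [simplexMap_app_apply, Fin.ext_iff, prismCollapse_val] at hi
      have e1 := h2 _ (h5 i)
      have e2 : (x i : ℕ) ≠ (m + 2) + j := fun e ↦ h9 (e ▸ h5 i)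
      have e3 : (x i : ℕ) ≠ 2 * (m + 2) := fun e ↦ h4 (e ▸ h5 i)
      simp only at hi
      split_ifs at hi <;> omega
  let r : (spanned.{u} (2 * (m + 2) + 1) F : SSet) ⟶ (Λ[m + 2, Fin.last (m + 2)] : SSet.{u}) :=
    Subcomplex.lift ((spanned.{u} (2 * (m + 2) + 1) F).ι ≫ simplexMap (prismCollapse (m + 2))) (by
      rintro ⟨d⟩ _ ⟨⟨x, hx⟩, rfl⟩
      induction d using SimplexCategory.rec with | _ d
      exact hF hx)
  have hrp : (r ≫ σ) ≫ p = (spanned.{u} (2 * (m + 2) + 1) F).ι ≫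
      simplexMap (prismCollapse (m + 2)) ≫ θ := by
    rw [Category.assoc, h₂]; rfl
  have hFS : F ⊆ prismStart (m + 2) := fun s hs ↦ hs.1
  obtain ⟨g₀, h5, h6, h7⟩ := exists_glue_simplexMap hFS (prismTriangle_strictMono (by omega)) (by
    intro s hs
    by_cases h : 2 * (m + 2) ∈ s
    · right
      intro x hx
      have h1 := (hs.2.2.2.resolve_left (not_not.2 h)) x hx
      have h2 := hs.1.1 x hx
      exact ⟨⟨x - (2 * (m + 2) - 1), by omega⟩, by rw [prismTriangle_val]; dsimp only; omega⟩
    · exact Or.inl ⟨hs, h⟩) (r ≫ σ) t (by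
    intro d z hz
    -- such a simplex avoids `x`, hence comes from the long edge of the triangle
    obtain ⟨s, hs, h⟩ := mem_spanned_iff.1 hz
    have hz1 (i) : z i ≠ 1 := by
      intro e
      have := h i
      rw [simplexMap_app_apply, prismTriangle_val, e] at this
      refine hs.2 ?_
      convert this using 1
      change _ = 2 * (m + 2) + 1 - (2 - 1)
      omega
    let z' : (Δ[1] : SSet.{u}) _⦋d⦌ := stdSimplex.objMk
      ⟨fun i ↦ if z i = 0 then 0 else 1, fun a b hab ↦ by
        have := stdSimplex.monotone_apply z hab
        dsimp only at this ⊢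
        have h1 := hz1 a
        have h2 := hz1 b
        split_ifs <;> lia⟩
    have hz'i (i) : z' i = if z i = 0 then 0 else 1 := rfl
    have hz' : (SSet.stdSimplex.δ (1 : Fin 3)).app _ z' = z := by
      apply SSet.stdSimplex.ext
      intro i
      change (1 : Fin 3).succAbove (z' i) = z i
      rw [hz'i]
      have h1 := hz1 i
      split_ifs with h2
      · rw [h2]; rfl
      · change (2 : Fin 3) = _
        lia
    have e1 := ConcreteCategory.congr_hom (NatTrans.congr_app h₁ (Opposite.op ⦋d⦌)) z'
    refine Eq.trans ?_ (e1.trans (congr_arg (t.app _) hz'))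
    refine congr_arg (σ.app _) (Subtype.ext ?_)
    apply SSet.stdSimplex.ext
    intro i
    ext
    refine Eq.trans ?_ (lastEdgeι_app_apply m z' i).symm
    change (prismCollapse (m + 2) (prismTriangle (m + 2) (z i)) : ℕ) = _
    rw [prismCollapse_val, prismTriangle_val, hz'i]
    have h1 := hz1 i
    have h2 : (z i : ℕ) = 0 ∨ (z i : ℕ) = 2 := by lia
    obtain h2 | h2 := h2
    · have h3 : z i = 0 := Fin.ext h2
      rw [h2, if_pos h3]
      change _ = m + 1
      split_ifs <;> omega
    · have h3 : z i ≠ 0 := by rintro e; rw [e] at h2; exact absurd h2 (by decide)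
      rw [h2, if_neg h3]
      change _ = m + 1 + 1
      split_ifs <;> omega)
  have h8 := h7 _ p ((spanned.{u} (2 * (m + 2) + 1) (prismStart (m + 2))).ι ≫
    simplexMap (prismCollapse (m + 2)) ≫ θ) hrp (fun d z h ↦
      ConcreteCategory.congr_hom (NatTrans.congr_app h₃ (Opposite.op ⦋d⦌)) z)
  have hpair := togglePairing_prismStart (n := m + 2) (by omega)
  obtain ⟨g, h9, h10, h11⟩ := hpair.exists_extension (M := PrismMarked (m + 2)) (p := p)
    (fun s hs hs' _ ↦ isFillable_primeToggle hp hp' hs.1 (fun h ↦ by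
      by_contra h'
      exact hs' ⟨hs.1, h, hs.2, Or.inl h'⟩))
    (by rintro a b (h | h) <;> omega)
    (fun a b hab hB hA ↦ primeToggle_mem_of_prismMarked hab (by omega) (by
      rintro e
      rw [e] at hA hB
      refine hA ⟨hB.1, ?_, hB.2, Or.inr ?_⟩ <;>
      · intro x hx
        simp only [Finset.mem_insert, Finset.mem_singleton] at hx
        omega))
    g₀ ((spanned.{u} (2 * (m + 2) + 1) (prismHorn (m + 2))).ι ≫
      simplexMap (prismCollapse (m + 2)) ≫ θ) h8 (by
      rintro x hx (⟨h1, h2, h3⟩ | ⟨h1, h2⟩)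
      · obtain ⟨s, hs, h⟩ := mem_spanned_iff.1 hx
        have := hs.2.1 _ (h 0)
        omega
      · have hx' : x = (simplexMap (prismTriangle (m + 2))).app _
            (stdSimplex.edge 2 1 2 (by decide)) := by
          apply SSet.stdSimplex.ext
          intro i
          ext
          refine Eq.trans ?_ (prismTriangle_val (m + 2) _).symm
          fin_cases i
          · refine h1.trans ?_
            change _ = 2 * (m + 2) + 1 - (2 - 1)
            omega
          · refine h2.trans ?_
            change _ = 2 * (m + 2) + 1 - (2 - 2)
            omega
        subst hx'
        rw [h6 _ _ hx]
        convert h₄ using 1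
        rw [← yonedaEquiv_symm_edge, yonedaEquiv_symm_comp])
  refine ⟨g, h10, h11, fun d z hz hz' ↦ ?_, fun d z hz' ↦ ?_⟩
  · have hz'' := mem_spanned_prismTop (by omega) hz
    rw [← h9] at h5
    refine (ConcreteCategory.congr_hom (NatTrans.congr_app h5 _) ⟨_, hz''⟩).trans ?_
    refine congr_arg (σ.app _) (Subtype.ext ?_)
    exact ConcreteCategory.congr_hom (NatTrans.congr_app
      (simplexMap_prismTop_comp (n := m + 2) (by omega)) (Opposite.op ⦋d⦌)) z
  · have hz'' : (simplexMap (prismTriangle (m + 2))).app _ z ∈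
        (spanned.{u} (2 * (m + 2) + 1) (prismStart (m + 2))).obj _ := by
      refine mem_spanned_iff.2 ⟨{2 * (m + 2) - 1, 2 * (m + 2), 2 * (m + 2) + 1},
        ⟨⟨?_, ?_⟩, ?_, Or.inl (by simp; omega), Or.inr ?_⟩, fun i ↦ ?_⟩
      · intro x hx
        simp only [Finset.mem_insert, Finset.mem_singleton] at hx
        omega
      · intro a ha b hb
        simp only [Finset.mem_insert, Finset.mem_singleton] at ha
        omega
      · intro x hx
        simp only [Finset.mem_insert, Finset.mem_singleton] at hx
        omega
      · intro x hx
        simp only [Finset.mem_insert, Finset.mem_singleton] at hx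
        omega
      · rw [simplexMap_app_apply, prismTriangle_val]
        simp only [Finset.mem_insert, Finset.mem_singleton]
        omega
    rw [← h6 d z hz'', ← h9]
    rfl

end

section

variable {n : ℕ}

lemma mem_horn_of_prismTop (hn : 1 ≤ n) {d : ℕ} {z : (Δ[n] : SSet.{u}) _⦋d⦌}
    (hz : (simplexMap (prismTop n)).app _ z ∈ (spanned (2 * n + 1) (prismHorn n)).obj _) :
    z ∈ Λ[n, Fin.last n].obj _ := by
  obtain ⟨s, hs, h⟩ := mem_spanned_iff.1 hz
  rw [mem_horn_iff_notMem_range]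
  obtain h1 | ⟨j, h1, h2, h3, h4⟩ := hs.2
  · refine ⟨0, fun e ↦ ?_, ?_⟩
    · have := congr_arg Fin.val e
      simp only [Fin.val_zero, Fin.val_last] at this
      omega
    · rintro ⟨i, hi⟩
      have := h i
      rw [simplexMap_app_apply, prismTop_val, hi, Fin.val_zero, if_pos rfl] at this
      exact h1 this
  · refine ⟨⟨j, by omega⟩, fun e ↦ ?_, ?_⟩
    · have := congr_arg Fin.val e
      simp only [Fin.val_last] at this
      omega
    · rintro ⟨i, hi⟩
      have := h i
      rw [simplexMap_app_apply, prismTop_val, hi] at this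
      simp only [h2, if_true, if_neg (by omega : ¬ j = 0)] at this
      exact h4 this

lemma mem_horn_of_prismBot (hn : 1 ≤ n) {d : ℕ} {z : (Δ[n] : SSet.{u}) _⦋d⦌}
    (hz : (simplexMap (prismBot n)).app _ z ∈ (spanned (2 * n + 1) (prismHorn n)).obj _) :
    z ∈ Λ[n, Fin.last n].obj _ := by
  obtain ⟨s, hs, h⟩ := mem_spanned_iff.1 hz
  rw [mem_horn_iff_notMem_range]
  obtain h1 | ⟨j, h1, h2, h3, h4⟩ := hs.2
  · refine ⟨0, fun e ↦ ?_, ?_⟩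
    · have := congr_arg Fin.val e
      simp only [Fin.val_zero, Fin.val_last] at this
      omega
    · rintro ⟨i, hi⟩
      have := h i
      rw [simplexMap_app_apply, prismBot_val, hi, Fin.val_zero] at this
      exact h1 this
  · refine ⟨⟨j, by omega⟩, fun e ↦ ?_, ?_⟩
    · have := congr_arg Fin.val e
      simp only [Fin.val_last] at this
      omega
    · rintro ⟨i, hi⟩
      have := h i
      rw [simplexMap_app_apply, prismBot_val, hi] at this
      exact h3 this

lemma prismTop_mem_prismChains (hn : 1 ≤ n) {d : ℕ} (z : (Δ[n] : SSet.{u}) _⦋d⦌) :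
    (simplexMap (prismTop n)).app _ z ∈ (spanned (2 * n + 1) (prismChains n)).obj _ := by
  refine mem_spanned_iff.2 ⟨Finset.univ.image fun i ↦ (prismTop n (z i) : ℕ),
    ⟨fun x hx ↦ ?_, fun a ha b hb h1 h2 h3 h4 ↦ ?_⟩,
    fun i ↦ Finset.mem_image.2 ⟨i, Finset.mem_univ i, rfl⟩⟩
  · obtain ⟨i, -, rfl⟩ := Finset.mem_image.1 hx
    omega
  · obtain ⟨i, -, rfl⟩ := Finset.mem_image.1 ha
    rw [prismTop_val] at h1 h2
    split_ifs at h1 h2 <;> omega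

lemma prismBot_mem_prismChains {d : ℕ} (z : (Δ[n] : SSet.{u}) _⦋d⦌) :
    (simplexMap (prismBot n)).app _ z ∈ (spanned (2 * n + 1) (prismChains n)).obj _ := by
  refine mem_spanned_iff.2 ⟨Finset.range (n + 1), ⟨fun x hx ↦ ?_, fun a ha b hb h1 h2 h3 h4 ↦ ?_⟩,
    fun i ↦ ?_⟩
  · rw [Finset.mem_range] at hx; omega
  · rw [Finset.mem_range] at hb; omega
  · rw [Finset.mem_range]
    exact (z i).isLt

/-- The extension of a map from the part of the prism over the last horn to the whole prism,
prescribed on the original simplex. -/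
lemma exists_extension_prismChains {D C : SSet.{u}} {q : D ⟶ C} (hn : 2 ≤ n)
    (hq : InnerFibration q) (hq' : HasCartesianLifts q)
    (g : (spanned.{u} (2 * n + 1) (prismHorn n) : SSet) ⟶ D) (τ : Δ[n] ⟶ D)
    (h₁ : g ≫ q = (spanned.{u} (2 * n + 1) (prismHorn n)).ι ≫ simplexMap (prismCollapse n) ≫ τ ≫ q)
    (h₂ : SendsMarked q (PrismMarked n) g)
    (h₃ : ∀ d (z : (Δ[n] : SSet.{u}) _⦋d⦌) (hz : (simplexMap (prismTop n)).app _ z ∈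
      (spanned.{u} (2 * n + 1) (prismHorn n)).obj _), g.app _ ⟨_, hz⟩ = τ.app _ z) :
    ∃ h : (spanned.{u} (2 * n + 1) (prismChains n) : SSet) ⟶ D,
      Subcomplex.homOfLE (spanned_mono fun _ hs ↦ hs.1) ≫ h = g ∧
      h ≫ q = (spanned.{u} (2 * n + 1) (prismChains n)).ι ≫
        simplexMap (prismCollapse n) ≫ τ ≫ q ∧
      ∀ d (z : (Δ[n] : SSet.{u}) _⦋d⦌),
        h.app _ ⟨_, prismTop_mem_prismChains (by omega) z⟩ = τ.app _ z := by
  have hsub : prismHorn n ⊆ prismHornTop n := fun s hs ↦ ⟨hs.1, Or.inl hs.2⟩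
  obtain ⟨g₀, h5, h6, h7⟩ := exists_glue_simplexMap hsub (prismTop_strictMono n) (by
    rintro s ⟨hs, h | ⟨h, h'⟩⟩
    · exact Or.inl ⟨hs, h⟩
    · right
      intro x hx
      have e1 := h x hx
      have e2 : x ≠ 2 * n := fun e ↦ h' (e ▸ hx)
      have e3 := hs.1 x hx
      refine ⟨⟨if x = 0 then 0 else if x < 2 * n then x - n else n, by split_ifs <;> omega⟩, ?_⟩
      rw [prismTop_val]
      dsimp only
      split_ifs <;> omega) g τ h₃
  have h8 := h7 _ q ((spanned.{u} (2 * n + 1) (prismHornTop n)).ι ≫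
    simplexMap (prismCollapse n) ≫ τ ≫ q) h₁ (fun d z h ↦ by
      refine congr_arg (fun y ↦ (τ ≫ q).app _ y) ?_
      exact (ConcreteCategory.congr_hom (NatTrans.congr_app
        (simplexMap_prismTop_comp (n := n) (by omega)) (Opposite.op ⦋d⦌)) z).symm)
  obtain ⟨h, h9, h10, -⟩ := (togglePairing_prismHornTop hn).exists_extension (M := PrismMarked n)
    (p := q)
    (fun s hs hs' _ ↦ isFillable_primeToggle hq hq' hs (fun h ↦ by
      by_contra h'
      exact hs' ⟨hs, Or.inr ⟨h, h'⟩⟩))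
    (by rintro a b (h | h) <;> omega)
    (fun a b hab hB hA ↦ primeToggle_mem_of_prismMarked hab (by omega) (by
      rintro e
      rw [e] at hA hB
      exact hA ⟨hB, Or.inl (Or.inl (by simp; omega))⟩))
    g₀ ((spanned.{u} (2 * n + 1) (prismChains n)).ι ≫ simplexMap (prismCollapse n) ≫ τ ≫ q) h8 (by
      intro x hx hM
      obtain ⟨s, ⟨hs, hs' | ⟨hs', hs''⟩⟩, h⟩ := mem_spanned_iff.1 hx
      · have hx' : x ∈ (spanned (2 * n + 1) (prismHorn n)).obj _ :=
          mem_spanned_iff.2 ⟨s, ⟨hs, hs'⟩, h⟩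
        have := h₂ x hx' hM
        rw [← h5] at this
        exact this
      · have e1 := hs' _ (h 0)
        have e2 : (x 0 : ℕ) ≠ 2 * n := fun e ↦ hs'' (e ▸ h 0)
        obtain h | h := hM <;> omega)
  refine ⟨h, ?_, h10, fun d z ↦ ?_⟩
  · rw [← h5, ← h9]; rfl
  · have hz : (simplexMap (prismTop n)).app _ z ∈
        (spanned.{u} (2 * n + 1) (prismHornTop n)).obj _ := by
      refine mem_spanned_iff.2 ⟨Finset.univ.image fun i ↦ (prismTop n (z i) : ℕ), ⟨
        ⟨fun x hx ↦ ?_, fun a ha b hb h1 h2 h3 h4 ↦ ?_⟩, Or.inr ⟨fun x hx ↦ ?_, fun hx ↦ ?_⟩⟩,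
        fun i ↦ Finset.mem_image.2 ⟨i, Finset.mem_univ i, rfl⟩⟩
      · obtain ⟨i, -, rfl⟩ := Finset.mem_image.1 hx
        omega
      · obtain ⟨i, -, rfl⟩ := Finset.mem_image.1 ha
        rw [prismTop_val] at h1 h2
        split_ifs at h1 h2 <;> omega
      · obtain ⟨i, -, rfl⟩ := Finset.mem_image.1 hx
        rw [prismTop_val]
        split_ifs <;> omega
      · obtain ⟨i, -, h⟩ := Finset.mem_image.1 hx
        rw [prismTop_val] at h
        split_ifs at h <;> omega
    rw [← h6 d z hz, ← h9]
    rfl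

/-- Lifting a map out of the prism along an inner fibration, given lifts over the last horn and
over the simplex with vertices `0` and `i'`. -/
lemma exists_lift_prismChains {E D : SSet.{u}} {f : E ⟶ D} (hn : 2 ≤ n)
    (hf : InnerFibration f)
    (g : (spanned.{u} (2 * n + 1) (prismHorn n) : SSet) ⟶ E)
    (h : (spanned.{u} (2 * n + 1) (prismChains n) : SSet) ⟶ D)
    (h₁ : g ≫ f = Subcomplex.homOfLE (spanned_mono fun _ hs ↦ hs.1) ≫ h)
    (l : Δ[n] ⟶ E) (h₂ : l ≫ f = liftSpanned (simplexMap (prismBot n))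
      (fun _ ↦ prismBot_mem_prismChains) ≫ h)
    (h₃ : ∀ d (z : (Δ[n] : SSet.{u}) _⦋d⦌) (hz : (simplexMap (prismBot n)).app _ z ∈
      (spanned.{u} (2 * n + 1) (prismHorn n)).obj _), g.app _ ⟨_, hz⟩ = l.app _ z) :
    ∃ G : (spanned.{u} (2 * n + 1) (prismChains n) : SSet) ⟶ E,
      Subcomplex.homOfLE (spanned_mono fun _ hs ↦ hs.1) ≫ G = g ∧ G ≫ f = h := by
  have hsub : prismHorn n ⊆ prismHornBot n := fun s hs ↦ ⟨hs.1, Or.inl hs.2⟩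
  obtain ⟨g₀, h5, h6, h7⟩ := exists_glue_simplexMap hsub (prismBot_strictMono n) (by
    rintro s ⟨hs, h | h⟩
    · exact Or.inl ⟨hs, h⟩
    · right
      intro x hx
      exact ⟨⟨x, by have := h x hx; omega⟩, rfl⟩) g l h₃
  have h8 := h7 _ f (Subcomplex.homOfLE (spanned_mono fun _ hs ↦ hs.1) ≫ h) h₁ (fun d z h ↦
    ConcreteCategory.congr_hom (NatTrans.congr_app h₂ (Opposite.op ⦋d⦌)) z)
  obtain ⟨G, h9, h10, -⟩ := (togglePairing_prismHornBot hn).exists_extension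
    (M := fun _ _ ↦ False) (p := f)
    (fun s hs hs' _ ↦ isFillable_unprimedToggle hf hn hs hs')
    (by simp) (by simp) g₀ h h8 (fun _ _ h ↦ h.elim)
  exact ⟨G, by rw [← h5, ← h9]; rfl, h10⟩

end

end

section

/-! ### Cartesian lifts from fibrewise Cartesian lifts -/

/-- The edge `e` is Cartesian for the functor induced by `f` on a fibre of `q`: it has the lifting
property of Cartesian edges for all lifting problems inside a fibre. -/
def IsFibreCartesian {E D C : SSet.{u}} (f : E ⟶ D) (q : D ⟶ C) (e : Δ[1] ⟶ E) : Prop :=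
  ∀ (n : ℕ) (σ : (Λ[n + 2, Fin.last (n + 2)] : SSet.{u}) ⟶ E), lastEdgeι n ≫ σ = e →
    ∀ τ : Δ[n + 2] ⟶ D, σ ≫ f = Λ[n + 2, Fin.last (n + 2)].ι ≫ τ →
      (∃ c : C _⦋0⦌, τ ≫ q = SSet.const c) →
      ∃ l : Δ[n + 2] ⟶ E, Λ[n + 2, Fin.last (n + 2)].ι ≫ l = σ ∧ l ≫ f = τ

/-- The horizontal side of a square at height `j`. -/
def sqHor (j : Fin 2) : Δ[1] ⟶ (Δ[1] ⊗ Δ[1] : SSet.{u}) :=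
  lift (𝟙 _) (SSet.const (stdSimplex.obj₀Equiv.symm j))

/-- The vertical side of a square at `j`. -/
def sqVer (j : Fin 2) : Δ[1] ⟶ (Δ[1] ⊗ Δ[1] : SSet.{u}) :=
  lift (SSet.const (stdSimplex.obj₀Equiv.symm j)) (𝟙 _)

/-- The square with vertices `(n - 1)'`, `n'`, `n - 1` and `x`. -/
def prismSquare (n : ℕ) : (Δ[1] ⊗ Δ[1] : SSet.{u}) ⟶ Δ[2 * n + 1] where
  app d := ↾fun z ↦ stdSimplex.objMk
    ⟨fun i ↦ ⟨n - 1 + stdSimplex.asOrderHom z.2 i + n * stdSimplex.asOrderHom z.1 i, by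
      have h1 := (stdSimplex.asOrderHom z.2 i).isLt
      have h2 := (stdSimplex.asOrderHom z.1 i).isLt
      have h2 : (stdSimplex.asOrderHom z.1 i : ℕ) = 0 ∨
        (stdSimplex.asOrderHom z.1 i : ℕ) = 1 := by omega
      change _ < 2 * n + 1 + 1
      rcases h2 with h2 | h2 <;> rw [h2] <;> omega⟩, fun a b hab ↦ by
      have h1 : (stdSimplex.asOrderHom z.2 a : ℕ) ≤ stdSimplex.asOrderHom z.2 b :=
        (stdSimplex.asOrderHom z.2).monotone hab
      have h2 : (stdSimplex.asOrderHom z.1 a : ℕ) ≤ stdSimplex.asOrderHom z.1 b :=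
        (stdSimplex.asOrderHom z.1).monotone hab
      simp only [Fin.mk_le_mk]
      gcongr⟩
  naturality _ _ _ := rfl

lemma prismSquare_val {n d : ℕ} (z : (Δ[1] ⊗ Δ[1] : SSet.{u}) _⦋d⦌) (i : Fin (d + 1)) :
    ((prismSquare n).app _ z i : ℕ) =
      n - 1 + (z.2 : (Δ[1] : SSet.{u}) _⦋d⦌) i + n * (z.1 : (Δ[1] : SSet.{u}) _⦋d⦌) i := rfl

lemma prismSquare_mem {n d : ℕ} (hn : 2 ≤ n) (z : (Δ[1] ⊗ Δ[1] : SSet.{u}) _⦋d⦌) :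
    (prismSquare n).app _ z ∈ (spanned (2 * n + 1) (prismHorn n)).obj _ := by
  rw [mem_spanned_iff]
  have h1 (i) : ((z.1 : (Δ[1] : SSet.{u}) _⦋d⦌) i : ℕ) = 0 ∨
    ((z.1 : (Δ[1] : SSet.{u}) _⦋d⦌) i : ℕ) = 1 := by omega
  by_cases h : ∃ i, ((z.1 : (Δ[1] : SSet.{u}) _⦋d⦌) i : ℕ) = 0 ∧
    ((z.2 : (Δ[1] : SSet.{u}) _⦋d⦌) i : ℕ) = 1
  · refine ⟨{n - 1, n, 2 * n}, ⟨⟨?_, ?_⟩, Or.inl (by simp; omega)⟩, fun i ↦ ?_⟩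
    · simp only [Finset.mem_insert, Finset.mem_singleton]; omega
    · simp only [Finset.mem_insert, Finset.mem_singleton]; omega
    · rw [prismSquare_val]
      simp only [Finset.mem_insert, Finset.mem_singleton]
      obtain ⟨j, hj1, hj2⟩ := h
      have h2 : i ≤ j → ((z.1 : (Δ[1] : SSet.{u}) _⦋d⦌) i : ℕ) ≤ (z.1 : (Δ[1] : SSet.{u}) _⦋d⦌) j :=
        fun h ↦ stdSimplex.monotone_apply (z.1 : (Δ[1] : SSet.{u}) _⦋d⦌) h
      have h3 : j ≤ i → ((z.2 : (Δ[1] : SSet.{u}) _⦋d⦌) j : ℕ) ≤ (z.2 : (Δ[1] : SSet.{u}) _⦋d⦌) i :=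
        fun h ↦ stdSimplex.monotone_apply (z.2 : (Δ[1] : SSet.{u}) _⦋d⦌) h
      obtain h1 | h1 := h1 i
      · rw [h1]; omega
      · have := h3 (by rcases le_total i j with h | h; · have := h2 h; omega
                       · exact h)
        rw [h1]; omega
  · push Not at h
    refine ⟨{n - 1, 2 * n - 1, 2 * n}, ⟨⟨?_, ?_⟩, Or.inl (by simp; omega)⟩, fun i ↦ ?_⟩
    · simp only [Finset.mem_insert, Finset.mem_singleton]; omega
    · simp only [Finset.mem_insert, Finset.mem_singleton]; omega
    · rw [prismSquare_val]
      simp only [Finset.mem_insert, Finset.mem_singleton]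
      obtain h1 | h1 := h1 i
      · have := h i h1
        rw [h1]; omega
      · rw [h1]; omega

lemma prismSquare_prismCollapse {n : ℕ} (hn : 2 ≤ n) :
    prismSquare.{u} n ≫ simplexMap (prismCollapse n) =
      fst _ _ ≫ SSet.yonedaEquiv.symm (stdSimplex.edge n 0 ⟨n - 1, by omega⟩ (Fin.zero_le _)) := by
  ext ⟨d⟩ z
  induction d using SimplexCategory.rec with | _ d
  apply SSet.stdSimplex.ext
  intro i
  refine Fin.ext ?_
  change (prismCollapse n ((prismSquare n).app _ z i) : ℕ) =
    ((![(0 : Fin (n + 1)), ⟨n - 1, _⟩] ((z.1 : (Δ[1] : SSet.{u}) _⦋d⦌) i) : Fin (n + 1)) : ℕ)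
  rw [prismCollapse_val, prismSquare_val]
  generalize (z.1 : (Δ[1] : SSet.{u}) _⦋d⦌) i = a
  generalize (z.2 : (Δ[1] : SSet.{u}) _⦋d⦌) i = b
  fin_cases a <;> fin_cases b <;> simp <;> (try split_ifs) <;> omega

lemma prismBot_prismCollapse (n : ℕ) : simplexMap.{u} (prismBot n) ≫ simplexMap (prismCollapse n) =
    SSet.const (stdSimplex.obj₀Equiv.symm 0) := by
  ext ⟨d⟩ z
  induction d using SimplexCategory.rec with | _ d
  apply SSet.stdSimplex.ext
  intro i
  refine Fin.ext ?_
  change (prismCollapse n (prismBot n (z i)) : ℕ) = 0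
  rw [prismCollapse_val, prismBot_val, if_pos (by omega)]

lemma prismBot_mem_prismHorn {n d : ℕ} {z : (Δ[n] : SSet.{u}) _⦋d⦌}
    (hz : z ∈ Λ[n, Fin.last n].obj _) :
    (simplexMap (prismBot n)).app _ z ∈ (spanned (2 * n + 1) (prismHorn n)).obj _ := by
  obtain ⟨j, hj, h⟩ := (mem_horn_iff_notMem_range _ _).1 hz
  have hj' : (j : ℕ) < n := Fin.lt_last_iff_ne_last.2 hj
  refine mem_spanned_iff.2 ⟨(Finset.range (n + 1)).erase j, ⟨⟨?_, ?_⟩, ?_⟩, fun i ↦ ?_⟩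
  · simp only [Finset.mem_erase, Finset.mem_range]; omega
  · simp only [Finset.mem_erase, Finset.mem_range]; omega
  · by_cases h0 : (j : ℕ) = 0
    · exact Or.inl (by simp [h0])
    · exact Or.inr ⟨j, by omega, hj', by simp, by
        simp only [Finset.mem_erase, Finset.mem_range]; omega⟩
  · rw [Finset.mem_erase, Finset.mem_range, simplexMap_app_apply, prismBot_val]
    exact ⟨fun e ↦ h ⟨i, Fin.ext e⟩, (z i).isLt⟩

lemma prismHorn_hom_ext {Z : SSet.{u}} {N : ℕ} {F : Set (Finset ℕ)}
    {a b : Z ⟶ (spanned.{u} N F : SSet)} (h : a ≫ (spanned N F).ι = b ≫ (spanned N F).ι) : a = b :=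
  (cancel_mono _).1 h

variable {E D C : SSet.{u}} {f : E ⟶ D} {q : D ⟶ C}

/-- The filler over the simplex with vertices `0` and `i'`, which lies in a fibre. -/
lemma exists_lift_prismBot {m : ℕ}
    (htrans : ∀ (φ : Δ[1] ⟶ C) (s : (Δ[1] ⊗ Δ[1] : SSet.{u}) ⟶ E), s ≫ f ≫ q = fst _ _ ≫ φ →
      IsCartesian (f ≫ q) (sqHor 0 ≫ s) → IsCartesian (f ≫ q) (sqHor 1 ≫ s) →
      IsFibreCartesian f q (sqVer 1 ≫ s) → IsFibreCartesian f q (sqVer 0 ≫ s))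
    (g : (spanned.{u} (2 * (m + 2) + 1) (prismHorn (m + 2)) : SSet) ⟶ E)
    (h : (spanned.{u} (2 * (m + 2) + 1) (prismChains (m + 2)) : SSet) ⟶ D) (θ : Δ[m + 2] ⟶ C)
    (h₁ : g ≫ f = Subcomplex.homOfLE (spanned_mono fun _ hs ↦ hs.1) ≫ h)
    (h₂ : h ≫ q = (spanned.{u} (2 * (m + 2) + 1) (prismChains (m + 2))).ι ≫
      simplexMap (prismCollapse (m + 2)) ≫ θ)
    (hg : SendsMarked (f ≫ q) (PrismMarked (m + 2)) g) (t : Δ[2] ⟶ E)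
    (ht : IsFibreCartesian f q (SSet.stdSimplex.δ 2 ≫ t))
    (hgt : ∀ d (z : (Δ[2] : SSet.{u}) _⦋d⦌)
        (hz' : (simplexMap (prismTriangle (m + 2))).app _ z ∈
          (spanned.{u} (2 * (m + 2) + 1) (prismHorn (m + 2))).obj _),
        g.app _ ⟨_, hz'⟩ = t.app _ z) :
    ∃ l : Δ[m + 2] ⟶ E, l ≫ f = liftSpanned (simplexMap (prismBot (m + 2)))
      (fun _ ↦ prismBot_mem_prismChains) ≫ h ∧
    ∀ d (z : (Δ[m + 2] : SSet.{u}) _⦋d⦌) (hz : (simplexMap (prismBot (m + 2))).app _ z ∈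
      (spanned.{u} (2 * (m + 2) + 1) (prismHorn (m + 2))).obj _), g.app _ ⟨_, hz⟩ = l.app _ z := by
  let s₀ := liftSpanned (prismSquare.{u} (m + 2)) (fun _ ↦ prismSquare_mem (by omega))
  have hgq : g ≫ f ≫ q = (spanned.{u} (2 * (m + 2) + 1) (prismHorn (m + 2))).ι ≫
      simplexMap (prismCollapse (m + 2)) ≫ θ := by
    rw [reassoc_of% h₁, h₂]; rfl
  have hleft : IsFibreCartesian f q (sqVer 0 ≫ s₀ ≫ g) := by
    refine htrans (SSet.yonedaEquiv.symm (stdSimplex.edge _ 0 ⟨m + 2 - 1, by omega⟩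
      (Fin.zero_le _)) ≫ θ) (s₀ ≫ g) ?_ ?_ ?_ ?_
    · rw [Category.assoc, hgq, ← Category.assoc (fst _ _), ← prismSquare_prismCollapse (by omega),
        Category.assoc]
      rfl
    · have e : sqHor 0 ≫ s₀ ≫ g = SSet.yonedaEquiv.symm (g.app _
          ⟨_, prismSquare_mem (by omega) ((sqHor 0).app _ (SSet.yonedaEquiv (𝟙 _)))⟩) :=
        SSet.yonedaEquiv.injective (by rw [Equiv.apply_symm_apply]; rfl)
      rw [e]
      refine hg ((sqHor 0 ≫ prismSquare (m + 2)).app _ (SSet.yonedaEquiv (𝟙 _)))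
        (prismSquare_mem (by omega) _) (Or.inl ⟨?_, ?_, ?_⟩)
      · change 1 ≤ m + 2 - 1 + 0 + (m + 2) * 0
        omega
      · change m + 2 - 1 + 0 + (m + 2) * 0 ≤ m + 2
        omega
      · change m + 2 - 1 + 0 + (m + 2) * 1 = m + 2 + (m + 2 - 1 + 0 + (m + 2) * 0)
        omega
    · have e : sqHor 1 ≫ s₀ ≫ g = SSet.yonedaEquiv.symm (g.app _
          ⟨_, prismSquare_mem (by omega) ((sqHor 1).app _ (SSet.yonedaEquiv (𝟙 _)))⟩) :=
        SSet.yonedaEquiv.injective (by rw [Equiv.apply_symm_apply]; rfl)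
      rw [e]
      refine hg ((sqHor 1 ≫ prismSquare (m + 2)).app _ (SSet.yonedaEquiv (𝟙 _)))
        (prismSquare_mem (by omega) _) (Or.inl ⟨?_, ?_, ?_⟩)
      · change 1 ≤ m + 2 - 1 + 1 + (m + 2) * 0
        omega
      · change m + 2 - 1 + 1 + (m + 2) * 0 ≤ m + 2
        omega
      · change m + 2 - 1 + 1 + (m + 2) * 1 = m + 2 + (m + 2 - 1 + 1 + (m + 2) * 0)
        omega
    · convert ht using 1
      apply SSet.yonedaEquiv.injective
      have hx : (prismSquare (m + 2)).app _ ((sqVer 1).app _ (SSet.yonedaEquiv (𝟙 Δ[1]))) =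
          (simplexMap.{u} (prismTriangle (m + 2))).app _
            (SSet.yonedaEquiv (SSet.stdSimplex.δ (2 : Fin 3))) := by
        apply SSet.stdSimplex.ext
        intro i
        ext
        fin_cases i
        · change m + 2 - 1 + 0 + (m + 2) * 1 = 2 * (m + 2) + 1 - (2 - 0)
          omega
        · change m + 2 - 1 + 1 + (m + 2) * 1 = 2 * (m + 2) + 1 - (2 - 1)
          omega
      have hm := prismSquare_mem.{u} (n := m + 2) (by omega)
        ((sqVer 1).app _ (SSet.yonedaEquiv (𝟙 Δ[1])))
      refine Eq.trans ?_ (hgt _ (SSet.yonedaEquiv (SSet.stdSimplex.δ (2 : Fin 3))) (hx ▸ hm))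
      exact congr_arg (g.app _) (Subtype.ext hx)
  let σ : (Λ[m + 2, Fin.last (m + 2)] : SSet.{u}) ⟶
      (spanned.{u} (2 * (m + 2) + 1) (prismHorn (m + 2)) : SSet) :=
    liftSpanned (Λ[m + 2, Fin.last (m + 2)].ι ≫ simplexMap (prismBot (m + 2)))
      (fun _ z ↦ prismBot_mem_prismHorn z.2)
  obtain ⟨l, h3, h4⟩ := hleft m (σ ≫ g) (by
      rw [← Category.assoc, ← Category.assoc]
      congr 1
      apply prismHorn_hom_ext
      apply SSet.yonedaEquiv.injective
      apply SSet.stdSimplex.ext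
      intro i
      ext
      refine (lastEdge_apply.{u} m i).trans ?_
      fin_cases i
      · change m + 1 + 0 = m + 2 - 1 + 0 + (m + 2) * 0
        omega
      · change m + 1 + 1 = m + 2 - 1 + 1 + (m + 2) * 0
        omega)
    (liftSpanned (simplexMap (prismBot (m + 2))) (fun _ ↦ prismBot_mem_prismChains) ≫ h)
    (by rw [Category.assoc, h₁]; rfl)
    ⟨θ.app _ (stdSimplex.obj₀Equiv.symm 0), by
      rw [Category.assoc, h₂, ← Category.assoc (Subcomplex.ι _), ← Category.assoc]
      have : liftSpanned (simplexMap (prismBot (m + 2))) (fun _ ↦ prismBot_mem_prismChains) ≫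
        (spanned.{u} (2 * (m + 2) + 1) (prismChains (m + 2))).ι ≫
          simplexMap (prismCollapse (m + 2)) = SSet.const (stdSimplex.obj₀Equiv.symm 0) :=
        prismBot_prismCollapse (m + 2)
      rw [this, SSet.const_comp]⟩
  refine ⟨l, h4, fun d z hz ↦ ?_⟩
  exact (ConcreteCategory.congr_hom (NatTrans.congr_app h3 _)
    ⟨z, mem_horn_of_prismBot (by omega) hz⟩).symm

lemma lastEdgeι_zero : lastEdgeι.{u} 0 = horn₂₂.ι₁₂ := by
  rw [← cancel_mono Λ[2, 2].ι, horn.ι_ι]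
  apply SSet.yonedaEquiv.injective
  apply SSet.stdSimplex.ext
  intro i
  fin_cases i <;> rfl

lemma lastTriangle_eq (m : ℕ) : lastTriangle.{u} (m + 2) =
    SSet.stdSimplex.σ 0 ≫ lastEdgeι m ≫ Λ[m + 2, Fin.last (m + 2)].ι := by
  apply SSet.yonedaEquiv.injective
  apply SSet.stdSimplex.ext
  intro i
  refine Fin.ext ?_
  change (prismCollapse (m + 2) (prismTriangle (m + 2) i) : ℕ) =
    ((lastEdge.{u} m).1 ((0 : Fin 2).predAbove i) : ℕ)
  rw [prismCollapse_val, prismTriangle_val, lastEdge_apply]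
  fin_cases i
  · change _ = m + 1 + 0
    simp
    split_ifs <;> omega
  · change _ = m + 1 + 0
    simp
    omega
  · change _ = m + 1 + 1
    simp
    split_ifs <;> omega

lemma δ_two_comp_σ_zero : SSet.stdSimplex.δ (2 : Fin 3) ≫ SSet.stdSimplex.σ (0 : Fin 2) =
    (SSet.const (stdSimplex.obj₀Equiv.symm 0) : Δ[1] ⟶ (Δ[1] : SSet.{u})) := by
  apply SSet.yonedaEquiv.injective
  apply SSet.stdSimplex.ext
  intro i
  fin_cases i <;> rfl

/-- Factorization of an edge through a Cartesian edge with the same target. -/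
lemma IsCartesian.exists_triangle {X S : SSet.{u}} {p : X ⟶ S} {e : Δ[1] ⟶ X}
    (he : IsCartesian p e) (v : Δ[1] ⟶ X) (w : Δ[2] ⟶ S)
    (h : SSet.stdSimplex.δ 0 ≫ v = SSet.stdSimplex.δ 0 ≫ e)
    (h₁ : SSet.stdSimplex.δ 1 ≫ w = v ≫ p) (h₀ : SSet.stdSimplex.δ 0 ≫ w = e ≫ p) :
    ∃ t : Δ[2] ⟶ X, SSet.stdSimplex.δ 1 ≫ t = v ∧ SSet.stdSimplex.δ 0 ≫ t = e ∧ t ≫ p = w := by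
  have H : LiftsAt Λ[2, 2].ι p (horn₂₂.isPushout.desc v e h) := he 0 _ (by
    rw [lastEdgeι_zero]; exact horn₂₂.isPushout.inr_desc _ _ _)
  obtain ⟨t, h2, h3⟩ := H w (by
    apply horn₂₂.isPushout.hom_ext
    · rw [horn₂₂.isPushout.inl_desc_assoc, horn.ι_ι_assoc, h₁]
    · rw [horn₂₂.isPushout.inr_desc_assoc, horn.ι_ι_assoc, h₀])
  refine ⟨t, ?_, ?_, h3⟩
  · have := horn₂₂.ι₀₂ ≫= h2
    rwa [horn₂₂.isPushout.inl_desc, horn.ι_ι_assoc] at this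
  · have := horn₂₂.ι₁₂ ≫= h2
    rwa [horn₂₂.isPushout.inr_desc, horn.ι_ι_assoc] at this

/-- A functor over `C` between Cartesian fibrations which preserves Cartesian edges has Cartesian
lifts, provided that it has them fibrewise and that the transition functors preserve them. -/
theorem hasCartesianLifts_of_fibrewise (hf : InnerFibration f) (hq : InnerFibration q)
    (hp : InnerFibration (f ≫ q)) (hp' : HasCartesianLifts (f ≫ q)) (hq' : HasCartesianLifts q)
    (hfc : ∀ e : Δ[1] ⟶ E, IsCartesian (f ≫ q) e → IsCartesian q (e ≫ f))
    (hlift : ∀ (y : Δ[0] ⟶ E) (v : Δ[1] ⟶ D), SSet.stdSimplex.δ 0 ≫ v = y ≫ f →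
      (∃ c : C _⦋0⦌, v ≫ q = SSet.const c) →
      ∃ e : Δ[1] ⟶ E, SSet.stdSimplex.δ 0 ≫ e = y ∧ e ≫ f = v ∧ IsFibreCartesian f q e)
    (htrans : ∀ (φ : Δ[1] ⟶ C) (s : (Δ[1] ⊗ Δ[1] : SSet.{u}) ⟶ E), s ≫ f ≫ q = fst _ _ ≫ φ →
      IsCartesian (f ≫ q) (sqHor 0 ≫ s) → IsCartesian (f ≫ q) (sqHor 1 ≫ s) →
      IsFibreCartesian f q (sqVer 1 ≫ s) → IsFibreCartesian f q (sqVer 0 ≫ s)) :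
    HasCartesianLifts f := by
  intro y v hv
  -- the required lift of `v` is the composite of the lift `β` of an edge in a fibre with `α`
  obtain ⟨α, hα1, hα2, hα3⟩ := hp' y (v ≫ q) (by rw [reassoc_of% hv])
  -- compare `v` with the Cartesian edge `α ≫ f` by a triangle over a degenerate one
  obtain ⟨w, hw3, hw4, hw2⟩ := (hfc α hα3).exists_triangle v (SSet.stdSimplex.σ 0 ≫ v ≫ q)
    (by rw [hv, reassoc_of% hα1])
    (SSet.stdSimplex.δ_comp_σ_succ_assoc (i := 0) (v ≫ q))
    (by
      rw [Category.assoc, hα2]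
      exact SSet.stdSimplex.δ_comp_σ_self_assoc (i := 0) (v ≫ q))
  obtain ⟨β, hβ1, hβ2, hβ3⟩ := hlift (SSet.stdSimplex.δ 1 ≫ α) (SSet.stdSimplex.δ 2 ≫ w)
    (by
      rw [Category.assoc, ← hw4]
      exact SSet.stdSimplex.δ_comp_δ_assoc (i := (0 : Fin 2)) (j := 1) (by decide) w)
    ⟨(v ≫ q).app _ (stdSimplex.obj₀Equiv.symm 0), by
      rw [Category.assoc, hw2, ← Category.assoc, δ_two_comp_σ_zero, SSet.const_comp]⟩
  have := hf.mem _ (horn_ι_mem_innerHornInclusions.{u} (i := (1 : Fin 3)) (by decide) (by decide))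
  have sq : CommSq (horn₂₁.isPushout.desc β α hβ1) Λ[2, 1].ι f w := ⟨by
    apply horn₂₁.isPushout.hom_ext
    · rw [horn₂₁.isPushout.inl_desc_assoc, horn.ι_ι_assoc, hβ2]
    · rw [horn₂₁.isPushout.inr_desc_assoc, horn.ι_ι_assoc, hw4]⟩
  obtain ⟨t, ht⟩ : ∃ t, t = sq.lift := ⟨_, rfl⟩
  have ht1 : t ≫ f = w := ht ▸ sq.fac_right
  have ht2 : SSet.stdSimplex.δ 2 ≫ t = β := by
    have := horn₂₁.ι₀₁ ≫= sq.fac_left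
    rwa [horn₂₁.isPushout.inl_desc, horn.ι_ι_assoc, ← ht] at this
  have ht3 : SSet.stdSimplex.δ 0 ≫ t = α := by
    have := horn₂₁.ι₁₂ ≫= sq.fac_left
    rwa [horn₂₁.isPushout.inr_desc, horn.ι_ι_assoc, ← ht] at this
  refine ⟨SSet.stdSimplex.δ 1 ≫ t, ?_, by rw [Category.assoc, ht1, hw3], ?_⟩
  · rw [← hα1, ← ht3]
    exact (SSet.stdSimplex.δ_comp_δ_assoc (i := (0 : Fin 2)) (j := 0) le_rfl t)
  intro m σ hσ τ hτ
  -- pull the horn back along Cartesian edges to the fibre over its initial vertex, in `E`,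
  obtain ⟨g, hg1, hg2, hg3, hg4⟩ := exists_extension_prismHorn hp hp' σ t (τ ≫ q) hσ
    (by rw [reassoc_of% hτ])
    (by
      rw [reassoc_of% ht1, hw2, lastTriangle_eq, Category.assoc, Category.assoc,
        ← reassoc_of% hτ, reassoc_of% hσ, reassoc_of% ht1, reassoc_of% hw3])
    (by rwa [ht3])
  -- and the simplex `τ`, compatibly, in `D`
  obtain ⟨h, hh1, hh2, hh3⟩ := exists_extension_prismChains (by omega) hq hq' (g ≫ f) τ
    (by rw [Category.assoc, hg1])
    (by
      intro x hx hM
      have := hfc _ (hg2 x hx hM)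
      rwa [yonedaEquiv_symm_comp] at this)
    (by
      intro d z hz
      have hz' := mem_horn_of_prismTop (by omega) hz
      refine (congr_arg (f.app _) (hg3 d z hz' hz)).trans ?_
      exact ConcreteCategory.congr_hom (NatTrans.congr_app hτ _) ⟨z, hz'⟩)
  -- fill the horn in the fibre, where its last edge is Cartesian by `htrans`
  obtain ⟨l, hl1, hl2⟩ := exists_lift_prismBot htrans g h (τ ≫ q) hh1.symm hh2 hg2 t
    (by rwa [ht2]) hg4
  -- and transport the filler back to the original horn
  obtain ⟨G, hG1, hG2⟩ := exists_lift_prismChains (by omega) hf g h hh1.symm l hl1 hl2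
  refine ⟨liftSpanned (simplexMap (prismTop (m + 2)))
    (fun _ ↦ prismTop_mem_prismChains (by omega)) ≫ G, ?_, ?_⟩
  · apply hom_ext_horn
    intro d z hz
    have hz' := mem_spanned_prismTop (by omega) hz
    have hz'' := spanned_mono (fun s hs ↦ ⟨hs.1.1, hs.1.2.2.1⟩ : _ ⊆ prismHorn (m + 2)) _ hz'
    rw [← hg3 d z hz hz'', ← hG1]
    rfl
  · rw [Category.assoc, hG2]
    apply SSet.yonedaEquiv.injective
    exact hh3 _ (SSet.yonedaEquiv (𝟙 _))

end

section

/-! ### The isofibration associated with a functor over a base -/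

open PathSpace

/-- A square is a pullback if it has the universal property of one, with unbundled cones. -/
lemma isPullback_of_exists_lift {P X Y Z : SSet.{u}} {fst : P ⟶ X} {snd : P ⟶ Y} {f : X ⟶ Z}
    {g : Y ⟶ Z} (w : fst ≫ f = snd ≫ g)
    (H : ∀ {A : SSet.{u}} (a : A ⟶ X) (b : A ⟶ Y), a ≫ f = b ≫ g →
      ∃ l : A ⟶ P, l ≫ fst = a ∧ l ≫ snd = b)
    (H' : ∀ {A : SSet.{u}} {l l' : A ⟶ P}, l ≫ fst = l' ≫ fst → l ≫ snd = l' ≫ snd → l = l') :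
    IsPullback fst snd f g :=
  ⟨⟨w⟩, ⟨PullbackCone.IsLimit.mk w (fun s ↦ (H s.fst s.snd s.condition).choose)
    (fun s ↦ (H s.fst s.snd s.condition).choose_spec.1)
    (fun s ↦ (H s.fst s.snd s.condition).choose_spec.2) (fun s _ h h' ↦ H'
      (h.trans (H s.fst s.snd s.condition).choose_spec.1.symm)
      (h'.trans (H s.fst s.snd s.condition).choose_spec.2.symm))⟩⟩

lemma IsTrivialFibration.id (X : SSet.{u}) : IsTrivialFibration (𝟙 X) :=
  fun _ _ _ _ ↦ inferInstance

variable {X Y S : SSet.{u}} {p : X ⟶ S} {q : Y ⟶ S} (f : X ⟶ Y) (w : f ≫ q = p)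

/-- The functor between isofibrant replacements, on the level of path spaces. -/
def replMap : (ofRepl p).pt ⟶ (ofRepl q).pt := Repl.map f w

lemma replMap_src : replMap f w ≫ (ofRepl q).src = (ofRepl p).src ≫ f :=
  pullback.lift_fst _ _ _

lemma replMap_path : coherentIso ◁ replMap f w ≫ (ofRepl q).path = (ofRepl p).path := by
  refine (MonoidalClosed.uncurry_natural_left (Repl.map f w) (Repl.equiv q)).symm.trans ?_
  exact congr_arg MonoidalClosed.uncurry (pullback.lift_snd _ _ _)

lemma replMap_tgt : replMap f w ≫ (ofRepl q).tgt = (ofRepl p).tgt := by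
  rw [← end₁_path, ← end₁_path, ← replMap_path f w, reassoc_of% end₁_whiskerLeft]

lemma incl_replMap : (ofRepl p).incl ≫ replMap f w = f ≫ (ofRepl q).incl := by
  apply (ofRepl q).hom_ext
  · rw [Category.assoc, replMap_src, reassoc_of% incl_src, Category.assoc, incl_src,
      Category.comp_id]
  · rw [whiskerLeft_comp_assoc, replMap_path, incl_path, whiskerLeft_comp_assoc, incl_path,
      whiskerLeft_snd_assoc, w]

/-- The isofibration over the replacement of `q` which is associated with `f`: its total space
consists of the points of the replacement of `p` with an equivalence out of their image, which is
constant over the base. -/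
abbrev relRepl : PathSpace (replMap f w) (ofRepl q).tgt := rel _ _

lemma relRepl_tgt_comp : (relRepl f w).tgt ≫ (ofRepl q).tgt =
    (relRepl f w).src ≫ (ofRepl p).tgt := by
  rw [tgt_comp, replMap_tgt]

instance quasicategory_ofRepl [Quasicategory X] [Quasicategory S] :
    Quasicategory (ofRepl p).pt :=
  (ofRepl p).quasicategory_pt (isIsofibration_terminal_from S)

section

variable [Quasicategory Y] [Quasicategory S]

lemma isTrivialFibration_relRepl_src : IsTrivialFibration (relRepl f w).src :=
  (relRepl f w).isTrivialFibration_src (ofRepl_isIsofibration_tgt q)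

variable [Quasicategory X]

instance quasicategory_relRepl : Quasicategory (relRepl f w).pt :=
  (relRepl f w).quasicategory_pt (ofRepl_isIsofibration_tgt q)

lemma isIsofibration_relRepl_tgt : IsIsofibration (relRepl f w).tgt := by
  apply (relRepl f w).isIsofibration_tgt (ofRepl_isIsofibration_tgt q)
  rw [replMap_tgt]
  exact ofRepl_isIsofibration_tgt p

lemma equivalentFunctors_relRepl_tgt : EquivalentFunctors f (relRepl f w).tgt := by
  refine ⟨(ofRepl p).incl ≫ (relRepl f w).incl, (ofRepl q).incl, ?_, ?_, ?_⟩
  · exact ((ofRepl p).isCategoricalEquivalence_incl (isIsofibration_terminal_from S)).comp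
      ((relRepl f w).isCategoricalEquivalence_incl (ofRepl_isIsofibration_tgt q))
  · exact (ofRepl q).isCategoricalEquivalence_incl (isIsofibration_terminal_from S)
  · rw [Category.assoc, incl_tgt, incl_replMap]

end

lemma isCartesianEdge_iff {e : Δ[1] ⟶ X} : IsCartesianEdge p (SSet.yonedaEquiv e) ↔
    IsCartesian (ofRepl p).tgt (e ≫ (ofRepl p).incl) := by
  rw [ofRepl_tgt, ofRepl_incl]
  exact isCartesianLift_yonedaEquiv (p := Repl.proj p) (e := e ≫ Repl.incl p)

/-- Whether an edge of the replacement is Cartesian depends only on the underlying edge. -/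
lemma isCartesian_ofRepl_iff [Quasicategory X] [Quasicategory S] {e : Δ[1] ⟶ (ofRepl p).pt} :
    IsCartesian (ofRepl p).tgt e ↔ IsCartesianEdge p (SSet.yonedaEquiv (e ≫ (ofRepl p).src)) := by
  obtain ⟨k, h0, h1, -⟩ := (ofRepl p).exists_homotopy_incl (isIsofibration_terminal_from S)
  have h2 : end₀ _ ≫ coherentIso ◁ e ≫ k = e := by
    rw [reassoc_of% end₀_whiskerLeft, h0, Category.comp_id]
  have h3 : end₁ _ ≫ coherentIso ◁ e ≫ k = (e ≫ (ofRepl p).src) ≫ (ofRepl p).incl := by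
    rw [reassoc_of% end₁_whiskerLeft, h1, Category.assoc]
  rw [isCartesianEdge_iff, ← h3]
  constructor
  · intro h
    exact IsCartesian.of_homotopy (ofRepl_isIsofibration_tgt p) (by rwa [h2])
  · intro h
    rw [← h2]
    exact IsCartesian.of_homotopy' (ofRepl_isIsofibration_tgt p) h

/-! ### Fibres -/

/-- The inclusion of the fibre, on the level of path spaces. -/
def fibreι (p : X ⟶ S) (c : S _⦋0⦌) : Fibre p c ⟶ (ofRepl p).pt := Fibre.ι p c

lemma isPullback_fibreι (p : X ⟶ S) (c : S _⦋0⦌) :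
    IsPullback (fibreι p c) (SSet.const (stdSimplex.obj₀Equiv.symm 0)) (ofRepl p).tgt
      (SSet.const c : Δ[0] ⟶ S) := by
  rw [ofRepl_tgt]
  have h : (SSet.const (stdSimplex.obj₀Equiv.symm 0) : Fibre p c ⟶ Δ[0]) =
      pullback.snd (Repl.proj p) (SSet.const c : Δ[0] ⟶ S) :=
    stdSimplex.isTerminalObj₀.hom_ext _ _
  rw [h]
  exact IsPullback.of_hasPullback (Repl.proj p) (SSet.const c : Δ[0] ⟶ S)

lemma fibreι_tgt (p : X ⟶ S) (c : S _⦋0⦌) :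
    fibreι p c ≫ (ofRepl p).tgt = SSet.const c := by
  rw [(isPullback_fibreι p c).w, SSet.comp_const]

instance (p : X ⟶ S) (c : S _⦋0⦌) : Mono (fibreι p c) := by
  refine ⟨fun a b h ↦ (isPullback_fibreι p c).hom_ext h ?_⟩
  exact stdSimplex.isTerminalObj₀.hom_ext _ _

lemma exists_comp_fibreι {A : SSet.{u}} {c : S _⦋0⦌} (a : A ⟶ (ofRepl p).pt)
    (h : a ≫ (ofRepl p).tgt = SSet.const c) : ∃ a', a' ≫ fibreι p c = a :=
  ⟨(isPullback_fibreι p c).lift a (SSet.const (stdSimplex.obj₀Equiv.symm 0))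
    (by rw [h, SSet.comp_const]), (isPullback_fibreι p c).lift_fst _ _ _⟩

lemma fibreMap_ι (c : S _⦋0⦌) : Fibre.map f w c ≫ fibreι q c = fibreι p c ≫ replMap f w :=
  pullback.lift_fst _ _ _

instance quasicategory_point : Quasicategory (Δ[0] : SSet.{u}) := by
  have : IsIso (terminal.from (Δ[0] : SSet.{u})) :=
    isIso_of_isTerminal stdSimplex.isTerminalObj₀.{u} terminalIsTerminal _
  rw [quasicategory_iff_innerFibration, innerFibration_iff]
  exact MorphismProperty.of_isIso _ _

instance quasicategory_fibre [Quasicategory X] [Quasicategory S] (p : X ⟶ S) (c : S _⦋0⦌) :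
    Quasicategory (Fibre p c) :=
  ((ofRepl_isIsofibration_tgt p).of_isPullback (isPullback_fibreι p c)).quasicategory

/-- The fibre of the associated isofibration is the replacement of the functor on fibres. -/
lemma exists_isPullback_relRepl (c : S _⦋0⦌) :
    ∃ κ : (ofRepl (Fibre.map f w c)).pt ⟶ (relRepl f w).pt,
      IsPullback κ (ofRepl (Fibre.map f w c)).tgt (relRepl f w).tgt (fibreι q c) ∧
      κ ≫ (relRepl f w).src = (ofRepl (Fibre.map f w c)).src ≫ fibreι p c := by
  obtain ⟨κ, h1, h2⟩ := (relRepl f w).exists_lift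
    ((ofRepl (Fibre.map f w c)).src ≫ fibreι p c) ((ofRepl (Fibre.map f w c)).path ≫ fibreι q c)
    (by rw [reassoc_of% end₀_path, fibreMap_ι, Category.assoc])
    (by simp only [Category.assoc, replMap_tgt, fibreι_tgt, SSet.comp_const])
  have hw : κ ≫ (relRepl f w).tgt = (ofRepl (Fibre.map f w c)).tgt ≫ fibreι q c := by
    rw [← (relRepl f w).end₁_path, ← (ofRepl (Fibre.map f w c)).end₁_path,
      ← reassoc_of% end₁_whiskerLeft, h2, Category.assoc]
  refine ⟨κ, isPullback_of_exists_lift hw ?_ ?_, h1⟩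
  · intro A a b hab
    have h3 : a ≫ (relRepl f w).src ≫ (ofRepl p).tgt = SSet.const c := by
      rw [← relRepl_tgt_comp, reassoc_of% hab, fibreι_tgt, SSet.comp_const]
    obtain ⟨x, hx⟩ := exists_comp_fibreι (a ≫ (relRepl f w).src) (by rwa [Category.assoc])
    obtain ⟨h, hh⟩ := exists_comp_fibreι (c := c) (coherentIso ◁ a ≫ (relRepl f w).path) (by
      rw [Category.assoc, path_comp, whiskerLeft_snd_assoc, replMap_tgt, h3, SSet.comp_const])
    obtain ⟨l, h4, h5⟩ := (ofRepl (Fibre.map f w c)).exists_lift x h (by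
      rw [← cancel_mono (fibreι q c), Category.assoc, hh, Category.assoc, fibreMap_ι,
        reassoc_of% hx, reassoc_of% end₀_whiskerLeft, end₀_path]) (Subsingleton.elim _ _)
    have h6 : l ≫ κ = a := by
      apply (relRepl f w).hom_ext
      · rw [Category.assoc, h1, reassoc_of% h4, hx]
      · rw [whiskerLeft_comp_assoc, h2, reassoc_of% h5, hh]
    refine ⟨l, h6, ?_⟩
    rw [← cancel_mono (fibreι q c), ← hab, ← h6, Category.assoc, Category.assoc, hw]
  · intro A l l' h3 h4
    apply (ofRepl (Fibre.map f w c)).hom_ext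
    · have := h3 =≫ (relRepl f w).src
      rw [Category.assoc, Category.assoc, h1] at this
      rwa [← cancel_mono (fibreι p c), Category.assoc, Category.assoc]
    · have := congr_arg (fun a ↦ coherentIso ◁ a ≫ (relRepl f w).path) h3
      rw [whiskerLeft_comp_assoc, whiskerLeft_comp_assoc, h2] at this
      rwa [← cancel_mono (fibreι q c), Category.assoc, Category.assoc]

end

section

/-! ### Cartesian fibrations -/

open PathSpace

variable {X Y S : SSet.{u}} {p : X ⟶ S} {q : Y ⟶ S} (f : X ⟶ Y) (w : f ≫ q = p)

lemma const_injective {A S : SSet.{u}} (a : A _⦋0⦌) {c c' : S _⦋0⦌}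
    (h : (SSet.const c : A ⟶ S) = SSet.const c') : c = c' := by
  have := ConcreteCategory.congr_hom (NatTrans.congr_app h (Opposite.op ⦋0⦌)) a
  have e (c : S _⦋0⦌) : (SSet.const c : A ⟶ S).app _ a = c := by
    have h' := congr_arg SSet.yonedaEquiv (SSet.comp_const (SSet.yonedaEquiv.symm a) c)
    rwa [SSet.yonedaEquiv_const, yonedaEquiv_symm_comp, Equiv.apply_symm_apply] at h'
  rwa [e, e] at this

/-- Fibrewise Cartesian edges of the associated isofibration are the Cartesian edges of the
functor on fibres. -/
lemma isFibreCartesian_iff {c : S _⦋0⦌} {κ : (ofRepl (Fibre.map f w c)).pt ⟶ (relRepl f w).pt}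
    (hκ : IsPullback κ (ofRepl (Fibre.map f w c)).tgt (relRepl f w).tgt (fibreι q c))
    {e : Δ[1] ⟶ (ofRepl (Fibre.map f w c)).pt} :
    IsFibreCartesian (relRepl f w).tgt (ofRepl q).tgt (e ≫ κ) ↔
      IsCartesian (ofRepl (Fibre.map f w c)).tgt e := by
  constructor
  · intro h n σ hσ τ hτ
    obtain ⟨l, h1, h2⟩ := h n (σ ≫ κ) (by rw [reassoc_of% hσ]) (τ ≫ fibreι q c)
      (by rw [Category.assoc, hκ.w, reassoc_of% hτ])
      ⟨c, by rw [Category.assoc, fibreι_tgt, SSet.comp_const]⟩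
    refine ⟨hκ.lift l τ h2, hκ.hom_ext ?_ ?_, hκ.lift_snd _ _ _⟩
    · rw [Category.assoc, hκ.lift_fst, h1]
    · rw [Category.assoc, hκ.lift_snd, hτ]
  · rintro h n σ hσ τ hτ ⟨c', hc'⟩
    have hc : c' = c := by
      have h1 : e ≫ κ ≫ (relRepl f w).tgt ≫ (ofRepl q).tgt = SSet.const c := by
        rw [hκ.w_assoc, fibreι_tgt, SSet.comp_const, SSet.comp_const]
      rw [← Category.assoc, ← hσ, Category.assoc, reassoc_of% hτ, hc', SSet.comp_const,
        SSet.comp_const] at h1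
      exact const_injective (stdSimplex.obj₀Equiv.symm 0) h1
    subst hc
    obtain ⟨τ, rfl⟩ := exists_comp_fibreι τ hc'
    obtain ⟨σ', rfl, hσ'⟩ : ∃ σ', σ' ≫ κ = σ ∧ σ' ≫ (ofRepl (Fibre.map f w c')).tgt =
        Λ[n + 2, Fin.last (n + 2)].ι ≫ τ :=
      ⟨hκ.lift σ (Λ[n + 2, Fin.last (n + 2)].ι ≫ τ) (by rw [Category.assoc]; exact hτ),
        hκ.lift_fst _ _ _, hκ.lift_snd _ _ _⟩
    have hσ'' : lastEdgeι n ≫ σ' = e := by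
      rw [← Category.assoc] at hσ
      apply hκ.hom_ext hσ
      rw [← cancel_mono (fibreι q c'), Category.assoc, Category.assoc, ← hκ.w,
        reassoc_of% hσ, hκ.w]
      rfl
    obtain ⟨l, h1, h2⟩ := h n _ hσ'' τ hσ'
    refine ⟨l ≫ κ, by rw [reassoc_of% h1], ?_⟩
    rw [Category.assoc, hκ.w, reassoc_of% h2]

variable [Quasicategory X] [Quasicategory Y] [Quasicategory S]

/-- Cartesian edges of the total space of the associated isofibration. -/
lemma isCartesianEdge_of_relRepl {e : Δ[1] ⟶ (relRepl f w).pt}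
    (he : IsCartesian ((relRepl f w).tgt ≫ (ofRepl q).tgt) e) :
    IsCartesianEdge p (SSet.yonedaEquiv (e ≫ (relRepl f w).src ≫ (ofRepl p).src)) := by
  rw [← Category.assoc, ← isCartesian_ofRepl_iff]
  exact he.descend (isTrivialFibration_relRepl_src f w) (.id _)
    (by rw [relRepl_tgt_comp, Category.comp_id])

/-- The strict criterion `hasCartesianLifts_of_fibrewise` applies to the isofibration associated
with `f`, whose fibres over `S` are the replacements of the functors on fibres. -/
theorem isCartesianFibration_of_fibrewise
    (hp : IsCartesianFibration p) (hq : IsCartesianFibration q)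
    (hf : ∀ e : X _⦋1⦌, IsCartesianEdge p e → IsCartesianEdge q (f.app _ e))
    (hfib : ∀ c : S _⦋0⦌, IsCartesianFibration (Fibre.map f w c))
    (htrans : TransitionPreservesCartesian f w) : IsCartesianFibration f := by
  refine ⟨_, _, (relRepl f w).tgt, inferInstance, inferInstance,
    isCartesianInnerFibration_iff.2 ⟨(isIsofibration_relRepl_tgt f w).1, ?_⟩,
    equivalentFunctors_relRepl_tgt f w⟩
  have hpr : IsIsofibration ((relRepl f w).tgt ≫ (ofRepl q).tgt) :=
    (isIsofibration_relRepl_tgt f w).comp (ofRepl_isIsofibration_tgt q)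
  have hfibre {A : SSet.{u}} {c : S _⦋0⦌} (a : A ⟶ (relRepl f w).pt)
      {κ : (ofRepl (Fibre.map f w c)).pt ⟶ (relRepl f w).pt}
      (hκ : IsPullback κ (ofRepl (Fibre.map f w c)).tgt (relRepl f w).tgt (fibreι q c))
      (h : a ≫ (relRepl f w).tgt ≫ (ofRepl q).tgt = SSet.const c) : ∃ a', a' ≫ κ = a := by
    obtain ⟨b, hb⟩ := exists_comp_fibreι (a ≫ (relRepl f w).tgt) (by rwa [Category.assoc])
    exact ⟨hκ.lift a b hb.symm, hκ.lift_fst _ _ _⟩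
  refine hasCartesianLifts_of_fibrewise (isIsofibration_relRepl_tgt f w).1
    (ofRepl_isIsofibration_tgt q).1 hpr.1 ?_ hq.hasCartesianLifts ?_ ?_ ?_
  · rw [relRepl_tgt_comp]
    exact hp.hasCartesianLifts.trivial_comp (isTrivialFibration_relRepl_src f w)
  · intro e he
    have h1 := hf _ (isCartesianEdge_of_relRepl f w he)
    have h2 : f.app _ (SSet.yonedaEquiv (e ≫ (relRepl f w).src ≫ (ofRepl p).src)) =
        SSet.yonedaEquiv ((e ≫ (relRepl f w).src ≫ replMap f w) ≫ (ofRepl q).src) := by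
      rw [Category.assoc, Category.assoc, replMap_src]
      rfl
    rw [h2, ← isCartesian_ofRepl_iff] at h1
    have h3 : end₁ _ ≫ coherentIso ◁ e ≫ (relRepl f w).path = e ≫ (relRepl f w).tgt := by
      rw [reassoc_of% end₁_whiskerLeft, end₁_path]
    rw [← h3]
    apply IsCartesian.of_homotopy (ofRepl_isIsofibration_tgt q)
    rwa [reassoc_of% end₀_whiskerLeft, end₀_path]
  · rintro y v hv ⟨c, hc⟩
    obtain ⟨κ, hκ, -⟩ := exists_isPullback_relRepl f w c
    obtain ⟨y, rfl⟩ := hfibre y hκ (by rw [← reassoc_of% hv, hc, SSet.comp_const])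
    obtain ⟨v, rfl⟩ := exists_comp_fibreι v hc
    obtain ⟨e, h1, h2, h3⟩ := (hfib c).hasCartesianLifts y v (by
      rw [← cancel_mono (fibreι q c), Category.assoc, hv, Category.assoc, Category.assoc, hκ.w])
    refine ⟨e ≫ κ, by rw [reassoc_of% h1], ?_, (isFibreCartesian_iff f w hκ).2 h3⟩
    rw [Category.assoc, hκ.w, reassoc_of% h2]
  · intro φ s hs hs0 hs1 hr
    have hside (j : Fin 2) : (sqVer j ≫ s) ≫ (relRepl f w).tgt ≫ (ofRepl q).tgt =
        SSet.const (φ.app _ (stdSimplex.obj₀Equiv.symm j)) := by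
      rw [Category.assoc, hs, sqVer, lift_fst_assoc, SSet.const_comp]
    obtain ⟨κ₀, hκ₀, hκ₀'⟩ := exists_isPullback_relRepl f w
      (φ.app _ (stdSimplex.obj₀Equiv.symm 0))
    obtain ⟨κ₁, hκ₁, hκ₁'⟩ := exists_isPullback_relRepl f w
      (φ.app _ (stdSimplex.obj₀Equiv.symm 1))
    obtain ⟨β, hβ⟩ := hfibre (sqVer 0 ≫ s) hκ₀ (hside 0)
    obtain ⟨γ, hγ⟩ := hfibre (sqVer 1 ≫ s) hκ₁ (hside 1)
    rw [← hγ, isFibreCartesian_iff f w hκ₁, isCartesian_ofRepl_iff] at hr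
    rw [← hβ, isFibreCartesian_iff f w hκ₀, isCartesian_ofRepl_iff]
    refine htrans _ _ (SSet.Edge.mk (SSet.yonedaEquiv φ) ?_ ?_) (s ≫ (relRepl f w).src) _ _
      ?_ ?_ ?_ ?_ ?_ hr
    · rw [← SSet.stdSimplex.yonedaEquiv_δ_comp, stdSimplex.δ_one_eq_const, SSet.const_comp,
        SSet.yonedaEquiv_const]
    · rw [← SSet.stdSimplex.yonedaEquiv_δ_comp, stdSimplex.δ_zero_eq_const, SSet.const_comp,
        SSet.yonedaEquiv_const]
    · have : (s ≫ (relRepl f w).src) ≫ (ofRepl p).tgt = fst _ _ ≫ φ := by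
        rw [Category.assoc, ← relRepl_tgt_comp, hs]
      exact this.trans (congr_arg (fst Δ[1] Δ[1] ≫ ·) (Equiv.symm_apply_apply _ φ).symm)
    · have : β ≫ (ofRepl (Fibre.map f w _)).src ≫ fibreι p _ =
        sqVer 0 ≫ s ≫ (relRepl f w).src := by
        rw [← hκ₀', reassoc_of% hβ]
      exact congr_arg SSet.yonedaEquiv this
    · have : γ ≫ (ofRepl (Fibre.map f w _)).src ≫ fibreι p _ =
        sqVer 1 ≫ s ≫ (relRepl f w).src := by
        rw [← hκ₁', reassoc_of% hγ]
      exact congr_arg SSet.yonedaEquiv this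
    · have := isCartesianEdge_of_relRepl f w hs0
      rw [Category.assoc] at this
      exact this
    · have := isCartesianEdge_of_relRepl f w hs1
      rw [Category.assoc] at this
      exact this

end

section

/-! ### Right fibrations -/

open PathSpace

/-- The class of strict right fibrations. -/
def rightFibrations : MorphismProperty SSet.{u} := fun _ _ p ↦ IsStrictRightFibration p

/-- Passing to opposites reverses the index of a face. -/
lemma index_op {X : SSet.{u}} {x y : X.S} (h : x.IsUniquelyCodimOneFace y) {d : ℕ}
    (hd : x.dim = d) : h.op.index hd = (h.index hd).rev := by
  obtain ⟨dx, x, rfl⟩ := x.mk_surjective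
  obtain ⟨dy, y, rfl⟩ := y.mk_surjective
  obtain rfl : dy = dx + 1 := h.dim_eq
  obtain rfl : dx = d := hd
  refine ((h.op.δ_eq_iff rfl _).1 ?_).symm
  have h' : X.op.δ (h.index rfl).rev (opObjEquiv.symm y) = opObjEquiv.symm x := by
    rw [op_δ, Fin.rev_rev, Equiv.apply_symm_apply]
    exact congr_arg _ (h.δ_index rfl)
  exact h'

lemma index_op_ne_zero {X : SSet.{u}} {A : X.Subcomplex} (P : A.Pairing) [P.IsProper]
    (hP : ∀ (x : P.II) {d : ℕ} (hd : x.1.dim = d),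
      (P.isUniquelyCodimOneFace x).index hd ≠ Fin.last _) (x : P.op.II) {d : ℕ}
    (hd : x.1.dim = d) : (P.op.isUniquelyCodimOneFace x).index hd ≠ 0 := by
  intro h
  have h' := index_op (P.isUniquelyCodimOneFace ⟨_, x.2⟩) hd
  refine hP ⟨_, x.2⟩ hd ?_
  rw [← Fin.rev_inj, Fin.rev_last, ← h']
  exact h

lemma index_ofIso_ne_zero {X Y : SSet.{u}} {A : X.Subcomplex} (P : A.Pairing) [P.IsProper]
    {B : Y.Subcomplex} (e : Y ≅ X) (hA : A.preimage e.hom = B)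
    (hP : ∀ (x : P.II) {d : ℕ} (hd : x.1.dim = d), (P.isUniquelyCodimOneFace x).index hd ≠ 0)
    (x : (P.ofIso e hA).II) {d : ℕ} (hd : x.1.dim = d) :
    ((P.ofIso e hA).isUniquelyCodimOneFace x).index hd ≠ 0 := by
  obtain ⟨b, hb⟩ := x
  obtain ⟨a, rfl⟩ := (Subcomplex.N.orderIsoOfIso e hA).symm.surjective b
  simp only [Subcomplex.Pairing.ofIso_II, Set.mem_preimage, OrderIso.apply_symm_apply] at hb
  simpa only [P.ofIso_index e hA ⟨a, hb⟩ hd] using hP ⟨a, hb⟩ hd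

/-- A regular pairing by faces with nonzero index presents an inclusion as a relative cell complex
of the horn inclusions `Λ[n, i] ⟶ Δ[n]` with `0 < i`. -/
lemma llp_rightFibrations_of_pairing {X : SSet.{u}} {A : X.Subcomplex} (P : A.Pairing)
    [P.IsRegular]
    (hP : ∀ (x : P.II) {d : ℕ} (hd : x.1.dim = d), (P.isUniquelyCodimOneFace x).index hd ≠ 0) :
    rightFibrations.llp A.ι :=
  MorphismProperty.transfiniteCompositionsOfShape_le _ _ _
    ⟨P.rankFunction.relativeCellComplex.toTransfiniteCompositionOfShape, fun j hj ↦ by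
      refine (?_ : (_ : MorphismProperty _) ≤ _ ) _
        (P.rankFunction.relativeCellComplex.attachCells j hj).pushouts_coproducts
      simp only [MorphismProperty.pushouts_le_iff, MorphismProperty.coproducts_le_iff]
      rintro _ _ _ ⟨c⟩
      intro _ _ p hp
      exact hp _ _ (Fin.pos_iff_ne_zero.mpr (hP c.s rfl))⟩

lemma index_congr {X : SSet.{u}} {x y y' : X.S} (e : y = y') (hy : x.IsUniquelyCodimOneFace y)
    (hy' : x.IsUniquelyCodimOneFace y') : hy.index rfl = hy'.index rfl := by
  subst e; rfl

lemma index_pairing_ne_last {X : SSet.{u}} {A : X.Subcomplex} (P : A.PairingCore) [P.IsProper]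
    (hP : ∀ s, P.index s ≠ Fin.last _) (x : P.pairing.II) {d : ℕ} (hd : x.1.dim = d) :
    (P.pairing.isUniquelyCodimOneFace x).index hd ≠ Fin.last _ := by
  obtain ⟨s, rfl⟩ := P.equivII.surjective x
  obtain rfl := hd
  have h := index_congr (congr_arg (fun z ↦ z.toS) (P.type₁_pairing s))
    (P.isUniquelyCodimOneFace s) (P.pairing.isUniquelyCodimOneFace (P.equivII s))
  rw [P.isUniquelyCodimOneFace_index] at h
  exact fun h' ↦ hP s (h.trans h')

/-- The pushout-product of the last outer horn inclusion with a boundary inclusion is right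
anodyne. -/
lemma llp_rightFibrations_unionProd (m n : ℕ) :
    rightFibrations.llp
      (Subcomplex.unionProd.{u} Λ[m + 1, Fin.last (m + 1)] ∂Δ[n]).ι := by
  -- the horn is the opposite of `Λ[m + 1, 0]`, for which no index of the pairing is maximal
  obtain ⟨hA, -⟩ : ∃ hA, prodStdSimplex.pairing.{u} (Fin.last (m + 1)) n =
    (prodStdSimplex.pairingCore (0 : Fin (m + 1)) n).pairing.op.ofIso
      (((stdSimplex.opIso _).symm ⊗ᵢ (stdSimplex.opIso _).symm) ≪≫
        Functor.Monoidal.μIso opFunctor _ _) hA := ⟨_, dif_pos rfl⟩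
  apply llp_rightFibrations_of_pairing
    ((prodStdSimplex.pairingCore (0 : Fin (m + 1)) n).pairing.op.ofIso _ hA)
  apply index_ofIso_ne_zero
  apply index_op_ne_zero
  exact index_pairing_ne_last _ fun s ↦ Fin.castSucc_ne_last _

/-- The pushout-product of a monomorphism and an outer horn inclusion has the left lifting
property against right fibrations. -/
lemma IsStrictRightFibration.exists_extension {M N X S : SSet.{u}} {p : X ⟶ S}
    (hp : IsStrictRightFibration p) (m : M ⟶ N) [Mono m] (n : ℕ)
    {a : N ⊗ (Λ[n + 1, Fin.last (n + 1)] : SSet.{u}) ⟶ X} {b : M ⊗ Δ[n + 1] ⟶ X}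
    {c : N ⊗ Δ[n + 1] ⟶ S} (hab : m ▷ _ ≫ a = M ◁ Λ[n + 1, Fin.last (n + 1)].ι ≫ b)
    (ha : a ≫ p = N ◁ Λ[n + 1, Fin.last (n + 1)].ι ≫ c) (hb : b ≫ p = m ▷ _ ≫ c) :
    ∃ l : N ⊗ Δ[n + 1] ⟶ X, N ◁ Λ[n + 1, Fin.last (n + 1)].ι ≫ l = a ∧ m ▷ _ ≫ l = b ∧
      l ≫ p = c := by
  refine exists_extension_of_hasLiftingProperty (Functor.PushoutObjObj.ofHasPushout _ _ _) ?_
    hab ha hb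
  rw [hasLiftingProperty_pushoutObjObj_ι_flip]
  let sq₁₃ := Functor.PullbackObjObj.ofHasPullback MonoidalClosed.internalHom
    Λ[n + 1, Fin.last (n + 1)].ι p
  rw [MonoidalClosed.internalHomAdjunction₂.hasLiftingProperty_iff _ sq₁₃]
  suffices (MorphismProperty.monomorphisms _).rlp sq₁₃.π from this _ inferInstance
  rw [rlp_monomorphisms]
  rintro _ _ _ ⟨k⟩
  rw [← MonoidalClosed.internalHomAdjunction₂.hasLiftingProperty_iff
    (Subcomplex.unionProd.pushoutObjObj.{u} _ _), Subcomplex.unionProd.pushoutObjObj_ι]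
  exact llp_rightFibrations_unionProd n k _ hp

lemma ends.in₀_whiskerLeft {A B : SSet.{u}} (i : A ⟶ B) :
    ends.in₀ A ≫ (ends : SSet.{u}) ◁ i = i ≫ ends.in₀ B := by
  ext1 <;> simp

lemma ends.in₁_whiskerLeft {A B : SSet.{u}} (i : A ⟶ B) :
    ends.in₁ A ≫ (ends : SSet.{u}) ◁ i = i ≫ ends.in₁ B := by
  ext1 <;> simp

/-- An isofibration over a right fibration is a right fibration as soon as the composite is one:
a solution of a lifting problem over the base is equivalent, relative to the horn and over the
base, to a solution of the given problem. -/
lemma isStrictRightFibration_of_comp {X Y S : SSet.{u}} {r : X ⟶ Y} {q : Y ⟶ S}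
    (hr : IsIsofibration r) (hq : IsStrictRightFibration q)
    (hrq : IsStrictRightFibration (r ≫ q)) : IsStrictRightFibration r := by
  intro n i hi
  obtain hn | rfl := (Fin.le_last i).lt_or_eq
  · have := hr.1
    exact innerAnodyneExtensions.horn_ι hi hn _ (mem_innerFibrations r)
  rw [hasLiftingProperty_iff_forall_liftsAt]
  intro σ τ hτ
  -- `l` solves the problem over `S`
  obtain ⟨l, h1, h2⟩ := hasLiftingProperty_iff_forall_liftsAt.1 (hrq n _ hi) σ (τ ≫ q)
    (by rw [reassoc_of% hτ])
  -- a homotopy from `l ≫ r` to `τ`, relative to the horn and over `S`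
  obtain ⟨k, k1, k2, k3⟩ := hq.exists_extension ends.ι n (a := snd _ _ ≫ σ ≫ r)
    (b := ends.desc (l ≫ r) τ) (c := snd _ _ ≫ τ ≫ q) (by
      apply ends.hom_ext
      · rw [reassoc_of% ends.in₀_ι, lift_snd_assoc, Category.id_comp,
          reassoc_of% ends.in₀_whiskerLeft,
          ends.in₀_desc, reassoc_of% h1]
      · rw [reassoc_of% ends.in₁_ι, lift_snd_assoc, Category.id_comp,
          reassoc_of% ends.in₁_whiskerLeft,
          ends.in₁_desc, hτ]) (by simp [reassoc_of% hτ]) (by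
      apply ends.hom_ext
      · rw [reassoc_of% ends.in₀_ι, reassoc_of% ends.in₀_desc, lift_snd_assoc, Category.id_comp,
          Category.assoc, h2]
      · rw [reassoc_of% ends.in₁_ι, reassoc_of% ends.in₁_desc, lift_snd_assoc, Category.id_comp])
  -- its lift to a homotopy out of `l`, constant on the horn, ends at a solution
  obtain ⟨k', k4, k5, k6⟩ := hr.exists_homotopy₀ Λ[n + 1, Fin.last (n + 1)].ι
    (h := snd _ _ ≫ σ) (x := l) (k := k) (by rw [lift_snd_assoc, Category.id_comp, h1])
    (by rw [Category.assoc, k1]) (by rw [← reassoc_of% ends.in₀_ι, k2, ends.in₀_desc])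
  refine ⟨end₁ _ ≫ k', ?_, ?_⟩
  · rw [← reassoc_of% end₁_whiskerLeft, k4, lift_snd_assoc, Category.id_comp]
  · rw [Category.assoc, k6, ← reassoc_of% ends.in₁_ι, k2, ends.in₁_desc]

/-- After replacing `f` by the isofibration `relRepl`, both `q` and the composite with `q` become
strict right fibrations, the composite because it is the replacement of `p` preceded by a trivial
fibration. -/
theorem isRightFibration_of_comp {X Y S : SSet.{u}} [Quasicategory X] [Quasicategory Y]
    [Quasicategory S] {p : X ⟶ S} {q : Y ⟶ S} (f : X ⟶ Y) (w : f ≫ q = p)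
    (hp : IsRightFibration p) (hq : IsRightFibration q) : IsRightFibration f := by
  refine ⟨_, _, (relRepl f w).tgt, inferInstance, inferInstance,
    isStrictRightFibration_of_comp (isIsofibration_relRepl_tgt f w) hq.isStrictRightFibration ?_,
    equivalentFunctors_relRepl_tgt f w⟩
  rw [relRepl_tgt_comp]
  intro n i hi
  rw [hasLiftingProperty_iff_forall_liftsAt]
  intro σ
  have := hp.isStrictRightFibration n i hi
  rw [hasLiftingProperty_iff_forall_liftsAt] at this
  exact (this _).trivial_comp (isTrivialFibration_relRepl_src f w)

end

end

end ICat

theorem mainTheorem12 :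
    (∀ (E D C : SSet.{u}) [SSet.Quasicategory E] [SSet.Quasicategory D] [SSet.Quasicategory C]
      (f : E ⟶ D) (p : E ⟶ C) (q : D ⟶ C) (w : f ≫ q = p),
      ICat.IsCartesianFibration p → ICat.IsCartesianFibration q →
      (∀ e : E _⦋1⦌, ICat.IsCartesianEdge p e → ICat.IsCartesianEdge q (f.app _ e)) →
      (∀ c : C _⦋0⦌, ICat.IsCartesianFibration (ICat.Fibre.map f w c)) →
      ICat.TransitionPreservesCartesian f w →
      ICat.IsCartesianFibration f) ∧
    (∀ (A B C : SSet.{u}) [SSet.Quasicategory A] [SSet.Quasicategory B] [SSet.Quasicategory C]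
      (f : A ⟶ B) (p : A ⟶ C) (q : B ⟶ C), f ≫ q = p →
      ICat.IsRightFibration p → ICat.IsRightFibration q →
      ICat.IsRightFibration f) :=
  ⟨fun _ _ _ _ _ _ f _ _ w hp hq hf hfib htrans ↦
    ICat.isCartesianFibration_of_fibrewise f w hp hq hf hfib htrans,
  fun _ _ _ _ _ _ f _ _ w hp hq ↦ ICat.isRightFibration_of_comp f w hp hq⟩
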